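/- **Setting.** For $n\ge 1$ let $\widetilde S_n$ be the double cover of the symmetric group $S_n$ with generators $z,t_1,\dots,t_{n-1}$ and relations: $z$ central, $z^2=1$, $t_i^2=z$, $t_it_{i+1}t_i=t_{i+1}t_it_{i+1}$, and $t_jt_i=zt_it_j$ for $|i-j|>1$; regard $\widetilde S_n\subset\widetilde S_{n+1}$ in the natural way. With $x_i=t_it_{i+1}\cdots t_{n-1}t_nt_{n-1}\cdots t_{i+1}t_i\in\widetilde S_{n+1}$ ($1\le i\le n$), put $[i_1,\dots,i_m]=x_{i_1}x_{i_m}x_{i_{m-1}}\cdots x_{i_2}x_{i_1}$ for distinct $i_1,\dots,i_m\in\{1,\dots,n\}$, $m>1$; this element lies in $\widetilde S_n$. Let $\mathcal{EP}$ be the set of all partitions (including the empty one) with only even parts; $|\lambda|$ is the sum of the parts of $\lambda$, $\ell(\lambda)$ the number of parts, and $m_i(\lambda)$ the number of parts equal to $i$. For $\lambda\in\mathcal{EP}$ with $|\lambda|+\ell(\lambda)\le n$ let $D_\lambda(n)$ be the conjugacy class in $\widetilde S_n$ of $$[1,\dots,\lambda_1+1]\,[\lambda_1+2,\dots,\lambda_1+\lambda_2+2]\cdots$$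 and let $d_\lambda(n)$ be the image of its class sum in the spin group algebra $\mathbb Z S_n^-=\mathbb Z\widetilde S_n/\langle z+1\rangle$; if $|\lambda|+\ell(\lambda)>n$ let $d_\lambda(n)=0$. Write $d_\lambda(n)d_\mu(n)=\sum_{\nu\in\mathcal{EP}}a_{\lambda\mu}^\nu(n)d_\nu(n)$, where $a_{\lambda\mu}^\nu(n)\in\mathbb Z$ is determined for $n\ge|\nu|+\ell(\nu)$. Let $\mathbb B\subset\mathbb Q[x]$ be the ring of polynomials taking integer values at all integers, let $f_{\lambda\mu}^\nu\in\mathbb B$ be the unique polynomial with $f_{\lambda\mu}^\nu(n)=a_{\lambda\mu}^\nu(n)$ for all $n\ge|\nu|+\ell(\nu)$, and let $\mathcal K$ be the $\mathbb B$-algebra with $\mathbb B$-basis $\{d_\lambda\}_{\lambda\in\mathcal{EP}}$ and multiplication $d_\lambda d_\mu=\sum_{|\nu|\le|\lambda|+|\mu|}f_{\lambda\mu}^\nu d_\nu$. For $0\ne x\in\mathcal K$, $x^*$ denotes its top degree part, where $d_\nu$ has degree $|\nu|$. Write $d_s=d_{(s)}$. Further, $\lambda\cup\mu$ is the partition whose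 multiset of parts is the sum of those of $\lambda$ and $\mu$; $\mu$ is contained in $\lambda$ if $m_i(\mu)\le m_i(\lambda)$ for all $i$, and then $\lambda-\mu$ is obtained by deleting the parts of $\mu$ from $\lambda$; $\trianglerighteq$ is the dominance order on partitions of the same number. **Statement.** Let $\lambda\in\mathcal{EP}$ and let $s>0$ be even. For $|\nu|=|\lambda|+s$ the polynomial $f_{\lambda(s)}^\nu$ is well defined (it exists in $\mathbb B$ and is unique), and the following hold. (A) In $\mathcal K$, $$(d_\lambda d_s)^*=\sum_\mu(-1)^{\ell(\mu)}\frac{(m_{s+|\mu|}(\lambda)+1)\,(s+|\mu|+1)\,s!}{(s+1-\ell(\mu))!\,\prod_{i\ge1}m_i(\mu)!}\;d_{\lambda\cup(s+|\mu|)-\mu},$$ where $\mu$ runs over all partitions in $\mathcal{EP}$ contained in $\lambda$ with $\ell(\mu)\le s+1$; all the coefficients are integers. (B1) If $m=|\lambda|+s$, then $$f_{\lambda(s)}^{(m)}=\frac{(-1)^{\ell(\lambda)}(m+1)\,s!}{(s+1-\ell(\lambda))!\,\prod_{i\ge1}m_i(\lambda)!}\ \text{ if }\ell(\lambda)\le s+1,\qquad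 f_{\lambda(s)}^{(m)}=0\ \text{ otherwise.}$$ (B2) If $\nu=(\nu_1,\nu_2,\dots)\in\mathcal{EP}$ and $|\nu|=|\lambda|+s$, then $f_{\lambda(s)}^\nu=\sum f_{\mu(s)}^{(\nu_i)}$, summed over all pairs $(i,\mu)$ with $1\le i\le\ell(\nu)$, $\mu\in\mathcal{EP}$ and $\mu\cup\nu=\lambda\cup(\nu_i)$. (B3) If $\nu\in\mathcal{EP}$ and $|\nu|=|\lambda|+s$, then $f_{\lambda(s)}^\nu=0$ unless $\nu\trianglerighteq\lambda\cup(s)$. Moreover $f_{\lambda(s)}^{\lambda\cup(s)}$ is a positive integer constant. -/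

import Mathlib

namespace SpinFH

open Polynomial

/-! ### Partitions with even parts -/

/-- A possible part of an even partition: a positive even natural number. -/
abbrev EvenPart : Type := {k : ℕ // 0 < k ∧ Even k}

/-- A partition all of whose parts are (positive and) even, as the multiset of its parts. The union
of two partitions is the sum `+` of multisets, containment as partitions is `≤` on multisets,
deletion of the parts of a contained partition is `-`, the length is `Multiset.card`, the
multiplicity of `i` is `Multiset.count i`. -/
abbrev EvenPartition : Type := Multiset EvenPart

/-- The size `|ν|`, the sum of the parts. -/
def size (ν : EvenPartition) : ℕ := (ν.map Subtype.val).sum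

theorem even_size (ν : EvenPartition) : Even (size ν) := by
  induction ν using Multiset.induction_on with
  | empty => simp [size]
  | cons a t ih =>
    have h : size (a ::ₘ t) = a.1 + size t := by simp [size]
    rw [h]
    exact a.2.2.add ih

/-- The parts in non-increasing order. -/
def sortedParts (ν : EvenPartition) : List EvenPart := ν.sort (fun a b => b ≤ a)

/-- The even number `s + |μ|`, as a part. -/
def addSize (s : EvenPart) (μ : EvenPartition) : EvenPart :=
  ⟨s.1 + size μ, Nat.add_pos_left s.2.1 _, s.2.2.add (even_size μ)⟩

/-- The dominance order on partitions of the same number: `Dominates ν μ` is `ν ⊵ μ`. -/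
def Dominates (ν μ : EvenPartition) : Prop :=
  size ν = size μ ∧
    ∀ k : ℕ, (((sortedParts μ).take k).map Subtype.val).sum ≤
      (((sortedParts ν).take k).map Subtype.val).sum

theorem finite_size_le (m : ℕ) : {ν : EvenPartition | size ν ≤ m}.Finite := by
  have hpos : ∀ ν : EvenPartition, Multiset.card ν ≤ size ν := by
    intro ν
    induction ν using Multiset.induction_on with
    | empty => simp
    | cons a t ih =>
      have h : size (a ::ₘ t) = a.1 + size t := by simp [size]
      have := a.2.1
      rw [h, Multiset.card_cons]
      omega
  have hle : ∀ (ν : EvenPartition) (a : EvenPart), a ∈ ν → a.1 ≤ size ν := fun ν a ha =>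
    Multiset.single_le_sum (fun _ _ => Nat.zero_le _) _ (Multiset.mem_map_of_mem _ ha)
  have hP : {a : EvenPart | a.1 ≤ m}.Finite :=
    Set.Finite.preimage (Subtype.val_injective.injOn) (Set.finite_Iic m)
  refine (Set.finite_Iic (m • hP.toFinset.val)).subset ?_
  intro ν hν
  change size ν ≤ m at hν
  rw [Set.mem_Iic, Multiset.le_iff_count]
  intro a
  by_cases ha : a ∈ ν
  · have h1 : a ∈ hP.toFinset := by simpa using (hle ν a ha).trans hν
    have h2 : 1 ≤ hP.toFinset.val.count a := Multiset.one_le_count_iff_mem.2 h1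
    rw [Multiset.count_nsmul]
    calc ν.count a ≤ Multiset.card ν := Multiset.count_le_card _ _
      _ ≤ m := (hpos ν).trans hν
      _ = m * 1 := (mul_one m).symm
      _ ≤ _ := Nat.mul_le_mul_left m h2
  · rw [Multiset.count_eq_zero_of_notMem ha]
    exact Nat.zero_le _

/-- The finitely many even partitions of size at most `m`. -/
noncomputable def partitionsUpTo (m : ℕ) : Finset EvenPartition := (finite_size_le m).toFinset

/-! ### The double covers of the symmetric groups -/

/-- Generators `z` and `t_1, …, t_{n-1}`. -/
inductive Gen (n : ℕ) : Type
  | z : Gen n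
  | t (i : ℕ) (h : 1 ≤ i ∧ i < n) : Gen n

/-- The word `t_i` for `1 ≤ i < n`; only such `i` are ever used. -/
def word (n i : ℕ) : FreeGroup (Gen n) :=
  if h : 1 ≤ i ∧ i < n then FreeGroup.of (Gen.t i h) else 1

/-- The word `z`. -/
def wordZ (n : ℕ) : FreeGroup (Gen n) := FreeGroup.of Gen.z

/-- The defining relators: `z` is central, `z² = 1`, `t_i² = z`, the braid relations, and
`t_j t_i = z t_i t_j` for `|i - j| > 1`. -/
inductive Relator (n : ℕ) : FreeGroup (Gen n) → Prop
  | central (i : ℕ) (h : 1 ≤ i ∧ i < n) :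
      Relator n (wordZ n * word n i * (word n i * wordZ n)⁻¹)
  | z_sq : Relator n (wordZ n * wordZ n)
  | t_sq (i : ℕ) (h : 1 ≤ i ∧ i < n) : Relator n (word n i * word n i * (wordZ n)⁻¹)
  | braid (i : ℕ) (h : 1 ≤ i ∧ i + 1 < n) :
      Relator n (word n i * word n (i + 1) * word n i *
        (word n (i + 1) * word n i * word n (i + 1))⁻¹)
  | far (i j : ℕ) (hi : 1 ≤ i ∧ i < n) (hj : 1 ≤ j ∧ j < n) (hij : i + 1 < j ∨ j + 1 < i) :
      Relator n (word n j * word n i * (wordZ n * word n i * word n j)⁻¹)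

/-- The double cover of the symmetric group on `n` letters. -/
abbrev Cover (n : ℕ) : Type := PresentedGroup {r : FreeGroup (Gen n) | Relator n r}

/-- The central element `z`. -/
def zElt (n : ℕ) : Cover n := PresentedGroup.mk _ (wordZ n)

/-- The generator `t_i`, `1 ≤ i < n`. -/
def tElt (n i : ℕ) : Cover n := PresentedGroup.mk _ (word n i)

/-- Images of the generators under the natural map to the next double cover. -/
def embedGen (n : ℕ) : Gen n → Cover (n + 1)
  | Gen.z => zElt (n + 1)
  | Gen.t i _ => tElt (n + 1) i

theorem lift_wordZ (n : ℕ) : FreeGroup.lift (embedGen n) (wordZ n) =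
    PresentedGroup.mk {r | Relator (n + 1) r} (wordZ (n + 1)) := by
  simp [wordZ, embedGen, zElt]

theorem lift_word (n i : ℕ) (h : 1 ≤ i ∧ i < n) : FreeGroup.lift (embedGen n) (word n i) =
    PresentedGroup.mk {r | Relator (n + 1) r} (word (n + 1) i) := by
  conv_lhs => rw [word, dif_pos h]
  simp [embedGen, tElt]

theorem embed_rel (n : ℕ) : ∀ r ∈ {r : FreeGroup (Gen n) | Relator n r},
    FreeGroup.lift (embedGen n) r = 1 := by
  intro r hr
  have key : ∀ w : FreeGroup (Gen (n + 1)), Relator (n + 1) w →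
      PresentedGroup.mk {r | Relator (n + 1) r} w = 1 := fun w hw =>
    PresentedGroup.one_of_mem hw
  cases hr with
  | central i h =>
    simpa [lift_wordZ, lift_word n i h] using key _ (Relator.central i ⟨h.1, by omega⟩)
  | z_sq => simpa [lift_wordZ] using key _ Relator.z_sq
  | t_sq i h =>
    simpa [lift_wordZ, lift_word n i h] using key _ (Relator.t_sq i ⟨h.1, by omega⟩)
  | braid i h =>
    simpa [lift_word n i ⟨h.1, by omega⟩, lift_word n (i + 1) ⟨by omega, h.2⟩] using
      key _ (Relator.braid i ⟨h.1, by omega⟩)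
  | far i j hi hj hij =>
    simpa [lift_wordZ, lift_word n i hi, lift_word n j hj] using
      key _ (Relator.far i j ⟨hi.1, by omega⟩ ⟨hj.1, by omega⟩ hij)

/-- The natural embedding of the `n`-th double cover in the next one: `z ↦ z`, `t_i ↦ t_i`. -/
def embed (n : ℕ) : Cover n →* Cover (n + 1) := PresentedGroup.toGroup (embed_rel n)

/-- `x_i = t_i t_{i+1} ⋯ t_{n-1} t_n t_{n-1} ⋯ t_{i+1} t_i`, a lift of the transposition
`(i, n + 1)`, for `1 ≤ i ≤ n`. -/
def xElt (n i : ℕ) : Cover (n + 1) :=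
  ((List.range' i (n - i)).map (tElt (n + 1))).prod * tElt (n + 1) n *
    ((List.range' i (n - i)).reverse.map (tElt (n + 1))).prod

/-- The cycle `[i_1, …, i_m]` on distinct letters of `{1, …, n}`: it is `z` for `m = 1`, and
`x_{i_1} x_{i_m} x_{i_{m-1}} ⋯ x_{i_2} x_{i_1}` for `m > 1`. (The empty list is never used.) -/
def cycleElt (n : ℕ) : List ℕ → Cover (n + 1)
  | [] => 1
  | [_] => zElt (n + 1)
  | i :: j :: l => xElt n i * ((j :: l).reverse.map (xElt n)).prod * xElt n i

/-- `[a, …, a + p_1][a + p_1 + 1, …, a + p_1 + p_2 + 1] ⋯`: disjoint cycles on consecutive letters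
of lengths `p_1 + 1, p_2 + 1, …`, starting at the letter `a`. -/
def cyclesFrom (n : ℕ) : ℕ → List EvenPart → Cover (n + 1)
  | _, [] => 1
  | a, p :: l => cycleElt n (List.range' a (p.1 + 1)) * cyclesFrom n (a + p.1 + 1) l

/-- The distinguished element `t_ν` of modified type `ν`. Cycles are written with the auxiliary
letter `n + 1`; for `|ν| + ℓ(ν) ≤ n` this element lies in the image of `embed n`. -/
def distinguished (n : ℕ) (ν : EvenPartition) : Cover (n + 1) := cyclesFrom n 1 (sortedParts ν)

/-- The even split conjugacy class `D_ν(n)` of the `n`-th double cover: the class of the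
distinguished element of modified type `ν` if `|ν| + ℓ(ν) ≤ n`, and empty otherwise. -/
def splitClass (n : ℕ) (ν : EvenPartition) : Set (Cover n) :=
  {g | size ν + Multiset.card ν ≤ n ∧ ∃ g₀ : Cover n, embed n g₀ = distinguished n ν ∧ IsConj g₀ g}

/-! ### The spin group algebra and its structure constants -/

/-- The relation `z + 1 = 0` in the integral group algebra. -/
def spinRel (n : ℕ) (a b : MonoidAlgebra ℤ (Cover n)) : Prop :=
  a = MonoidAlgebra.of ℤ (Cover n) (zElt n) + 1 ∧ b = 0

/-- The integral spin symmetric group algebra, the quotient of the group algebra of the double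
cover by the two-sided ideal generated by `z + 1`. -/
abbrev SpinAlgebra (n : ℕ) : Type := RingQuot (spinRel n)

/-- The element `d_ν(n)` of the spin group algebra: the image of the sum of the (finite) class
`D_ν(n)`; it is `0` if `|ν| + ℓ(ν) > n`. -/
noncomputable def classSum (n : ℕ) (ν : EvenPartition) : SpinAlgebra n :=
  RingQuot.mkRingHom (spinRel n) (∑ᶠ g ∈ splitClass n ν, MonoidAlgebra.of ℤ (Cover n) g)

/-- `a` is a system of structure constants for the product of `d_lam(n)` and `d_μ(n)`:
`d_lam(n) d_μ(n) = ∑_ν a_ν d_ν(n)`. Here `a_ν` is undetermined if `n < |ν| + ℓ(ν)`. -/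
def IsStructureConstants (n : ℕ) (lam μ : EvenPartition) (a : EvenPartition →₀ ℤ) : Prop :=
  classSum n lam * classSum n μ = a.sum fun ν c => c • classSum n ν

/-- The ring `𝔹` of polynomials that take integer values at all integers. -/
def integerValued : Subring ℚ[X] where
  carrier := {p | ∀ k : ℤ, ∃ m : ℤ, p.eval (k : ℚ) = m}
  mul_mem' {p q} hp hq k := by
    obtain ⟨a, ha⟩ := hp k
    obtain ⟨b, hb⟩ := hq k
    exact ⟨a * b, by simp [ha, hb]⟩
  one_mem' k := ⟨1, by simp⟩
  add_mem' {p q} hp hq k := by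
    obtain ⟨a, ha⟩ := hp k
    obtain ⟨b, hb⟩ := hq k
    exact ⟨a + b, by simp [ha, hb]⟩
  zero_mem' k := ⟨0, by simp⟩
  neg_mem' {p} hp k := by
    obtain ⟨a, ha⟩ := hp k
    exact ⟨-a, by simp [ha]⟩

/-- The integer-valued polynomial `p` gives the structure constants `a_{lam μ}^ν(n)`, i.e. these
exist, are determined, and are equal to `p(n)`, for all `n ≥ |ν| + ℓ(ν)`. -/
def IsStructurePolynomial (lam μ ν : EvenPartition) (p : integerValued) : Prop :=
  ∀ n : ℕ, size ν + Multiset.card ν ≤ n →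
    (∃ a, IsStructureConstants n lam μ a) ∧
      ∀ a, IsStructureConstants n lam μ a → (a ν : ℚ) = p.1.eval (n : ℚ)

open Classical in
/-- The structure polynomial `f_{lam μ}^ν`, the unique integer-valued polynomial with
`a_{lam μ}^ν(n) = f_{lam μ}^ν(n)` for all `n ≥ |ν| + ℓ(ν)`. -/
noncomputable def structurePolynomial (lam μ ν : EvenPartition) : integerValued :=
  if h : ∃ p, IsStructurePolynomial lam μ ν p then h.choose else 0

/-! ### The filtered spin algebra -/

/-- The filtered spin Farahat–Higman algebra `𝒦`, a free `𝔹`-module with basis indexed by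
the even partitions. -/
def K : Type := EvenPartition →₀ integerValued

noncomputable instance : AddCommGroup K :=
  inferInstanceAs (AddCommGroup (EvenPartition →₀ integerValued))

noncomputable instance : Module integerValued K :=
  inferInstanceAs (Module integerValued (EvenPartition →₀ integerValued))

/-- The coordinates of an element of `𝒦`. -/
noncomputable def coords : K ≃ₗ[integerValued] (EvenPartition →₀ integerValued) := LinearEquiv.refl _ _

/-- The basis element `d_ν` of `𝒦`. -/
noncomputable def d (ν : EvenPartition) : K := coords.symm (Finsupp.single ν 1)

/-- The multiplication of `𝒦`: the bilinear extension of
`d_lam d_μ = ∑ f_{lam μ}^ν d_ν`, the sum over the even partitions `ν` with `|ν| ≤ |lam| + |μ|`. -/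
noncomputable instance : Mul K where
  mul x y := (coords x).sum fun lam p => (coords y).sum fun μ q =>
    (p * q) • ∑ ν ∈ partitionsUpTo (size lam + size μ), structurePolynomial lam μ ν • d ν

/-- The degree of a nonzero element of `𝒦`: the largest `|ν|` over the `d_ν` that occur in it. -/
noncomputable def degree (x : K) : ℕ := (coords x).support.sup size

/-- The top degree part `x^*`. -/
noncomputable def topPart (x : K) : K :=
  coords.symm ((coords x).filter fun ν => size ν = degree x)

end SpinFH

open SpinFH

/-! In top degree every structure constant is a signed count of factorizations in the symmetric
group, and all factorizations counted carry the same sign.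

Lifts. Conjugation by an element of sign ε permutes the letters x_i up to a factor 1 or z given by ε
(`embed_mul_letter`). A cycle element on m letters is a word of m + 1 letters, so for odd m no sign
appears. It then depends only on the cycle, disjoint ones commute, and each permutation with odd
cycles gets a canonical lift `oddLift`. The class D_ν consists exactly of the canonical lifts of the
permutations of type ν (`mem_splitClass`). A coset count bounds the order of the cover by 2·n!, and
a Clifford algebra in which z acts as -1 shows z ≠ 1, so the kernel of the map to the symmetric
group is {1, z}.

Coefficients. Modulo z + 1 an element is recorded by the differences a(g) - a(zg) of its
coefficients (`map_sum_smul_of_eq_iff`). Even elements with a cycle of even length are conjugate to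
z times themselves and contribute nothing, so the structure constants exist, and a^ν(n) is
`spinCoeff` at any g in D_ν.

Geometry. Let |ν| = |λ| + s, and let w of type ν be a product pq with p of type λ and q an
(s+1)-cycle. The lengths (points minus cycles) add up, and a dimension count of invariant functions
shows that no cycle of p meets q twice (`eq_of_sameCycle_of_absLength_mul`). Hence pq arises by
cutting one cycle of w into s + 1 consecutive blocks: the cycles of the blocks belong to p and the
last letters of the blocks form q (`exists_isGoodBlocks`). On lifts, each block with at least two
letters costs one z, and the number of such blocks is ℓ(λ) + 1 - ℓ(ν) for every factorization
(`oddLift_mul_oddLift`).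

Counting. A cut is a starting point on a cycle of w together with a composition of its length. The
parts larger than 1 of the composition are prescribed: they come from μ, where μ ∪ ν = λ ∪ (k) and k
+ 1 is the length of the cycle. The multinomial formula for such compositions gives `topCoeff`, and
summing over the parts k of ν gives `topValue` (`spinCoeff_eq_topValue`). This number does not
involve n, so the structure polynomial is this constant. The top degree formula is a regrouping of
the sum over k by μ. Dominance holds because a nonzero coefficient forces ν to arise from λ ∪ (s) by
merging the part s with the parts in μ. -/

namespace SpinFH

open Equiv Equiv.Perm

/-! ### Basic relations in the double covers -/

section Anticommute

variable {G : Type*} [Group G]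

/-- Moving a past three factors produces z³ = z. This is the inductive step for words built as x_i =
t_i x_{i+1} t_i. -/
theorem anticomm_conj {z a t x : G} (hz : ∀ g, z * g = g * z) (hz2 : z * z = 1)
    (h1 : a * t = z * (t * a)) (h2 : a * x = z * (x * a)) :
    a * (t * x * t) = z * (t * x * t * a) := by
  calc a * (t * x * t) = (a * t) * x * t := by group
    _ = z * t * (a * x) * t := by rw [h1]; group
    _ = z * (t * z) * x * (a * t) := by rw [h2]; group
    _ = z * (t * z) * x * (z * t * a) := by rw [h1]; group
    _ = z * z * t * (x * z) * t * a := by rw [← hz t]; group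
    _ = z * z * t * (z * x) * t * a := by rw [hz x]
    _ = (z * z) * (t * z) * x * t * a := by group
    _ = (z * z) * (z * t) * x * t * a := by rw [hz t]
    _ = z * (t * x * t * a) := by rw [hz2]; group

end Anticommute

theorem zElt_mul_self (n : ℕ) : zElt n * zElt n = 1 := by
  have h := PresentedGroup.one_of_mem (rels := {r | Relator n r}) (Relator.z_sq (n := n))
  simpa [zElt] using h

theorem zElt_inv (n : ℕ) : (zElt n)⁻¹ = zElt n :=
  inv_eq_of_mul_eq_one_left (zElt_mul_self n)

theorem tElt_of (n i : ℕ) (h : 1 ≤ i ∧ i < n) :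
    tElt n i = PresentedGroup.of (rels := {r | Relator n r}) (Gen.t i h) := by
  simp only [tElt, word, dif_pos h]; rfl

@[elab_as_elim]
theorem cover_induction {n : ℕ} {P : Cover n → Prop} (g : Cover n) (one : P 1)
    (mul : ∀ a b, P a → P b → P (a * b)) (inv : ∀ a, P a → P a⁻¹) (hz : P (zElt n))
    (ht : ∀ i, 1 ≤ i → i < n → P (tElt n i)) : P g := by
  obtain ⟨w, rfl⟩ := PresentedGroup.mk_surjective _ g
  induction w using FreeGroup.induction_on with
  | C1 => simpa using one
  | of x =>
    cases x with
    | z => exact hz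
    | t i h =>
      have := ht i h.1 h.2
      rwa [tElt_of n i h] at this
  | inv_of x h => rw [map_inv]; exact inv _ h
  | mul a b ha hb => rw [map_mul]; exact mul _ _ ha hb

theorem zElt_comm {n : ℕ} (g : Cover n) : zElt n * g = g * zElt n := by
  induction g using cover_induction with
  | one => simp
  | mul a b ha hb => rw [← mul_assoc, ha, mul_assoc, hb, mul_assoc]
  | inv a ha =>
    rw [eq_inv_mul_iff_mul_eq, ← mul_assoc, ← ha, mul_assoc, mul_inv_cancel, mul_one]
  | hz => rfl
  | ht i h1 h2 =>
    have h := PresentedGroup.one_of_mem (rels := {r | Relator n r})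
      (Relator.central (n := n) i ⟨h1, h2⟩)
    rw [map_mul, map_inv, mul_inv_eq_one] at h
    simpa [zElt, tElt] using h

theorem tElt_sq {n i : ℕ} (h1 : 1 ≤ i) (h2 : i < n) : tElt n i * tElt n i = zElt n := by
  have h := PresentedGroup.one_of_mem (rels := {r | Relator n r})
    (Relator.t_sq (n := n) i ⟨h1, h2⟩)
  rw [map_mul, map_inv, mul_inv_eq_one] at h
  simpa [zElt, tElt] using h

theorem tElt_braid {n i : ℕ} (h1 : 1 ≤ i) (h2 : i + 1 < n) :
    tElt n i * tElt n (i + 1) * tElt n i = tElt n (i + 1) * tElt n i * tElt n (i + 1) := by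
  have h := PresentedGroup.one_of_mem (rels := {r | Relator n r})
    (Relator.braid (n := n) i ⟨h1, h2⟩)
  rw [map_mul, map_inv, mul_inv_eq_one] at h
  simpa [zElt, tElt] using h

theorem tElt_far {n i j : ℕ} (hi : 1 ≤ i ∧ i < n) (hj : 1 ≤ j ∧ j < n)
    (hij : i + 1 < j ∨ j + 1 < i) :
    tElt n j * tElt n i = zElt n * (tElt n i * tElt n j) := by
  have h := PresentedGroup.one_of_mem (rels := {r | Relator n r})
    (Relator.far (n := n) i j hi hj hij)
  rw [map_mul, map_inv, mul_inv_eq_one] at h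
  simpa [zElt, tElt, mul_assoc] using h

theorem tElt_inv {n i : ℕ} (h1 : 1 ≤ i) (h2 : i < n) :
    (tElt n i)⁻¹ = zElt n * tElt n i := by
  rw [inv_eq_iff_mul_eq_one, zElt_comm, ← mul_assoc, tElt_sq h1 h2, zElt_mul_self]

/-- The homomorphism `ℤˣ → Cover n` that sends `-1` to `z`. -/
def signElt (n : ℕ) : ℤˣ →* Cover n where
  toFun u := if u = 1 then 1 else zElt n
  map_one' := by simp
  map_mul' u v := by
    rcases Int.units_eq_one_or u with rfl | rfl <;> rcases Int.units_eq_one_or v with rfl | rfl <;>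
      simp [zElt_mul_self]

theorem signElt_neg_one (n : ℕ) : signElt n (-1) = zElt n := by simp [signElt]

theorem signElt_comm {n : ℕ} (u : ℤˣ) (g : Cover n) : signElt n u * g = g * signElt n u := by
  rcases Int.units_eq_one_or u with rfl | rfl
  · simp
  · rw [signElt_neg_one, zElt_comm]

theorem embed_zElt (n : ℕ) : embed n (zElt n) = zElt (n + 1) := by
  exact PresentedGroup.toGroup.of (embed_rel n) (x := Gen.z)

theorem embed_tElt (n i : ℕ) (h : 1 ≤ i ∧ i < n) : embed n (tElt n i) = tElt (n + 1) i := by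
  rw [tElt_of n i h]
  exact PresentedGroup.toGroup.of (embed_rel n)

theorem embed_signElt (n : ℕ) (u : ℤˣ) : embed n (signElt n u) = signElt (n + 1) u := by
  rcases Int.units_eq_one_or u with rfl | rfl
  · simp
  · rw [signElt_neg_one, signElt_neg_one, embed_zElt]

/-! ### The permutation of an element of the double cover -/

/-- The permutations of the generators. -/
def permGen (n : ℕ) : Gen n → Perm (Fin n)
  | Gen.z => 1
  | Gen.t i h => swap ⟨i - 1, by omega⟩ ⟨i, h.2⟩

theorem lift_permGen_word (n i : ℕ) (h : 1 ≤ i ∧ i < n) :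
    FreeGroup.lift (permGen n) (word n i) = swap ⟨i - 1, by omega⟩ ⟨i, h.2⟩ := by
  conv_lhs => rw [word, dif_pos h]
  simp [permGen]

theorem lift_permGen_wordZ (n : ℕ) : FreeGroup.lift (permGen n) (wordZ n) = 1 := by
  simp [wordZ, permGen]

theorem permGen_rel (n : ℕ) : ∀ r ∈ {r : FreeGroup (Gen n) | Relator n r},
    FreeGroup.lift (permGen n) r = 1 := by
  intro r hr
  cases hr with
  | central i h => simp [lift_permGen_wordZ]
  | z_sq => simp [lift_permGen_wordZ]
  | t_sq i h => simp [lift_permGen_wordZ, lift_permGen_word n i h]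
  | braid i h =>
    rw [map_mul, map_inv, mul_inv_eq_one]
    simp only [map_mul, lift_permGen_word n i ⟨h.1, by omega⟩,
      lift_permGen_word n (i + 1) ⟨by omega, h.2⟩]
    have h1 : (⟨i - 1, by omega⟩ : Fin n) ≠ ⟨i, by omega⟩ := by simp; omega
    have h2 : (⟨i - 1, by omega⟩ : Fin n) ≠ ⟨i + 1, by omega⟩ := by simp
    have h3 : (⟨i, by omega⟩ : Fin n) ≠ ⟨i + 1, h.2⟩ := by simp
    simp only [Nat.add_sub_cancel]
    generalize (⟨i - 1, _⟩ : Fin n) = a at *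
    generalize (⟨i, _⟩ : Fin n) = b at *
    generalize (⟨i + 1, _⟩ : Fin n) = c at *
    have e1 := swap_mul_swap_mul_swap h3.symm h2.symm
    have e2 := swap_mul_swap_mul_swap h1 h2
    rw [swap_comm a b, swap_comm b c, e1, swap_comm b a, swap_comm c b, e2, swap_comm]
  | far i j hi hj hij =>
    rw [map_mul, map_inv, mul_inv_eq_one]
    simp only [map_mul, lift_permGen_word n i hi, lift_permGen_word n j hj, lift_permGen_wordZ,
      one_mul]
    refine (Perm.Disjoint.commute ?_).eq
    rw [Perm.disjoint_iff_disjoint_support, support_swap (by simp; omega),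
      support_swap (by simp; omega)]
    simp
    omega

/-- The permutation of an element of the double cover. -/
def perm (n : ℕ) : Cover n →* Perm (Fin n) := PresentedGroup.toGroup (permGen_rel n)

theorem perm_zElt (n : ℕ) : perm n (zElt n) = 1 :=
  PresentedGroup.toGroup.of (permGen_rel n) (x := Gen.z)

theorem perm_tElt {n i : ℕ} (h1 : 1 ≤ i) (h2 : i < n) :
    perm n (tElt n i) = swap ⟨i - 1, by omega⟩ ⟨i, h2⟩ := by
  rw [tElt_of n i ⟨h1, h2⟩]
  exact PresentedGroup.toGroup.of (permGen_rel n)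

theorem perm_signElt (n : ℕ) (u : ℤˣ) : perm n (signElt n u) = 1 := by
  rcases Int.units_eq_one_or u with rfl | rfl
  · simp
  · rw [signElt_neg_one, perm_zElt]

theorem perm_surjective (n : ℕ) : Function.Surjective (perm n) := by
  rw [← MonoidHom.range_eq_top, eq_top_iff]
  cases n with
  | zero => intro σ _; exact ⟨1, Subsingleton.elim _ _⟩
  | succ n =>
    have h := Equiv.Perm.mclosure_swap_castSucc_succ n
    intro σ _
    have hσ : σ ∈ (⊤ : Submonoid (Perm (Fin (n + 1)))) := trivial
    rw [← h] at hσ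
    refine (Submonoid.closure_le (S := (perm (n + 1)).range.toSubmonoid)).2 ?_ hσ
    rintro _ ⟨i, rfl⟩
    refine ⟨tElt (n + 1) (i + 1), ?_⟩
    rw [perm_tElt (by omega) (by omega)]
    rfl

/-! ### The lifts `x_i` of transpositions -/

theorem xElt_self (n : ℕ) : xElt n n = tElt (n + 1) n := by simp [xElt]

theorem xElt_succ {n i : ℕ} (h : i < n) :
    xElt n i = tElt (n + 1) i * xElt n (i + 1) * tElt (n + 1) i := by
  obtain ⟨k, rfl⟩ : ∃ k, n = i + 1 + k := ⟨n - (i + 1), by omega⟩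
  have h1 : i + 1 + k - i = k + 1 := by omega
  have h2 : i + 1 + k - (i + 1) = k := by omega
  simp only [xElt, h1, h2, List.range'_succ, List.map_cons, List.prod_cons, List.reverse_cons,
    List.map_append, List.prod_append, List.map_nil, List.prod_nil, mul_one, mul_assoc]

theorem xElt_sq {n i : ℕ} (h1 : 1 ≤ i) (h2 : i ≤ n) :
    xElt n i * xElt n i = zElt (n + 1) := by
  revert h1
  induction h2 using Nat.decreasingInduction with
  | self => intro h1; rw [xElt_self, tElt_sq h1 (by omega)]
  | of_succ i h ih =>
    intro h1
    have ih := ih (by omega)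
    have ht := tElt_sq (n := n + 1) h1 (by omega)
    rw [xElt_succ h]
    generalize tElt (n + 1) i = t at *
    generalize xElt n (i + 1) = x at *
    calc t * x * t * (t * x * t) = (t * x) * (t * t) * (x * t) := by group
      _ = zElt (n + 1) * (t * x) * (x * t) := by rw [ht, ← zElt_comm (t * x)]
      _ = zElt (n + 1) * t * (x * x) * t := by group
      _ = zElt (n + 1) * zElt (n + 1) * (t * t) := by
        rw [ih, mul_assoc _ t, ← zElt_comm t]; group
      _ = zElt (n + 1) := by rw [zElt_mul_self, one_mul, ht]

/-- All generators in x_i are far from t_j and there is an odd number of them; hence the single z.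
-/
theorem tElt_mul_xElt_of_lt {n i j : ℕ} (hj : 1 ≤ j) (hij : j + 1 < i) (hi : i ≤ n) :
    tElt (n + 1) j * xElt n i = zElt (n + 1) * (xElt n i * tElt (n + 1) j) := by
  revert hij
  induction hi using Nat.decreasingInduction with
  | self =>
    intro hij
    rw [xElt_self]
    exact tElt_far ⟨by omega, by omega⟩ ⟨by omega, by omega⟩ (Or.inr hij)
  | of_succ i h ih =>
    intro hij
    rw [xElt_succ h]
    exact anticomm_conj zElt_comm (zElt_mul_self _)
      (tElt_far ⟨by omega, by omega⟩ ⟨by omega, by omega⟩ (Or.inr hij)) (ih (by omega))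

/-- Here t_j itself occurs in x_i. In the base case i = j - 1 the braid relation turns t_j into
t_{j-1}, which passes x_{j+1} at the cost of z and is turned back by a second braid relation. -/
theorem tElt_mul_xElt_of_gt {n i j : ℕ} (hi : 1 ≤ i) (hij : i < j) (hj : j < n) :
    tElt (n + 1) j * xElt n i = zElt (n + 1) * (xElt n i * tElt (n + 1) j) := by
  obtain ⟨m, hm⟩ : ∃ m, m + 1 = j := ⟨j - 1, by omega⟩
  have him : i ≤ m := by omega
  revert hi hij
  induction him using Nat.decreasingInduction with
  | self =>
    intro hi hij
    subst hm
    rw [xElt_succ (by omega : m < n), xElt_succ (by omega : m + 1 < n)]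
    have hb := tElt_braid (n := n + 1) (i := m) hi (by omega)
    have hx := tElt_mul_xElt_of_lt hi (show m + 1 < m + 2 by omega) (show m + 2 ≤ n by omega)
    generalize tElt (n + 1) m = a at *
    generalize tElt (n + 1) (m + 1) = b at *
    generalize xElt n (m + 1 + 1) = x at *
    calc b * (a * (b * x * b) * a) = (b * a * b) * x * b * a := by group
      _ = (a * b * a) * x * b * a := by rw [hb]
      _ = a * b * (a * x) * b * a := by group
      _ = (a * b) * zElt (n + 1) * (x * (a * b * a)) := by rw [hx]; group
      _ = _ := by rw [hb, ← zElt_comm (a * b)]; group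
  | of_succ i h ih =>
    intro hi hij
    rw [xElt_succ (by omega)]
    exact anticomm_conj zElt_comm (zElt_mul_self _)
      (tElt_far ⟨by omega, by omega⟩ ⟨by omega, by omega⟩ (by omega)) (ih (by omega) (by omega))

/-- `x_i`, with the letters numbered from `0`. -/
def letter (n : ℕ) (i : Fin n) : Cover (n + 1) := xElt n (i + 1)

theorem letter_mul_self {n : ℕ} (i : Fin n) : letter n i * letter n i = zElt (n + 1) :=
  xElt_sq (by omega) (by omega)

theorem tElt_conj_letter {n j : ℕ} (h1 : 1 ≤ j) (h2 : j < n) (i : Fin n) :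
    tElt (n + 1) j * letter n i =
      zElt (n + 1) * letter n (swap ⟨j - 1, by omega⟩ ⟨j, h2⟩ i) * tElt (n + 1) j := by
  have ht := tElt_sq (n := n + 1) h1 (by omega)
  have hx : xElt n j = tElt (n + 1) j * xElt n (j + 1) * tElt (n + 1) j := xElt_succ h2
  obtain ⟨i, hi⟩ := i
  by_cases ha : i = j - 1
  · subst ha
    rw [swap_apply_left]
    have e : j - 1 + 1 = j := by omega
    simp only [letter, e]
    rw [hx, ← ht]; group
  · by_cases hb : i = j
    · subst hb
      rw [swap_apply_right]
      have e : i - 1 + 1 = i := by omega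
      simp only [letter, e]
      rw [hx]
      calc _ = zElt (n + 1) * zElt (n + 1) * (tElt (n + 1) i * xElt n (i + 1)) := by
            rw [zElt_mul_self, one_mul]
        _ = zElt (n + 1) * (tElt (n + 1) i * xElt n (i + 1)) * zElt (n + 1) := by
            rw [mul_assoc, zElt_comm (_ * _)]
        _ = _ := by rw [← ht]; group
    · rw [swap_apply_of_ne_of_ne (by simpa using ha) (by simpa using hb)]
      simp only [letter]
      rw [mul_assoc]
      rcases lt_or_gt_of_ne ha with h | h
      · exact tElt_mul_xElt_of_gt (by omega) (by omega) h2
      · exact tElt_mul_xElt_of_lt h1 (by omega) (by omega)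

/-- The sign of an element of the double cover. -/
def sgn {n : ℕ} (g : Cover n) : ℤˣ := Perm.sign (perm n g)

theorem sgn_mul {n : ℕ} (g h : Cover n) : sgn (g * h) = sgn g * sgn h := by simp [sgn]

/-- The source of all signs: the letters behave like anticommuting basis vectors permuted by the
symmetric group. On words with an even number of letters the sign disappears. -/
theorem embed_mul_letter {n : ℕ} (g : Cover n) (i : Fin n) :
    embed n g * letter n i = signElt (n + 1) (sgn g) * letter n (perm n g i) * embed n g := by
  induction g using cover_induction generalizing i with
  | one => simp [sgn]
  | mul a b ha hb =>
    rw [map_mul, mul_assoc, hb, sgn_mul, map_mul, mul_assoc, ← mul_assoc (embed n a),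
      ← signElt_comm, mul_assoc (signElt _ _), ← mul_assoc (embed n a), ha, map_mul, Perm.mul_apply,
      ← mul_assoc (signElt _ _), ← mul_assoc (signElt _ _), ← mul_assoc (signElt _ _),
      signElt_comm (sgn b)]
    simp only [mul_assoc]
  | inv a ha =>
    have h := ha ((perm n a)⁻¹ i)
    rw [show perm n a ((perm n a)⁻¹ i) = i by simp] at h
    rw [map_inv, inv_mul_eq_iff_eq_mul, ← mul_assoc, ← mul_assoc, eq_mul_inv_iff_mul_eq, 
      ← signElt_comm, mul_assoc (signElt _ _), map_inv, h, mul_assoc, ← mul_assoc (signElt _ _),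
      ← map_mul]
    simp [sgn]
  | hz => simp [sgn, perm_zElt, embed_zElt, zElt_comm]
  | ht j h1 h2 =>
    rw [embed_tElt n j ⟨h1, h2⟩, tElt_conj_letter h1 h2, sgn, perm_tElt h1 h2, sign_swap,
      signElt_neg_one]
    simp; omega

/-! ### The order of the double cover -/

-- Inverses of generators are again products of generators, because z⁻¹ = z and t_i⁻¹ = z t_i, so
-- the inverse step can be dropped.
@[elab_as_elim]
theorem cover_induction_mul {n : ℕ} {P : Cover n → Prop} (g : Cover n) (one : P 1)
    (mul : ∀ a b, P a → P b → P (a * b)) (hz : P (zElt n))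
    (ht : ∀ i, 1 ≤ i → i < n → P (tElt n i)) : P g := by
  obtain ⟨w, rfl⟩ := PresentedGroup.mk_surjective _ g
  have hof : ∀ x, P (PresentedGroup.mk _ (FreeGroup.of x)) := by
    intro x
    cases x with
    | z => exact hz
    | t i h =>
      have := ht i h.1 h.2
      rwa [tElt_of n i h] at this
  induction w using FreeGroup.induction_on with
  | C1 => simpa using one
  | of x => exact hof x
  | inv_of x hx =>
    rw [map_inv]
    cases x with
    | z => rw [show (PresentedGroup.mk _ (FreeGroup.of Gen.z) : Cover n) = zElt n from rfl,
        zElt_inv]; exact hz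
    | t i h =>
      rw [show (PresentedGroup.mk _ (FreeGroup.of (Gen.t i h)) : Cover n) = tElt n i from
        (tElt_of n i h).symm, tElt_inv h.1 h.2]
      exact mul _ _ hz (ht i h.1 h.2)
  | mul a b ha hb => rw [map_mul]; exact mul _ _ ha hb

/-- The product of the letters in a list. -/
def letters (n : ℕ) (l : List (Fin n)) : Cover (n + 1) := (l.map (letter n)).prod

theorem letters_nil (n : ℕ) : letters n [] = 1 := rfl

theorem letters_cons {n : ℕ} (i : Fin n) (l : List (Fin n)) :
    letters n (i :: l) = letter n i * letters n l := by simp [letters]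

theorem letters_append {n : ℕ} (l l' : List (Fin n)) :
    letters n (l ++ l') = letters n l * letters n l' := by simp [letters]

theorem embed_mul_letters {n : ℕ} (g : Cover n) (l : List (Fin n)) :
    embed n g * letters n l =
      signElt (n + 1) (sgn g ^ l.length) * letters n (l.map (perm n g)) * embed n g := by
  induction l with
  | nil => simp [letters_nil]
  | cons i l ih =>
    rw [letters_cons, ← mul_assoc, embed_mul_letter, mul_assoc, ih, List.map_cons, letters_cons,
      List.length_cons, pow_succ', map_mul]
    have h := signElt_comm (sgn g ^ l.length) (letter n (perm n g i))
    simp only [← mul_assoc]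
    rw [mul_assoc (signElt _ _) (letter n _), ← h]
    simp only [mul_assoc]

theorem letter_last_conj {k : ℕ} :
    letter (k + 2) ⟨k + 1, by omega⟩ * letter (k + 2) ⟨k, by omega⟩ *
      letter (k + 2) ⟨k + 1, by omega⟩ = embed (k + 2) (tElt (k + 2) (k + 1)) := by
  rw [embed_tElt _ _ ⟨by omega, by omega⟩]
  simp only [letter]
  rw [xElt_succ (show k + 1 < k + 2 by omega), xElt_self, tElt_braid (by omega) (by omega)]
  have h := tElt_sq (n := k + 3) (i := k + 2) (by omega) (by omega)
  generalize tElt (k + 2 + 1) (k + 1 + 1) = a at *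
  generalize tElt (k + 2 + 1) (k + 1) = b at *
  calc a * (a * b * a) * a = (a * a) * b * (a * a) := by group
    _ = b := by rw [h, zElt_comm, mul_assoc, zElt_mul_self, mul_one]

theorem exists_perm_apply {α : Type*} [DecidableEq α] {a b c d : α} (hab : a ≠ b) (hcd : c ≠ d) :
    ∃ σ : Perm α, σ a = c ∧ σ b = d := by
  refine ⟨swap a c * swap b (swap a c d), ?_, ?_⟩
  · rw [Perm.mul_apply, swap_apply_of_ne_of_ne hab, swap_apply_left]
    intro h
    have h := congrArg (swap a c) h
    rw [swap_apply_self, swap_apply_left] at h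
    exact hcd h
  · rw [Perm.mul_apply, swap_apply_left, swap_apply_self]

/-- For the last two letters the word is t_{n-1}. Any other pair is reached by conjugating with a
lift of a suitable permutation, and the resulting sign, sgn³ = sgn, is absorbed into the preimage.
-/
theorem exists_embed_eq_letter_conj {n : ℕ} {a b : Fin n} (hab : a ≠ b) :
    ∃ g : Cover n, embed n g = letter n a * letter n b * letter n a ∧ perm n g = swap a b := by
  obtain ⟨k, rfl⟩ : ∃ k, n = k + 2 := by
    have h1 := a.2
    have h2 := b.2
    have h3 : (a : ℕ) ≠ b := fun h => hab (Fin.ext h)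
    exact ⟨n - 2, by omega⟩
  obtain ⟨σ, h1, h2⟩ := exists_perm_apply (a := (⟨k + 1, by omega⟩ : Fin (k + 2)))
    (b := ⟨k, by omega⟩) (by simp) hab
  obtain ⟨g, rfl⟩ := perm_surjective _ σ
  refine ⟨signElt _ (sgn g) * (g * tElt (k + 2) (k + 1) * g⁻¹), ?_, ?_⟩
  · have h := embed_mul_letters g [⟨k + 1, by omega⟩, ⟨k, by omega⟩, ⟨k + 1, by omega⟩]
    have hs : sgn g ^ 3 = sgn g := by rw [pow_succ, sq, Int.units_mul_self, one_mul]
    simp only [letters, List.map_cons, List.map_nil, List.prod_cons, List.prod_nil, mul_one, h1, h2,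
      List.length_cons, List.length_nil, zero_add, Nat.reduceAdd, hs] at h
    rw [← mul_assoc (letter _ _), letter_last_conj] at h
    rw [map_mul, map_mul, map_mul, h, map_inv, mul_inv_cancel_right, embed_signElt, ← mul_assoc,
      ← map_mul, Int.units_mul_self, map_one, one_mul, mul_assoc]
  · rw [map_mul, map_mul, map_mul, perm_signElt, map_inv, perm_tElt (by omega) (by omega), one_mul,
      ← swap_apply_apply, swap_comm]
    exact congrArg₂ _ h1 h2

/-- At most n + 1 cosets of the smaller cover fill the larger one, represented by 1 and the letters.
This bounds the order by induction. -/
theorem exists_embed_or_mul_letter {n : ℕ} (y : Cover (n + 1)) :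
    ∃ g : Cover n, y = embed n g ∨ ∃ i, y = embed n g * letter n i := by
  -- The statement is strengthened to stability of the union of cosets under right multiplication by
  -- y, a property that passes to products.
  suffices H : ∀ x : Cover (n + 1), (∃ g : Cover n, x = embed n g ∨ ∃ i, x = embed n g * letter n i) →
      ∃ g : Cover n, x * y = embed n g ∨ ∃ i, x * y = embed n g * letter n i by
    simpa using H 1 ⟨1, Or.inl (by simp)⟩
  induction y using cover_induction_mul with
  | one => simp
  | mul a b ha hb => 
    intro x hx
    rw [← mul_assoc]
    exact hb _ (ha _ hx)
  | hz =>
    rintro x ⟨g, rfl | ⟨i, rfl⟩⟩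
    · exact ⟨g * zElt n, Or.inl (by rw [map_mul, embed_zElt])⟩
    · refine ⟨g * zElt n, Or.inr ⟨i, ?_⟩⟩
      rw [map_mul, embed_zElt, mul_assoc, mul_assoc, zElt_comm]
  | ht j h1 h2 =>
    rcases Nat.lt_succ_iff_lt_or_eq.1 h2 with h2 | rfl
    · rintro x ⟨g, rfl | ⟨i, rfl⟩⟩
      · exact ⟨g * tElt n j, Or.inl (by rw [map_mul, embed_tElt _ _ ⟨h1, h2⟩])⟩
      · refine ⟨g * tElt n j * zElt n, Or.inr ⟨swap ⟨j - 1, by omega⟩ ⟨j, h2⟩ i, ?_⟩⟩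
        have h := tElt_conj_letter h1 h2 (swap ⟨j - 1, by omega⟩ ⟨j, h2⟩ i)
        rw [swap_apply_self] at h
        rw [map_mul, map_mul, embed_tElt _ _ ⟨h1, h2⟩, embed_zElt, mul_assoc (_ * _),
          zElt_comm, mul_assoc _ _ (letter _ _ * _), ← mul_assoc _ (letter _ _), h]
        simp only [← mul_assoc]
        rw [← zElt_comm (_ * tElt (n + 1) j)]
        simp only [← mul_assoc]
        rw [zElt_comm (embed n g), mul_assoc (embed n g) _ (zElt (n + 1)), zElt_mul_self, mul_one]
    · have hl : tElt (j + 1) j = letter j ⟨j - 1, by omega⟩ := by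
        have e : j - 1 + 1 = j := by omega
        simp only [letter, e, xElt_self]
      rw [hl]
      generalize (⟨j - 1, _⟩ : Fin j) = b
      rintro x ⟨g, rfl | ⟨i, rfl⟩⟩
      · exact ⟨g, Or.inr ⟨_, rfl⟩⟩
      · by_cases hi : i = b
        · subst hi
          exact ⟨g * zElt j, Or.inl (by rw [mul_assoc, letter_mul_self, map_mul, embed_zElt])⟩
        -- With k = x_i x_b x_i one has k x_i = z x_i x_b, so x_i x_b = z k x_i lies in the coset of
        -- x_i.
        · obtain ⟨k, hk, -⟩ := exists_embed_eq_letter_conj hi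
          refine ⟨g * zElt j * k, Or.inr ⟨i, ?_⟩⟩
          rw [map_mul, map_mul, hk, embed_zElt, mul_assoc, mul_assoc, mul_assoc,
            mul_assoc (_ * _), letter_mul_self, ← zElt_comm, ← mul_assoc (zElt _) (zElt _),
            zElt_mul_self, one_mul]

theorem eq_one_or_zElt_of_zero (g : Cover 0) : g = 1 ∨ g = zElt 0 := by
  induction g using cover_induction_mul with
  | one => simp
  | mul a b ha hb =>
    rcases ha with rfl | rfl <;> rcases hb with rfl | rfl <;> simp [zElt_mul_self]
  | hz => simp
  | ht i h1 h2 => omega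

theorem finite_and_card_cover_le (n : ℕ) : Finite (Cover n) ∧ Nat.card (Cover n) ≤ 2 * n.factorial := by
  induction n with
  | zero =>
    have hs : Function.Surjective (fun b : Bool => if b then (1 : Cover 0) else zElt 0) := by
      intro g
      rcases eq_one_or_zElt_of_zero g with rfl | rfl
      · exact ⟨true, by simp⟩
      · exact ⟨false, by simp⟩
    exact ⟨Finite.of_surjective _ hs, by simpa using Nat.card_le_card_of_surjective _ hs⟩
  | succ n ih =>
    obtain ⟨_, ih⟩ := ih
    have hs : Function.Surjective (fun p : Cover n × Option (Fin n) =>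
        p.2.elim (embed n p.1) fun i => embed n p.1 * letter n i) := by
      intro y
      obtain ⟨g, h | ⟨i, h⟩⟩ := exists_embed_or_mul_letter y
      · exact ⟨(g, none), h.symm⟩
      · exact ⟨(g, some i), h.symm⟩
    refine ⟨Finite.of_surjective _ hs, (Nat.card_le_card_of_surjective _ hs).trans ?_⟩
    rw [Nat.card_prod, Nat.factorial_succ, Finite.card_option, Nat.card_fin]
    nlinarith

instance (n : ℕ) : Finite (Cover n) := (finite_and_card_cover_le n).1

/-! ### The element `z` is nontrivial -/

section Clifford

variable (n : ℕ)

/-- The negative definite form in which the simple roots have square `-1`. -/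
noncomputable def rootForm : QuadraticForm ℚ (Fin n → ℚ) :=
  (-(1 / 2) : ℚ) • QuadraticMap.weightedSumSquares ℚ (fun _ : Fin n => (1 : ℚ))

theorem rootForm_apply (v : Fin n → ℚ) : rootForm n v = -(1 / 2) * ∑ i, v i * v i := by
  simp [rootForm, QuadraticMap.weightedSumSquares_apply]

theorem polar_rootForm (u v : Fin n → ℚ) :
    QuadraticMap.polar (rootForm n) u v = -∑ i, u i * v i := by
  simp only [QuadraticMap.polar, rootForm_apply, Pi.add_apply, Finset.mul_sum,
    ← Finset.sum_sub_distrib, ← Finset.sum_neg_distrib]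
  exact Finset.sum_congr rfl fun i _ => by ring

/-- The simple roots. -/
def root (i : ℕ) (h : 1 ≤ i ∧ i < n) : Fin n → ℚ :=
  Pi.single ⟨i - 1, by omega⟩ 1 - Pi.single ⟨i, h.2⟩ 1

theorem sum_root_mul_root (i j : ℕ) (hi : 1 ≤ i ∧ i < n) (hj : 1 ≤ j ∧ j < n) :
    ∑ k, root n i hi k * root n j hj k =
      if i = j then 2 else if i + 1 = j ∨ j + 1 = i then -1 else 0 := by
  have e : ∀ a b : Fin n, ∑ k, (Pi.single a (1 : ℚ) : Fin n → ℚ) k * (Pi.single b (1 : ℚ) : Fin n → ℚ) k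
      = if (a : ℕ) = b then 1 else 0 := by
    intro a b
    simp [Pi.single_apply, Fin.val_inj, eq_comm]
  simp only [root, Pi.sub_apply, sub_mul, mul_sub, Finset.sum_sub_distrib, e]
  obtain ⟨i', rfl⟩ : ∃ k, i = k + 1 := ⟨i - 1, by omega⟩
  obtain ⟨j', rfl⟩ : ∃ k, j = k + 1 := ⟨j - 1, by omega⟩
  simp only [Nat.add_sub_cancel]
  split_ifs <;> first | omega | norm_num

open CliffordAlgebra in
theorem ι_root_mul_self (i : ℕ) (h : 1 ≤ i ∧ i < n) :
    ι (rootForm n) (root n i h) * ι (rootForm n) (root n i h) = -1 := by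
  rw [ι_sq_scalar, rootForm_apply, sum_root_mul_root]
  simp

open CliffordAlgebra in
theorem ι_root_mul_swap (i j : ℕ) (hi : 1 ≤ i ∧ i < n) (hj : 1 ≤ j ∧ j < n) :
    ι (rootForm n) (root n i hi) * ι (rootForm n) (root n j hj) +
      ι (rootForm n) (root n j hj) * ι (rootForm n) (root n i hi) =
      algebraMap ℚ _ (-(if i = j then 2 else if i + 1 = j ∨ j + 1 = i then -1 else 0)) := by
  rw [ι_mul_ι_add_swap, polar_rootForm, sum_root_mul_root]

/-- The images of the generators in the Clifford algebra. -/
noncomputable def cliffordGen : Gen n → (CliffordAlgebra (rootForm n))ˣ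
  | Gen.z => -1
  | Gen.t i h =>
    { val := CliffordAlgebra.ι (rootForm n) (root n i h)
      inv := -CliffordAlgebra.ι (rootForm n) (root n i h)
      val_inv := by rw [mul_neg, ι_root_mul_self, neg_neg]
      inv_val := by rw [neg_mul, ι_root_mul_self, neg_neg] }

theorem lift_cliffordGen_word (i : ℕ) (h : 1 ≤ i ∧ i < n) :
    FreeGroup.lift (cliffordGen n) (word n i) = cliffordGen n (Gen.t i h) := by
  conv_lhs => rw [word, dif_pos h]
  simp

theorem lift_cliffordGen_wordZ : FreeGroup.lift (cliffordGen n) (wordZ n) = -1 := by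
  simp [wordZ, cliffordGen]

/-- Orthogonal roots anticommute. Adjacent roots u, v satisfy uv + vu = 1 and u² = v² = -1, so that
uvu and vuv both equal u + v, which is the braid relation. -/
theorem cliffordGen_rel : ∀ r ∈ {r : FreeGroup (Gen n) | Relator n r},
    FreeGroup.lift (cliffordGen n) r = 1 := by
  intro r hr
  cases hr with
  | central i h => simp [lift_cliffordGen_wordZ]
  | z_sq => simp [lift_cliffordGen_wordZ]
  | t_sq i h =>
    rw [map_mul, map_inv, mul_inv_eq_one, map_mul, lift_cliffordGen_wordZ,
      lift_cliffordGen_word n i h, Units.ext_iff]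
    exact ι_root_mul_self n i h
  | braid i h =>
    rw [map_mul, map_inv, mul_inv_eq_one]
    simp only [map_mul, lift_cliffordGen_word n i ⟨h.1, by omega⟩,
      lift_cliffordGen_word n (i + 1) ⟨by omega, h.2⟩]
    rw [Units.ext_iff]
    have h1 := ι_root_mul_swap n i (i + 1) ⟨h.1, by omega⟩ ⟨by omega, h.2⟩
    have h2 := ι_root_mul_self n i ⟨h.1, by omega⟩
    have h3 := ι_root_mul_self n (i + 1) ⟨by omega, h.2⟩
    simp only [cliffordGen, Units.val_mul]
    generalize CliffordAlgebra.ι (rootForm n) (root n i ⟨h.1, by omega⟩) = u at *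
    generalize CliffordAlgebra.ι (rootForm n) (root n (i + 1) ⟨by omega, h.2⟩) = v at *
    simp only [Nat.left_eq_add, one_ne_zero, if_false, true_or, if_true, neg_neg, map_one] at h1
    have h4 : v * u = 1 - u * v := eq_sub_of_add_eq' h1
    calc u * v * u = u * (v * u) := mul_assoc _ _ _
      _ = u - (u * u) * v := by rw [h4, mul_sub, mul_one, mul_assoc]
      _ = u + v := by rw [h2]; simp
      _ = v - u * (v * v) := by rw [h3]; simp [add_comm]
      _ = (1 - u * v) * v := by rw [sub_mul, one_mul, mul_assoc]
      _ = v * u * v := by rw [h4]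
  | far i j hi hj hij =>
    rw [map_mul, map_inv, mul_inv_eq_one]
    simp only [map_mul, lift_cliffordGen_word n i hi, lift_cliffordGen_word n j hj,
      lift_cliffordGen_wordZ]
    rw [Units.ext_iff]
    have h1 := ι_root_mul_swap n j i hj hi
    rw [if_neg (by omega), if_neg (by omega), neg_zero, map_zero] at h1
    simpa [cliffordGen] using eq_neg_of_add_eq_zero_left h1

end Clifford

/-- The Clifford representation sends z to -1, and -1 ≠ 1 because the scalars embed in the Clifford
algebra. -/
theorem zElt_ne_one (n : ℕ) : zElt n ≠ 1 := by
  intro h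
  have h1 := congrArg (PresentedGroup.toGroup (cliffordGen_rel n)) h
  have h2 : PresentedGroup.toGroup (cliffordGen_rel n) (zElt n) = -1 :=
    PresentedGroup.toGroup.of (cliffordGen_rel n) (x := Gen.z)
  rw [h2, map_one, Units.ext_iff, Units.val_neg, Units.val_one] at h1
  have h3 : algebraMap ℚ (CliffordAlgebra (rootForm n)) (-1) = algebraMap ℚ _ 1 := by
    simpa using h1
  have h4 := (algebraMap ℚ (CliffordAlgebra (rootForm n))).injective h3
  norm_num at h4

theorem card_ker_perm_le (n : ℕ) : Nat.card (perm n).ker ≤ 2 := by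
  have h := (finite_and_card_cover_le n).2
  have h1 := Subgroup.card_mul_index (perm n).ker
  rw [Subgroup.index_ker, MonoidHom.range_eq_top.2 (perm_surjective n), Subgroup.card_top,
    Nat.card_perm, Nat.card_fin] at h1
  rw [← h1] at h
  exact Nat.le_of_mul_le_mul_right h n.factorial_pos

theorem perm_eq_one_iff {n : ℕ} {g : Cover n} : perm n g = 1 ↔ g = 1 ∨ g = zElt n := by
  refine ⟨fun h => ?_, ?_⟩
  · by_contra! H
    -- A third element of the kernel would contradict its order being at most 2.
    have hs : Function.Injective (fun i : Fin 3 =>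
        (![⟨1, one_mem _⟩, ⟨zElt n, perm_zElt n⟩, ⟨g, h⟩] i : (perm n).ker)) := by
      have hz := zElt_ne_one n
      intro i j hij
      have hij := congrArg Subtype.val hij
      fin_cases i <;> fin_cases j <;> first
        | rfl
        | exact absurd hij hz
        | exact absurd hij H.1
        | exact absurd hij H.2
        | exact absurd hij.symm hz
        | exact absurd hij.symm H.1
        | exact absurd hij.symm H.2
    have := Nat.card_le_card_of_injective _ hs
    have h2 := card_ker_perm_le n
    rw [Nat.card_fin] at this
    omega
  · rintro (rfl | rfl)
    · simp
    · exact perm_zElt n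

theorem perm_eq_iff {n : ℕ} {g h : Cover n} : perm n g = perm n h ↔ g = h ∨ g = zElt n * h := by
  rw [← mul_inv_eq_one, ← map_inv, ← map_mul, perm_eq_one_iff, mul_inv_eq_one, mul_inv_eq_iff_eq_mul]

theorem perm_embed_castSucc {n : ℕ} (g : Cover n) (i : Fin n) :
    perm (n + 1) (embed n g) i.castSucc = (perm n g i).castSucc := by
  induction g using cover_induction_mul generalizing i with
  | one => simp
  | mul a b ha hb => simp [ha, hb]
  | hz => simp [embed_zElt, perm_zElt]
  | ht j h1 h2 =>
    rw [embed_tElt _ _ ⟨h1, h2⟩, perm_tElt h1 h2, perm_tElt h1 (by omega)]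
    exact (Fin.castSucc_injective n).map_swap ⟨j - 1, _⟩ ⟨j, h2⟩ i |>.symm

/-- An element of the kernel acts trivially on the letters, hence is 1 or z, and z maps to z ≠ 1.
Identities between cycles can therefore be checked in the larger cover, where the letters live. -/
theorem embed_injective (n : ℕ) : Function.Injective (embed n) := by
  rw [injective_iff_map_eq_one]
  intro g hg
  have h : perm n g = 1 := by
    ext i
    have := perm_embed_castSucc g i
    rw [hg, map_one, Perm.one_apply] at this
    simpa using (congrArg Fin.val this).symm
  rcases perm_eq_one_iff.1 h with rfl | rfl
  · rfl
  · exact absurd ((embed_zElt n).symm.trans hg) (zElt_ne_one _)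

/-! ### Cycles in the double cover -/

/-- The cycle `[i_1, …, i_m]`, with the letters numbered from `0`. -/
def cyc (n : ℕ) : List (Fin n) → Cover (n + 1)
  | [] => 1
  | a :: l => letter n a * letters n l.reverse * letter n a

theorem cyc_cons {n : ℕ} (a : Fin n) (l : List (Fin n)) :
    cyc n (a :: l) = letters n (a :: (l.reverse ++ [a])) := by
  simp [cyc, letters_cons, letters_append, letters_nil, mul_assoc]

theorem cyc_singleton {n : ℕ} (a : Fin n) : cyc n [a] = zElt (n + 1) := by
  simp [cyc, letters_nil, letter_mul_self]

theorem embed_mul_cyc {n : ℕ} (g : Cover n) {l : List (Fin n)} (hl : l ≠ []) :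
    embed n g * cyc n l =
      signElt (n + 1) (sgn g ^ (l.length + 1)) * cyc n (l.map (perm n g)) * embed n g := by
  cases l with
  | nil => exact absurd rfl hl
  | cons a l =>
    rw [cyc_cons, embed_mul_letters]
    simp [cyc_cons]

/-- The last x_c of the first factor meets the first x_c of the second, and x_c² = z. -/
theorem cyc_cons_mul_cyc_cons {n : ℕ} (c : Fin n) (l m : List (Fin n)) :
    cyc n (c :: l) * cyc n (c :: m) = zElt (n + 1) * cyc n (c :: (m ++ l)) := by
  simp only [cyc, List.reverse_append, letters_append]
  calc _ = letter n c * letters n l.reverse * (letter n c * letter n c) * letters n m.reverse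
        * letter n c := by group
    _ = _ := by rw [letter_mul_self, ← zElt_comm]; group

theorem map_formPerm_self {α : Type*} [DecidableEq α] {l : List α} (hl : l.Nodup) :
    l.map l.formPerm = l.rotate 1 := by
  apply List.ext_getElem
  · simp
  · intro i h1 h2
    rw [List.getElem_map, List.getElem_rotate, List.formPerm_apply_getElem _ hl]

theorem sign_formPerm {α : Type*} [DecidableEq α] [Fintype α] (a : α) {l : List α}
    (hl : (a :: l).Nodup) : sign (a :: l).formPerm = (-1) ^ l.length := by
  induction l generalizing a with
  | nil => simp
  | cons b l ih =>
    rw [List.formPerm_cons_cons, map_mul, ih b hl.of_cons, sign_swap, List.length_cons, pow_succ']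
    rintro rfl
    simp at hl

/-- Induction on the last letter: since x_a² = z, inserting z x_a x_a = 1 splits off the factor x_a
x_b x_a and leaves a shorter cycle element. -/
theorem exists_embed_eq_cyc {n : ℕ} {l : List (Fin n)} (hl : l.Nodup) (h0 : l ≠ []) :
    ∃ g : Cover n, embed n g = cyc n l ∧ perm n g = l.formPerm := by
  obtain ⟨a, l, rfl⟩ := List.exists_cons_of_ne_nil h0
  clear h0
  induction l using List.reverseRecOn with
  | nil => exact ⟨zElt n, by rw [cyc_singleton, embed_zElt], by simp [perm_zElt]⟩
  | append_singleton l b ih =>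
    have hr : a :: (l ++ [b]) = (b :: a :: l).rotate 1 := by simp
    have hnd : (b :: a :: l).Nodup := by rwa [hr, List.nodup_rotate] at hl
    obtain ⟨g, hg, hp⟩ := ih hnd.of_cons
    have hab : a ≠ b := by rintro rfl; simp at hnd
    obtain ⟨k, hk, hkp⟩ := exists_embed_eq_letter_conj hab
    refine ⟨k * zElt n * g, ?_, ?_⟩
    · rw [map_mul, map_mul, hk, hg, embed_zElt]
      simp only [cyc, List.reverse_append, List.reverse_cons, List.reverse_nil, List.nil_append,
        List.cons_append, letters_cons]
      have h := letter_mul_self a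
      calc _ = letter n a * letter n b * letter n a * zElt (n + 1) * letter n a *
            (letters n l.reverse * letter n a) := by group
        _ = letter n a * letter n b * (zElt (n + 1) * (letter n a * letter n a)) *
            (letters n l.reverse * letter n a) := by
          rw [mul_assoc _ (letter n a) (zElt _), ← zElt_comm (letter n a)]; group
        _ = _ := by rw [h, zElt_mul_self]; group
    · rw [map_mul, map_mul, hp, hkp, perm_zElt, mul_one, hr, List.formPerm_rotate _ hnd,
        List.formPerm_cons_cons, swap_comm]

theorem exists_even_embed_eq_cyc {n : ℕ} {l : List (Fin n)} (hl : l.Nodup) (h0 : Odd l.length) :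
    ∃ g : Cover n, embed n g = cyc n l ∧ perm n g = l.formPerm ∧ sgn g = 1 := by
  have hne : l ≠ [] := by rintro rfl; simp at h0
  obtain ⟨g, h1, h2⟩ := exists_embed_eq_cyc hl hne
  refine ⟨g, h1, h2, ?_⟩
  obtain ⟨a, l, rfl⟩ := List.exists_cons_of_ne_nil hne
  rw [sgn, h2, sign_formPerm a hl]
  rw [List.length_cons, Nat.odd_add_one, Nat.not_odd_iff_even] at h0
  exact h0.neg_one_pow

theorem embed_mul_cyc_of_odd {n : ℕ} (g : Cover n) {l : List (Fin n)} (hl : Odd l.length) :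
    embed n g * cyc n l = cyc n (l.map (perm n g)) * embed n g := by
  have hne : l ≠ [] := by rintro rfl; simp at hl
  have h : sgn g ^ (l.length + 1) = 1 := by
    obtain ⟨k, hk⟩ := hl
    rw [hk, show 2 * k + 1 + 1 = 2 * (k + 1) by ring, pow_mul, sq, Int.units_mul_self, one_pow]
  rw [embed_mul_cyc g hne, h, map_one, one_mul]

/-- An odd cycle element commutes with itself. Reading this as conjugation, its own permutation
moves every letter of the list one step, without sign, so the rotated list gives the same element.
-/
theorem cyc_rotate {n : ℕ} {l : List (Fin n)} (hl : l.Nodup) (h0 : Odd l.length) (k : ℕ) :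
    cyc n (l.rotate k) = cyc n l := by
  induction k with
  | zero => simp
  | succ k ih =>
    rw [← ih, ← List.rotate_rotate]
    have hl' : (l.rotate k).Nodup := List.nodup_rotate.2 hl
    have h0' : Odd (l.rotate k).length := by simpa using h0
    obtain ⟨g, h1, h2, -⟩ := exists_even_embed_eq_cyc hl' h0'
    have h := embed_mul_cyc_of_odd g h0'
    rw [h2, map_formPerm_self hl', h1] at h
    exact (mul_right_cancel h).symm

theorem cyc_eq_of_isRotated {n : ℕ} {l l' : List (Fin n)} (hl : l.Nodup) (h0 : Odd l.length)
    (h : l ~r l') : cyc n l = cyc n l' := by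
  obtain ⟨k, rfl⟩ := h
  exact (cyc_rotate hl h0 k).symm

/-- Joining two odd cycles that share one letter. -/
theorem cyc_mul_cyc_insert {n : ℕ} {c : Fin n} {l P Q : List (Fin n)}
    (hl : Odd (c :: l).length) (h : (P ++ l ++ c :: Q).Nodup) (hPQ : Odd (P ++ c :: Q).length) :
    cyc n (c :: l) * cyc n (P ++ c :: Q) = zElt (n + 1) * cyc n (P ++ l ++ c :: Q) := by
  have hsub : (P ++ c :: Q).Nodup := by
    refine h.sublist ?_
    rw [List.append_assoc]
    exact List.Sublist.append_left (List.sublist_append_right _ _) _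
  have hr1 : (P ++ c :: Q) ~r (c :: (Q ++ P)) := by
    simpa using List.isRotated_append (l := P) (l' := c :: Q)
  have hr2 : (P ++ l ++ c :: Q) ~r (c :: (Q ++ P ++ l)) := by
    simpa using List.isRotated_append (l := P ++ l) (l' := c :: Q)
  rw [cyc_eq_of_isRotated hsub hPQ hr1, cyc_cons_mul_cyc_cons, cyc_eq_of_isRotated h _ hr2]
  simp only [List.length_append, List.length_cons] at hl hPQ ⊢
  grind

/-- The image in the symmetric group of the rule `cyc_cons_mul_cyc_cons`. -/
theorem formPerm_cons_mul_formPerm_cons {α : Type*} [DecidableEq α] {c : α} {l m : List α}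
    (h : (c :: (m ++ l)).Nodup) :
    (c :: l).formPerm * (c :: m).formPerm = (c :: (m ++ l)).formPerm := by
  induction m generalizing c l with
  | nil => simp
  | cons d m ih =>
    have h1 : (c :: d :: l).Nodup :=
      h.sublist (((List.sublist_append_right m l).cons_cons d).cons_cons c)
    have e1 : (c :: l).formPerm * swap c d = (d :: (l ++ [c])).formPerm := by
      have e : (c :: l).formPerm = (l ++ [c]).formPerm := by
        rw [← List.formPerm_rotate_one (c :: l) (h1.sublist ((List.sublist_cons_self d l).cons_cons c))]
        simp
      rw [e, ← List.formPerm_append_pair, ← List.formPerm_rotate_one (d :: (l ++ [c]))]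
      · simp
      · have : (d :: (l ++ [c])) = (c :: d :: l).rotate 1 := by simp
        rwa [this, List.nodup_rotate]
    have e2 : d :: (m ++ (l ++ [c])) = (c :: (d :: m ++ l)).rotate 1 := by simp
    rw [List.formPerm_cons_cons, ← mul_assoc, e1, ih, e2, List.formPerm_rotate_one _ h]
    rwa [e2, List.nodup_rotate]

theorem formPerm_mul_formPerm_insert {α : Type*} [DecidableEq α] {c : α} {l P Q : List α}
    (h : (P ++ l ++ c :: Q).Nodup) :
    (c :: l).formPerm * (P ++ c :: Q).formPerm = (P ++ l ++ c :: Q).formPerm := by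
  have hsub : (P ++ c :: Q).Nodup := by
    refine h.sublist ?_
    rw [List.append_assoc]
    exact List.Sublist.append_left (List.sublist_append_right _ _) _
  have hr1 : (P ++ c :: Q) ~r (c :: (Q ++ P)) := by
    simpa using List.isRotated_append (l := P) (l' := c :: Q)
  have hr2 : (P ++ l ++ c :: Q) ~r (c :: (Q ++ P ++ l)) := by
    simpa using List.isRotated_append (l := P ++ l) (l' := c :: Q)
  rw [List.formPerm_eq_of_isRotated hsub hr1, List.formPerm_eq_of_isRotated h hr2]
  exact formPerm_cons_mul_formPerm_cons (hr2.nodup_iff.1 h)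

/-- Conjugation by the first cycle element fixes every letter of the second, and the odd length of
the second removes the sign. -/
theorem commute_cyc {n : ℕ} {l l' : List (Fin n)} (hl : l.Nodup) (h0 : Odd l.length)
    (h0' : Odd l'.length) (hd : l.Disjoint l') : Commute (cyc n l) (cyc n l') := by
  obtain ⟨g, h1, h2, -⟩ := exists_even_embed_eq_cyc hl h0
  have h := embed_mul_cyc_of_odd g h0'
  have hm : l'.map (perm n g) = l' := by
    rw [h2]
    conv_rhs => rw [← List.map_id l']
    refine List.map_congr_left fun x hx => ?_
    exact List.formPerm_apply_of_notMem fun hx' => hd hx' hx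
  rwa [h1, hm] at h

/-! ### The distinguished lift of a permutation with odd cycles -/

theorem formPerm_map_perm {α : Type*} [DecidableEq α] (σ : Perm α) (l : List α) :
    (l.map σ).formPerm = σ * l.formPerm * σ⁻¹ := by
  induction l with
  | nil => simp
  | cons a l ih =>
    cases l with
    | nil => simp
    | cons b l =>
      rw [List.map_cons, List.map_cons, List.formPerm_cons_cons, ← List.map_cons, ih,
        List.formPerm_cons_cons, swap_apply_apply]
      group

open Classical in
/-- The distinguished lift of an odd cycle. -/
noncomputable def cycleLift (n : ℕ) (p : Perm (Fin n)) : Cover (n + 1) :=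
  if h : ∃ l : List (Fin n), l.Nodup ∧ Odd l.length ∧ 3 ≤ l.length ∧ l.formPerm = p
  then cyc n h.choose else 1

/-- Independence of the chosen list: two lists of at least three letters with the same cycle are
rotations of each other. The bound 3 excludes one-letter lists, whose cycle is trivial but whose
cycle element is z. -/
theorem cycleLift_formPerm {n : ℕ} {l : List (Fin n)} (hl : l.Nodup) (h0 : Odd l.length)
    (h3 : 3 ≤ l.length) : cycleLift n l.formPerm = cyc n l := by
  have h : ∃ l' : List (Fin n), l'.Nodup ∧ Odd l'.length ∧ 3 ≤ l'.length ∧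
    l'.formPerm = l.formPerm := ⟨l, hl, h0, h3, rfl⟩
  rw [cycleLift, dif_pos h]
  have hs := h.choose_spec
  rcases (List.formPerm_eq_formPerm_iff hs.1 hl).1 hs.2.2.2 with hr | hr
  · exact cyc_eq_of_isRotated hs.1 hs.2.1 hr
  · omega

theorem exists_formPerm_eq {n : ℕ} {p : Perm (Fin n)} (hp : p.IsCycle) (h0 : Odd p.support.card) :
    ∃ l : List (Fin n), l.Nodup ∧ Odd l.length ∧ 3 ≤ l.length ∧ l.formPerm = p ∧
      l.toFinset = p.support := by
  obtain ⟨x, hx, -⟩ := id hp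
  have hl : (p.toList x).length = p.support.card := by rw [length_toList, hp.cycleOf_eq hx]
  refine ⟨p.toList x, nodup_toList p x, hl ▸ h0, ?_, ?_, ?_⟩
  · have := hp.two_le_card_support
    rw [hl]
    obtain ⟨k, hk⟩ := h0
    omega
  · rw [formPerm_toList, hp.cycleOf_eq hx]
  · ext y
    rw [List.mem_toFinset, mem_toList_iff]
    refine ⟨fun h => h.1.mem_support_iff.1 h.2, fun h => ⟨?_, mem_support.2 hx⟩⟩
    exact hp.sameCycle hx (mem_support.1 h)

/-- All cycles have odd length. -/
def OddPerm {n : ℕ} (p : Perm (Fin n)) : Prop := ∀ k ∈ p.cycleType, Odd k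

/-- A list of pairwise disjoint odd cycles. -/
def OddCycles {n : ℕ} (M : List (Perm (Fin n))) : Prop :=
  (∀ p ∈ M, p.IsCycle ∧ Odd p.support.card) ∧ M.Pairwise Disjoint

/-- The distinguished lift of a permutation with odd cycles. -/
noncomputable def oddLift (n : ℕ) (p : Perm (Fin n)) : Cover (n + 1) :=
  (p.cycleFactors.1.map (cycleLift n)).prod

theorem commute_cycleLift {n : ℕ} {p q : Perm (Fin n)} (hp : p.IsCycle ∧ Odd p.support.card)
    (hq : q.IsCycle ∧ Odd q.support.card) (h : Disjoint p q) :
    Commute (cycleLift n p) (cycleLift n q) := by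
  obtain ⟨l, h1, h2, h3, rfl, h4⟩ := exists_formPerm_eq hp.1 hp.2
  obtain ⟨m, k1, k2, k3, rfl, k4⟩ := exists_formPerm_eq hq.1 hq.2
  rw [cycleLift_formPerm h1 h2 h3, cycleLift_formPerm k1 k2 k3]
  refine commute_cyc h1 h2 k2 ?_
  rwa [List.formPerm_disjoint_iff h1 k1 (by omega) (by omega)] at h

theorem oddPerm_iff {n : ℕ} {M : List (Perm (Fin n))} (hc : ∀ p ∈ M, p.IsCycle)
    (hd : M.Pairwise Disjoint) : OddPerm M.prod ↔ OddCycles M := by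
  rw [OddPerm, cycleType_eq M rfl hc hd]
  simp only [Multiset.mem_coe, List.mem_map, Function.comp, OddCycles]
  constructor
  · intro h
    exact ⟨fun p hp => ⟨hc p hp, h _ ⟨p, hp, rfl⟩⟩, hd⟩
  · rintro ⟨h, -⟩ _ ⟨p, hp, rfl⟩
    exact (h p hp).2

theorem OddPerm.exists_oddCycles {n : ℕ} {p : Perm (Fin n)} (hp : OddPerm p) :
    ∃ M, OddCycles M ∧ M.prod = p := by
  obtain ⟨h1, h2, h3⟩ := p.cycleFactors.2
  refine ⟨p.cycleFactors.1, (oddPerm_iff h2 h3).1 ?_, h1⟩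
  rwa [h1]

/-- Two decompositions into disjoint cycles differ by reordering, and the lifts of disjoint odd
cycles commute. -/
theorem oddLift_prod {n : ℕ} {M : List (Perm (Fin n))} (hM : OddCycles M) :
    oddLift n M.prod = (M.map (cycleLift n)).prod := by
  obtain ⟨h1, h2, h3⟩ := M.prod.cycleFactors.2
  have hP := list_cycles_perm_list_cycles h1.symm (fun p hp => (hM.1 p hp).1) h2 hM.2 h3
  refine ((hP.map (cycleLift n)).prod_eq' ?_).symm
  rw [List.pairwise_map]
  exact hM.2.imp_of_mem fun ha hb h => commute_cycleLift (hM.1 _ ha) (hM.1 _ hb) h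

theorem oddLift_one (n : ℕ) : oddLift n 1 = 1 := by
  have := oddLift_prod (n := n) (M := []) ⟨by simp, List.Pairwise.nil⟩
  simpa using this

theorem oddLift_mul {n : ℕ} {p q : Perm (Fin n)} (hp : OddPerm p) (hq : OddPerm q)
    (h : Disjoint p q) : oddLift n (p * q) = oddLift n p * oddLift n q := by
  obtain ⟨M, hM, rfl⟩ := hp.exists_oddCycles
  obtain ⟨N, hN, rfl⟩ := hq.exists_oddCycles
  have hMN : OddCycles (M ++ N) := by
    refine ⟨fun p hp => (List.mem_append.1 hp).elim (hM.1 p) (hN.1 p), ?_⟩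
    refine List.pairwise_append.2 ⟨hM.2, hN.2, fun a ha b hb => ?_⟩
    rw [disjoint_iff_disjoint_support] at h ⊢
    refine h.mono ?_ ?_
    · intro x hx
      have := eq_on_support_mem_disjoint ha hM.2 x hx
      rw [mem_support] at hx ⊢
      rwa [← this]
    · intro x hx
      have := eq_on_support_mem_disjoint hb hN.2 x hx
      rw [mem_support] at hx ⊢
      rwa [← this]
  rw [← List.prod_append, oddLift_prod hMN, oddLift_prod hM, oddLift_prod hN, List.map_append,
    List.prod_append]

theorem support_formPerm {α : Type*} [DecidableEq α] [Fintype α] {l : List α} (hl : l.Nodup)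
    (h : 2 ≤ l.length) : l.formPerm.support = l.toFinset :=
  List.support_formPerm_of_nodup l hl (by rintro x rfl; simp at h)

theorem cycleType_formPerm {α : Type*} [DecidableEq α] [Fintype α] {l : List α} (hl : l.Nodup)
    (h : 2 ≤ l.length) : l.formPerm.cycleType = {l.length} := by
  rw [(List.isCycle_formPerm hl h).cycleType, support_formPerm hl h,
    List.toFinset_card_of_nodup hl]

theorem oddPerm_formPerm {n : ℕ} {l : List (Fin n)} (hl : l.Nodup) (h0 : Odd l.length) :
    OddPerm l.formPerm := by
  rcases Nat.lt_or_ge l.length 2 with h | h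
  · have h1 : l.formPerm = 1 := (List.formPerm_eq_one_iff _ hl).2 (by omega)
    simp [OddPerm, h1]
  · rw [OddPerm, cycleType_formPerm hl h]
    simpa using h0

/-- The exceptional z for one letter comes from the convention [a] = x_a x_a = z, whereas the
identity permutation has lift 1. -/
theorem oddLift_formPerm {n : ℕ} {l : List (Fin n)} (hl : l.Nodup) (h0 : Odd l.length) :
    cyc n l = (if l.length = 1 then zElt (n + 1) else 1) * oddLift n l.formPerm := by
  split_ifs with h
  · obtain ⟨a, rfl⟩ := List.length_eq_one_iff.1 h
    simp [cyc_singleton, oddLift_one]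
  · have h3 : 3 ≤ l.length := by obtain ⟨k, hk⟩ := h0; omega
    have hM : OddCycles [l.formPerm] := by
      have hc := List.isCycle_formPerm hl (by omega)
      refine ⟨?_, List.pairwise_singleton _ _⟩
      simp only [List.mem_singleton, forall_eq]
      refine ⟨hc, ?_⟩
      rw [support_formPerm hl (by omega), List.toFinset_card_of_nodup hl]
      exact h0
    have := oddLift_prod hM
    simp only [List.prod_singleton, List.map_cons, List.map_nil] at this
    rw [this, one_mul, cycleLift_formPerm hl h0 h3]

theorem embed_mul_cycleLift {n : ℕ} (g : Cover n) {p : Perm (Fin n)}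
    (hp : p.IsCycle ∧ Odd p.support.card) :
    embed n g * cycleLift n p = cycleLift n (perm n g * p * (perm n g)⁻¹) * embed n g := by
  obtain ⟨l, h1, h2, h3, rfl, -⟩ := exists_formPerm_eq hp.1 hp.2
  rw [← formPerm_map_perm, cycleLift_formPerm h1 h2 h3, cycleLift_formPerm, embed_mul_cyc_of_odd g h2]
  · exact h1.map (perm n g).injective
  · simpa using h2
  · simpa using h3

/-- Equivariance under conjugation, cycle by cycle; odd lengths make it free of signs. This is what
makes the canonical lifts a union of conjugacy classes. -/
theorem embed_mul_oddLift {n : ℕ} (g : Cover n) {p : Perm (Fin n)} (hp : OddPerm p) :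
    embed n g * oddLift n p = oddLift n (perm n g * p * (perm n g)⁻¹) * embed n g := by
  obtain ⟨M, hM, rfl⟩ := hp.exists_oddCycles
  set N := M.map (MulAut.conj (perm n g)) with hN
  have hN' : OddCycles N := by
    refine ⟨?_, ?_⟩
    · simp only [hN, List.mem_map, MulAut.conj_apply]
      rintro _ ⟨p, hp, rfl⟩
      refine ⟨(hM.1 p hp).1.conj, ?_⟩
      rw [card_support_conj]
      exact (hM.1 p hp).2
    · rw [hN, List.pairwise_map]
      exact hM.2.imp fun h => by simpa using h.conj (perm n g)
  have hprod : perm n g * M.prod * (perm n g)⁻¹ = N.prod := by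
    rw [hN, ← map_list_prod, MulAut.conj_apply]
  rw [hprod, oddLift_prod hM, oddLift_prod hN', hN, List.map_map]
  have hc := hM.1
  clear hp hM hN' hprod hN
  clear_value N
  induction M with
  | nil => simp
  | cons p M ih =>
    rw [List.map_cons, List.map_cons, List.prod_cons, List.prod_cons, ← mul_assoc,
      embed_mul_cycleLift g (hc p (by simp)), mul_assoc, 
      ih fun q hq => hc q (by simp [hq])]
    simp [mul_assoc]

theorem exists_embed_eq_oddLift {n : ℕ} {p : Perm (Fin n)} (hp : OddPerm p) :
    ∃ g : Cover n, embed n g = oddLift n p ∧ perm n g = p := by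
  obtain ⟨M, hM, rfl⟩ := hp.exists_oddCycles
  rw [oddLift_prod hM]
  have hc := hM.1
  clear hM hp
  induction M with
  | nil => exact ⟨1, by simp⟩
  | cons p M ih =>
    obtain ⟨g, hg, hgp⟩ := ih fun q hq => hc q (by simp [hq])
    have hp := hc p (by simp)
    obtain ⟨l, h1, h2, h3, rfl, -⟩ := exists_formPerm_eq hp.1 hp.2
    obtain ⟨k, hk, hkp, -⟩ := exists_even_embed_eq_cyc h1 h2
    refine ⟨k * g, ?_, ?_⟩
    · rw [map_mul, hk, hg, List.map_cons, List.prod_cons, cycleLift_formPerm h1 h2 h3]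
    · rw [map_mul, hkp, hgp, List.prod_cons]

/-! ### The even split classes -/

theorem exists_map_succ_eq {n : ℕ} {L : List ℕ} (h : ∀ x ∈ L, 1 ≤ x ∧ x ≤ n) :
    ∃ l : List (Fin n), l.map (fun i : Fin n => (i : ℕ) + 1) = L := by
  induction L with
  | nil => exact ⟨[], rfl⟩
  | cons x L ih =>
    obtain ⟨l, hl⟩ := ih fun y hy => h y (by simp [hy])
    have hx := h x (by simp)
    refine ⟨⟨x - 1, by omega⟩ :: l, ?_⟩
    simp only [List.map_cons, hl, List.cons.injEq, and_true]
    omega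

theorem cycleElt_map {n : ℕ} {l : List (Fin n)} (hl : 2 ≤ l.length) :
    cycleElt n (l.map fun i : Fin n => (i : ℕ) + 1) = cyc n l := by
  match l, hl with
  | a :: b :: l, _ =>
    simp only [List.map_cons, cycleElt, cyc, letters, letter]
    rw [← List.map_cons (f := fun i : Fin n => (i : ℕ) + 1), ← List.map_reverse, List.map_map]
    rfl

/-- The modified cycle type as a multiset of cycle lengths. -/
def cycleLengths (ν : EvenPartition) : Multiset ℕ := ν.map fun p => p.1 + 1

theorem sum_cycleLengths (ν : EvenPartition) :
    (cycleLengths ν).sum = size ν + Multiset.card ν := by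
  induction ν using Multiset.induction_on with
  | empty => simp [cycleLengths, size]
  | cons a t ih =>
    simp only [cycleLengths, size, Multiset.map_cons, Multiset.sum_cons, Multiset.card_cons] at *
    omega

theorem oddPerm_of_cycleType {n : ℕ} {p : Perm (Fin n)} {ν : EvenPartition}
    (h : p.cycleType = cycleLengths ν) : OddPerm p := by
  intro k hk
  rw [h, cycleLengths, Multiset.mem_map] at hk
  obtain ⟨a, -, rfl⟩ := hk
  exact a.2.2.add_one

theorem exists_perm_cyclesFrom {n : ℕ} (P : List EvenPart) (a : ℕ)
    (h : a + (P.map fun p => p.1 + 1).sum ≤ n) :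
    ∃ w : Perm (Fin n), w.cycleType = cycleLengths (P : Multiset EvenPart) ∧
      (∀ i ∈ w.support, a ≤ (i : ℕ)) ∧ cyclesFrom n (a + 1) P = oddLift n w := by
  induction P generalizing a with
  | nil => exact ⟨1, by simp [cycleLengths], by simp, by simp [cyclesFrom, oddLift_one]⟩
  | cons p P ih =>
    simp only [List.map_cons, List.sum_cons] at h
    obtain ⟨w, h1, h2, h3⟩ := ih (a + p.1 + 1) (by omega)
    obtain ⟨l, hl⟩ := exists_map_succ_eq (n := n) (L := List.range' (a + 1) (p.1 + 1)) (by
      intro x hx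
      rw [List.mem_range'_1] at hx
      omega)
    have hlen : l.length = p.1 + 1 := by simpa using congrArg List.length hl
    have hp := p.2.1
    have hnd : l.Nodup := by
      refine List.Nodup.of_map (fun i : Fin n => (i : ℕ) + 1) ?_
      rw [hl]
      exact List.nodup_range'
    have hodd : Odd l.length := by rw [hlen]; exact p.2.2.add_one
    have hmem : ∀ i ∈ l, a ≤ (i : ℕ) ∧ (i : ℕ) < a + p.1 + 1 := by
      intro i hi
      have : (i : ℕ) + 1 ∈ List.range' (a + 1) (p.1 + 1) := by
        rw [← hl]; exact List.mem_map_of_mem hi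
      rw [List.mem_range'_1] at this
      omega
    have hsup : l.formPerm.support = l.toFinset := support_formPerm hnd (by omega)
    have hdisj : Disjoint l.formPerm w := by
      rw [disjoint_iff_disjoint_support, hsup, Finset.disjoint_left]
      intro i hi hi'
      have k1 := hmem i (List.mem_toFinset.1 hi)
      have k2 := h2 i hi'
      omega
    refine ⟨l.formPerm * w, ?_, ?_, ?_⟩
    · rw [hdisj.cycleType_mul, h1, cycleType_formPerm hnd (by omega), hlen]
      simp [cycleLengths]
    · intro i hi
      rcases Finset.mem_union.1 (support_mul_le _ _ hi) with k | k
      · rw [hsup, List.mem_toFinset] at k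
        exact (hmem i k).1
      · have := h2 i k
        omega
    · rw [oddLift_mul (oddPerm_formPerm hnd hodd) (oddPerm_of_cycleType h1) hdisj, ← h3, cyclesFrom,
        ← hl, cycleElt_map (by omega), oddLift_formPerm hnd hodd, if_neg (by omega), one_mul]
      congr 2
      omega

theorem exists_perm_distinguished {n : ℕ} {ν : EvenPartition} (h : size ν + Multiset.card ν ≤ n) :
    ∃ w : Perm (Fin n), w.cycleType = cycleLengths ν ∧ distinguished n ν = oddLift n w := by
  have e : ((sortedParts ν : List EvenPart) : Multiset EvenPart) = ν := Multiset.sort_eq _ _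
  obtain ⟨w, h1, -, h3⟩ := exists_perm_cyclesFrom (n := n) (sortedParts ν) 0 (by
    have : ((sortedParts ν).map fun p => p.1 + 1).sum = (cycleLengths ν).sum := by
      conv_rhs => rw [← e, cycleLengths, Multiset.map_coe, Multiset.sum_coe]
    rw [this, sum_cycleLengths]
    omega)
  rw [e] at h1
  exact ⟨w, h1, h3⟩

/-- The distinguished element is a canonical lift. Conjugation preserves canonical lifts and is
transitive on permutations of one cycle type, so the class contains exactly one of the two lifts of
each such permutation. -/
theorem mem_splitClass {n : ℕ} {ν : EvenPartition} {g : Cover n} :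
    g ∈ splitClass n ν ↔
      (perm n g).cycleType = cycleLengths ν ∧ embed n g = oddLift n (perm n g) := by
  have key : ∀ (k g₀ : Cover n), OddPerm (perm n g₀) → embed n g₀ = oddLift n (perm n g₀) →
      embed n (k * g₀ * k⁻¹) = oddLift n (perm n (k * g₀ * k⁻¹)) := by
    intro k g₀ h1 h2
    rw [map_mul, map_mul, h2, embed_mul_oddLift k h1, map_inv, mul_inv_cancel_right]
    simp
  constructor
  · rintro ⟨hn, g₀, h0, hc⟩
    obtain ⟨w, hw, hd⟩ := exists_perm_distinguished hn
    obtain ⟨g₁, k1, rfl⟩ := exists_embed_eq_oddLift (oddPerm_of_cycleType hw)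
    rw [hd, ← k1] at h0
    obtain rfl := embed_injective n h0
    obtain ⟨k, rfl⟩ := isConj_iff.1 hc
    refine ⟨?_, key _ _ (oddPerm_of_cycleType hw) k1⟩
    rw [map_mul, map_mul, map_inv, cycleType_conj, hw]
  · rintro ⟨h1, h2⟩
    have hn : size ν + Multiset.card ν ≤ n := by
      rw [← sum_cycleLengths, ← h1]
      simpa using sum_cycleType_le (perm n g)
    obtain ⟨w, hw, hd⟩ := exists_perm_distinguished hn
    obtain ⟨g₁, k1, rfl⟩ := exists_embed_eq_oddLift (oddPerm_of_cycleType hw)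
    refine ⟨hn, g₁, by rw [k1, hd], ?_⟩
    obtain ⟨σ, hσ⟩ := isConj_iff.1 (isConj_of_cycleType_eq (hw.trans h1.symm))
    obtain ⟨k, rfl⟩ := perm_surjective n σ
    refine isConj_iff.2 ⟨k, embed_injective n ?_⟩
    rw [key _ _ (oddPerm_of_cycleType hw) k1, h2, ← hσ]
    simp

/-- Split off a cycle of even length with lift d. It is odd, so the remaining factor d⁻¹g is odd too
and fixes all letters of the cycle. -/
theorem isConj_zElt_mul {n : ℕ} {g : Cover n} (hs : sgn g = 1) (ho : ¬ OddPerm (perm n g)) :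
    IsConj g (zElt n * g) := by
  simp only [OddPerm, not_forall, Nat.not_odd_iff_even] at ho
  obtain ⟨k, hk, hev⟩ := ho
  rw [cycleType_def, Multiset.mem_map] at hk
  obtain ⟨c, hc, rfl⟩ := hk
  obtain ⟨hc, hcg⟩ := mem_cycleFactorsFinset_iff.1 (Finset.mem_def.2 hc)
  simp only [Function.comp] at hev
  obtain ⟨x, hx, -⟩ := id hc
  set l := c.toList x with hl
  have hlen : l.length = c.support.card := by rw [hl, length_toList, hc.cycleOf_eq hx]
  have hform : l.formPerm = c := by rw [hl, formPerm_toList, hc.cycleOf_eq hx]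
  have hnd : l.Nodup := nodup_toList c x
  have h2 : 2 ≤ l.length := hlen ▸ hc.two_le_card_support
  have hne : l ≠ [] := by rintro h; simp [h] at h2
  obtain ⟨d, hd, hdp⟩ := exists_embed_eq_cyc hnd hne
  rw [hform] at hdp
  have hsd : sgn d = -1 := by
    rw [sgn, hdp, hc.sign, hev.neg_one_pow]
  have hfix : l.map (perm n (d⁻¹ * g)) = l := by
    conv_rhs => rw [← List.map_id l]
    refine List.map_congr_left fun y hy => ?_
    have hy' : y ∈ c.support := by
      rw [← hform, support_formPerm hnd h2, List.mem_toFinset]; exact hy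
    rw [map_mul, map_inv, hdp, Perm.mul_apply, ← hcg y hy']
    simp
  have hsh : sgn (d⁻¹ * g) = -1 := by
    rw [sgn_mul, hs, mul_one, ← hsd]
    simp [sgn]
  -- The cycle element has an odd number of letters, so moving d⁻¹g past it costs exactly one z;
  -- hence d⁻¹gd = zg.
  have h := embed_mul_cyc (d⁻¹ * g) hne
  rw [hfix, hsh, hlen, (hev.add_one).neg_one_pow, signElt_neg_one, ← hd, ← embed_zElt, ← map_mul,
    ← map_mul, ← map_mul] at h
  have h := embed_injective n h
  refine isConj_iff.2 ⟨d⁻¹, ?_⟩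
  rw [inv_inv, h, mul_assoc, mul_inv_cancel_left]

/-! ### The spin group algebra -/

/-- The ring congruence of equality after multiplication by `1 - z`. -/
noncomputable def spinCon (n : ℕ) : RingCon (MonoidAlgebra ℤ (Cover n)) where
  r a b := (1 - MonoidAlgebra.of ℤ (Cover n) (zElt n)) * a =
    (1 - MonoidAlgebra.of ℤ (Cover n) (zElt n)) * b
  iseqv := ⟨fun _ => rfl, fun h => h.symm, fun h h' => h.trans h'⟩
  add' h h' := by rw [mul_add, mul_add, h, h']
  mul' {a b c d} h h' := by
    have hc : ∀ x : MonoidAlgebra ℤ (Cover n),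
        (1 - MonoidAlgebra.of ℤ (Cover n) (zElt n)) * x =
          x * (1 - MonoidAlgebra.of ℤ (Cover n) (zElt n)) := by
      intro x
      have : Commute (MonoidAlgebra.of ℤ (Cover n) (zElt n)) x := by
        refine MonoidAlgebra.of_commute (fun g => ?_) x
        exact zElt_comm g
      exact ((Commute.one_left x).sub_left this).eq
    rw [← mul_assoc, h, mul_assoc, ← mul_assoc, hc b, mul_assoc, h', ← mul_assoc, ← hc b, mul_assoc]

/-- Since (1 - z)(z + 1) = 0, multiplication by the central element 1 - z does not see the ideal.
Equality in the quotient is thereby turned into an identity of coefficients in the group algebra. -/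
theorem mul_eq_of_mkRingHom_eq {n : ℕ} {a b : MonoidAlgebra ℤ (Cover n)}
    (h : RingQuot.mkRingHom (spinRel n) a = RingQuot.mkRingHom (spinRel n) b) :
    (1 - MonoidAlgebra.of ℤ (Cover n) (zElt n)) * a =
      (1 - MonoidAlgebra.of ℤ (Cover n) (zElt n)) * b := by
  have hw : ∀ ⦃x y⦄, spinRel n x y → (spinCon n).mk' x = (spinCon n).mk' y := by
    rintro x y ⟨rfl, rfl⟩
    refine (spinCon n).eq.2 ?_
    change _ = _
    rw [mul_zero, sub_mul, one_mul, mul_add, mul_one, ← map_mul, zElt_mul_self, map_one]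
    abel
  have := congrArg (RingQuot.lift ⟨(spinCon n).mk', hw⟩) h
  rw [RingQuot.lift_mkRingHom_apply, RingQuot.lift_mkRingHom_apply] at this
  exact (spinCon n).eq.1 this

noncomputable instance (n : ℕ) : Fintype (Cover n) := Fintype.ofFinite _

theorem mkRingHom_zElt_add_one (n : ℕ) :
    RingQuot.mkRingHom (spinRel n) (MonoidAlgebra.of ℤ (Cover n) (zElt n) + 1) =
      RingQuot.mkRingHom (spinRel n) 0 :=
  RingQuot.mkRingHom_rel ⟨rfl, rfl⟩

/-- The involution g ↦ zg is free because z ≠ 1, and the terms of the difference cancel in pairs. -/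
theorem sum_smul_eq_sum_smul {n : ℕ} {R : Type*} [Ring R] {e : Cover n → R}
    (he : ∀ g, e (zElt n * g) = -e g) {a b : Cover n → ℤ}
    (h : ∀ g, a g - a (zElt n * g) = b g - b (zElt n * g)) :
    ∑ g, a g • e g = ∑ g, b g • e g := by
  rw [← sub_eq_zero, ← Finset.sum_sub_distrib]
  refine Finset.sum_involution (fun g _ => zElt n * g) ?_ ?_ ?_ ?_
  · intro g _
    rw [he, ← sub_smul, ← sub_smul, smul_neg, ← sub_eq_add_neg, ← sub_smul]
    have := h g
    rw [show a g - b g - (a (zElt n * g) - b (zElt n * g)) = 0 by linarith, zero_smul]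
  · intro g _ _ hg
    exact zElt_ne_one n (mul_eq_right.1 hg)
  · simp
  · intro g _
    rw [← mul_assoc, zElt_mul_self, one_mul]

theorem coeff_one_sub_mul_sum {n : ℕ} (c : Cover n → ℤ) (g : Cover n) :
    (((1 - MonoidAlgebra.of ℤ (Cover n) (zElt n)) *
        (∑ g, c g • MonoidAlgebra.of ℤ (Cover n) g)).coeff g) = c g - c (zElt n * g) := by
  have e : ∀ g, (∑ g, c g • MonoidAlgebra.of ℤ (Cover n) g).coeff g = c g := by
    classical
    intro g
    simp [MonoidAlgebra.coeff_sum, Finsupp.finsetSum_apply, Finsupp.single_apply]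
  have e2 := e (zElt n * g)
  rw [sub_mul, one_mul, MonoidAlgebra.coeff_sub, Finsupp.sub_apply, e,
    show MonoidAlgebra.of ℤ (Cover n) (zElt n) = MonoidAlgebra.single (zElt n) 1 from rfl,
    MonoidAlgebra.coeff_single_mul_apply, zElt_inv, one_mul, e2]

/-- Only the part of the coefficient function that is odd under g ↦ zg survives in the quotient, and
it survives completely. -/
theorem map_sum_smul_of_eq_iff {n : ℕ} {R : Type*} [Ring R] {φ : MonoidAlgebra ℤ (Cover n) →+* R}
    (h0 : φ (MonoidAlgebra.of ℤ (Cover n) (zElt n) + 1) = φ 0)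
    (hφ : ∀ a b, φ a = φ b → (1 - MonoidAlgebra.of ℤ (Cover n) (zElt n)) * a =
      (1 - MonoidAlgebra.of ℤ (Cover n) (zElt n)) * b) (a b : Cover n → ℤ) :
    φ (∑ g, a g • MonoidAlgebra.of ℤ (Cover n) g) = φ (∑ g, b g • MonoidAlgebra.of ℤ (Cover n) g) ↔
      ∀ g, a g - a (zElt n * g) = b g - b (zElt n * g) := by
  constructor
  · intro h g
    rw [← coeff_one_sub_mul_sum, ← coeff_one_sub_mul_sum, hφ _ _ h]
  · intro h
    simp only [map_sum, map_zsmul]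
    refine sum_smul_eq_sum_smul (fun g => ?_) h
    rw [map_add, map_one, map_zero] at h0
    rw [map_mul, map_mul, eq_neg_of_add_eq_zero_left h0, neg_one_mul]

open Classical in
/-- The indicator function of an even split class. -/
noncomputable def classInd (n : ℕ) (ν : EvenPartition) (g : Cover n) : ℤ :=
  if g ∈ splitClass n ν then 1 else 0

theorem finsum_mem_splitClass (n : ℕ) (ν : EvenPartition) :
    ∑ᶠ g ∈ splitClass n ν, MonoidAlgebra.of ℤ (Cover n) g =
      ∑ g, classInd n ν g • MonoidAlgebra.of ℤ (Cover n) g := by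
  classical
  rw [finsum_mem_def, finsum_eq_sum_of_fintype]
  refine Finset.sum_congr rfl fun g _ => ?_
  by_cases hg : g ∈ splitClass n ν <;> simp [hg, classInd]

/-- The coefficients of the product of two class sums in the group algebra. -/
noncomputable def convInd (n : ℕ) (lam μ : EvenPartition) (g : Cover n) : ℤ :=
  ∑ h, classInd n lam (g * h⁻¹) * classInd n μ h

theorem finsum_mul_finsum (n : ℕ) (lam μ : EvenPartition) :
    (∑ᶠ g ∈ splitClass n lam, MonoidAlgebra.of ℤ (Cover n) g) *
      (∑ᶠ g ∈ splitClass n μ, MonoidAlgebra.of ℤ (Cover n) g) =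
        ∑ g, convInd n lam μ g • MonoidAlgebra.of ℤ (Cover n) g := by
  rw [finsum_mem_splitClass, finsum_mem_splitClass, Finset.sum_mul_sum]
  rw [Finset.sum_comm]
  have e : ∀ g, convInd n lam μ g • MonoidAlgebra.of ℤ (Cover n) g =
      ∑ h, (classInd n lam (g * h⁻¹) * classInd n μ h) • MonoidAlgebra.of ℤ (Cover n) g :=
    fun g => Finset.sum_smul
  simp only [e]
  conv_rhs => rw [Finset.sum_comm]
  refine Finset.sum_congr rfl fun h _ => ?_
  refine Fintype.sum_equiv (Equiv.mulRight h) _ _ fun g => ?_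
  rw [Equiv.coe_mulRight, mul_inv_cancel_right, smul_mul_smul_comm, map_mul]

/-! ### Conjugation invariance, existence and uniqueness of structure constants -/

theorem classInd_conj {n : ℕ} (ν : EvenPartition) (k g : Cover n) :
    classInd n ν (k * g * k⁻¹) = classInd n ν g := by
  have : k * g * k⁻¹ ∈ splitClass n ν ↔ g ∈ splitClass n ν := by
    have hc : IsConj g (k * g * k⁻¹) := isConj_iff.2 ⟨k, rfl⟩
    constructor
    · rintro ⟨h, g₀, h1, h2⟩
      exact ⟨h, g₀, h1, h2.trans hc.symm⟩
    · rintro ⟨h, g₀, h1, h2⟩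
      exact ⟨h, g₀, h1, h2.trans hc⟩
  by_cases h : g ∈ splitClass n ν
  · rw [classInd, classInd, if_pos h, if_pos (this.2 h)]
  · rw [classInd, classInd, if_neg h, if_neg (mt this.1 h)]

theorem convInd_conj {n : ℕ} (lam μ : EvenPartition) (k g : Cover n) :
    convInd n lam μ (k * g * k⁻¹) = convInd n lam μ g := by
  rw [convInd, convInd]
  refine (Fintype.sum_equiv (MulAut.conj k).toEquiv _ _ fun h => ?_).symm
  have e : k * g * k⁻¹ * (k * h * k⁻¹)⁻¹ = k * (g * h⁻¹) * k⁻¹ := by group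
  simp only [MulEquiv.toEquiv_eq_coe, EquivLike.coe_coe, MulAut.conj_apply, e, classInd_conj]

/-- The coefficients of the product of two class sums in the spin group algebra. -/
noncomputable def spinCoeff (n : ℕ) (lam μ : EvenPartition) (g : Cover n) : ℤ :=
  convInd n lam μ g - convInd n lam μ (zElt n * g)

theorem spinCoeff_zElt_mul {n : ℕ} (lam μ : EvenPartition) (g : Cover n) :
    spinCoeff n lam μ (zElt n * g) = -spinCoeff n lam μ g := by
  rw [spinCoeff, spinCoeff, ← mul_assoc, zElt_mul_self, one_mul, neg_sub]

theorem spinCoeff_eq_of_isConj {n : ℕ} (lam μ : EvenPartition) {g h : Cover n} (hc : IsConj g h) :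
    spinCoeff n lam μ g = spinCoeff n lam μ h := by
  obtain ⟨k, rfl⟩ := isConj_iff.1 hc
  have e : zElt n * (k * g * k⁻¹) = k * (zElt n * g) * k⁻¹ := by
    rw [← mul_assoc, ← mul_assoc, zElt_comm k, mul_assoc k]
  rw [spinCoeff, spinCoeff, e, convInd_conj, convInd_conj]

theorem sgn_of_mem_splitClass {n : ℕ} {ν : EvenPartition} {g : Cover n}
    (hg : g ∈ splitClass n ν) : sgn g = 1 := by
  rw [sgn, sign_of_cycleType', (mem_splitClass.1 hg).1, cycleLengths, Multiset.map_map]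
  refine Multiset.prod_eq_one fun u hu => ?_
  obtain ⟨p, -, rfl⟩ := Multiset.mem_map.1 hu
  simp [pow_succ, p.2.2.neg_one_pow]

theorem sgn_zElt_mul {n : ℕ} (g : Cover n) : sgn (zElt n * g) = sgn g := by
  simp [sgn, perm_zElt]

theorem convInd_eq_zero {n : ℕ} {lam μ : EvenPartition} {g : Cover n} (hg : sgn g ≠ 1) :
    convInd n lam μ g = 0 := by
  refine Finset.sum_eq_zero fun h _ => ?_
  by_contra H
  have h1 : g * h⁻¹ ∈ splitClass n lam := by
    by_contra h1; simp [classInd, h1] at H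
  have h2 : h ∈ splitClass n μ := by
    by_contra h2; simp [classInd, h2] at H
  refine hg ?_
  have := sgn_mul (g * h⁻¹) h
  rwa [inv_mul_cancel_right, sgn_of_mem_splitClass h1, sgn_of_mem_splitClass h2, one_mul] at this

theorem exists_cycleLengths_eq {n : ℕ} {p : Perm (Fin n)} (hp : OddPerm p) :
    ∃ ν, p.cycleType = cycleLengths ν := by
  have h2 : ∀ k ∈ p.cycleType, 2 ≤ k := fun k => two_le_of_mem_cycleType
  unfold OddPerm at hp
  generalize p.cycleType = t at hp h2
  induction t using Multiset.induction_on with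
  | empty => exact ⟨0, rfl⟩
  | cons k t ih =>
    obtain ⟨ν, hν⟩ := ih (fun j hj => hp j (by simp [hj])) fun j hj => h2 j (by simp [hj])
    have h := hp k (by simp)
    have h2 := h2 k (by simp)
    refine ⟨⟨k - 1, by omega, Nat.Odd.sub_odd h odd_one⟩ ::ₘ ν, ?_⟩
    simp only [cycleLengths, Multiset.map_cons] at hν ⊢
    rw [hν, Nat.sub_add_cancel (by omega)]

theorem cycleLengths_injective : Function.Injective cycleLengths := by
  refine Multiset.map_injective fun p q h => Subtype.ext ?_
  exact Nat.succ_injective h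

theorem classInd_zElt_mul {n : ℕ} {ν ν' : EvenPartition} {g : Cover n} (hg : g ∈ splitClass n ν) :
    classInd n ν' (zElt n * g) = 0 := by
  refine if_neg fun h => ?_
  have h1 := (mem_splitClass.1 h).2
  rw [map_mul, map_mul, perm_zElt, one_mul, ← (mem_splitClass.1 hg).2, embed_zElt] at h1
  exact zElt_ne_one _ (mul_eq_right.1 h1)

open Classical in
theorem classInd_of_mem {n : ℕ} {ν ν' : EvenPartition} {g : Cover n} (hg : g ∈ splitClass n ν) :
    classInd n ν' g = if ν' = ν then 1 else 0 := by
  have : g ∈ splitClass n ν' ↔ ν' = ν := by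
    refine ⟨fun h => ?_, fun h => h ▸ hg⟩
    exact cycleLengths_injective ((mem_splitClass.1 h).1.symm.trans (mem_splitClass.1 hg).1)
  simp only [classInd, this]

theorem map_mul_eq_sum_iff {n : ℕ} {R : Type*} [Ring R] {φ : MonoidAlgebra ℤ (Cover n) →+* R}
    (h0 : φ (MonoidAlgebra.of ℤ (Cover n) (zElt n) + 1) = φ 0)
    (hφ : ∀ a b, φ a = φ b → (1 - MonoidAlgebra.of ℤ (Cover n) (zElt n)) * a =
      (1 - MonoidAlgebra.of ℤ (Cover n) (zElt n)) * b)
    (lam μ : EvenPartition) (a : EvenPartition →₀ ℤ) :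
    φ (∑ᶠ g ∈ splitClass n lam, MonoidAlgebra.of ℤ (Cover n) g) *
      φ (∑ᶠ g ∈ splitClass n μ, MonoidAlgebra.of ℤ (Cover n) g) =
        (a.sum fun ν c => c • φ (∑ᶠ g ∈ splitClass n ν, MonoidAlgebra.of ℤ (Cover n) g)) ↔
    ∀ g, spinCoeff n lam μ g =
      (a.sum fun ν c => c * classInd n ν g) - a.sum fun ν c => c * classInd n ν (zElt n * g) := by
  have h : (a.sum fun ν c => c • φ (∑ᶠ g ∈ splitClass n ν, MonoidAlgebra.of ℤ (Cover n) g)) =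
      φ (∑ g, (a.sum fun ν c => c * classInd n ν g) • MonoidAlgebra.of ℤ (Cover n) g) := by
    simp only [Finsupp.sum, finsum_mem_splitClass, ← map_zsmul, ← map_sum, Finset.smul_sum,
      Finset.sum_smul, smul_smul]
    rw [Finset.sum_comm]
  rw [← map_mul, finsum_mul_finsum, h, map_sum_smul_of_eq_iff h0 hφ]
  rfl

theorem isStructureConstants_iff {n : ℕ} {lam μ : EvenPartition} {a : EvenPartition →₀ ℤ} :
    IsStructureConstants n lam μ a ↔ ∀ g, spinCoeff n lam μ g =
      (a.sum fun ν c => c * classInd n ν g) - a.sum fun ν c => c * classInd n ν (zElt n * g) :=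
  map_mul_eq_sum_iff (R := SpinAlgebra n) (mkRingHom_zElt_add_one n)
    (fun _ _ => mul_eq_of_mkRingHom_eq) lam μ a

theorem sum_mul_classInd {n : ℕ} (a : EvenPartition →₀ ℤ) {ν : EvenPartition} {g : Cover n}
    (hg : g ∈ splitClass n ν) : (a.sum fun ν c => c * classInd n ν g) = a ν := by
  classical
  simp only [classInd_of_mem hg]
  simp [Finsupp.sum, eq_comm]

theorem sum_mul_classInd_zElt_mul {n : ℕ} (a : EvenPartition →₀ ℤ) {ν : EvenPartition} {g : Cover n}
    (hg : g ∈ splitClass n ν) : (a.sum fun ν c => c * classInd n ν (zElt n * g)) = 0 := by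
  simp only [classInd_zElt_mul hg]
  simp [Finsupp.sum]

theorem IsStructureConstants.apply_eq {n : ℕ} {lam μ ν : EvenPartition} {a : EvenPartition →₀ ℤ}
    (ha : IsStructureConstants n lam μ a) {g : Cover n} (hg : g ∈ splitClass n ν) :
    a ν = spinCoeff n lam μ g := by
  rw [isStructureConstants_iff.1 ha g, sum_mul_classInd a hg, sum_mul_classInd_zElt_mul a hg,
    sub_zero]

/-- `spinCoeff` is a class function that is odd under z, so its values on the split classes are the
only candidates. It remains to see that it vanishes at g when neither g nor zg lies in a split
class. -/
theorem exists_isStructureConstants (n : ℕ) (lam μ : EvenPartition) :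
    ∃ a, IsStructureConstants n lam μ a := by
  classical
  let f : EvenPartition → ℤ := fun ν =>
    if h : ∃ g, g ∈ splitClass n ν then spinCoeff n lam μ h.choose else 0
  have hf : ∀ ν, f ν ≠ 0 → ν ∈ partitionsUpTo n := by
    intro ν h
    have : ∃ g, g ∈ splitClass n ν := by
      by_contra hne; exact h (dif_neg hne)
    obtain ⟨g, hn, -⟩ := this
    simp only [partitionsUpTo, Set.Finite.mem_toFinset, Set.mem_ofPred_eq]
    omega
  have key : ∀ ν g, g ∈ splitClass n ν → f ν = spinCoeff n lam μ g := by
    intro ν g hg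
    have h : ∃ g, g ∈ splitClass n ν := ⟨g, hg⟩
    have h1 : f ν = spinCoeff n lam μ h.choose := dif_pos h
    rw [h1]
    obtain ⟨-, g₀, k1, k2⟩ := h.choose_spec
    obtain ⟨-, g₁, k3, k4⟩ := hg
    rw [← k3] at k1
    obtain rfl := embed_injective n k1
    exact spinCoeff_eq_of_isConj _ _ (k2.symm.trans k4)
  refine ⟨Finsupp.onFinset _ f hf, isStructureConstants_iff.2 fun g => ?_⟩
  by_cases h1 : ∃ ν, g ∈ splitClass n ν
  · obtain ⟨ν, hg⟩ := h1
    rw [sum_mul_classInd _ hg, sum_mul_classInd_zElt_mul _ hg, sub_zero, Finsupp.onFinset_apply,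
      key ν g hg]
  by_cases h2 : ∃ ν, zElt n * g ∈ splitClass n ν
  · obtain ⟨ν, hg⟩ := h2
    have e := sum_mul_classInd_zElt_mul (Finsupp.onFinset _ f hf) hg
    rw [← mul_assoc, zElt_mul_self, one_mul] at e
    rw [sum_mul_classInd _ hg, e, zero_sub, Finsupp.onFinset_apply,
      key ν _ hg, spinCoeff_zElt_mul, neg_neg]
  push Not at h1 h2
  have e1 : ∀ ν, classInd n ν g = 0 := fun ν => if_neg (h1 ν)
  have e2 : ∀ ν, classInd n ν (zElt n * g) = 0 := fun ν => if_neg (h2 ν)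
  simp only [e1, e2, mul_zero, Finsupp.sum, Finset.sum_const_zero, sub_zero]
  -- An even g with odd cycles is a canonical lift up to z, contrary to the assumption. With a cycle
  -- of even length, g is conjugate to zg, so the coefficient equals its own negative. For odd g
  -- there are no factorizations, split classes being even.
  by_cases hs : sgn g = 1
  · by_cases ho : OddPerm (perm n g)
    · exfalso
      obtain ⟨ν, hν⟩ := exists_cycleLengths_eq ho
      obtain ⟨k, hk, hkp⟩ := exists_embed_eq_oddLift ho
      rcases perm_eq_iff.1 hkp with rfl | rfl
      · exact h1 ν (mem_splitClass.2 ⟨hν, hk⟩)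
      · refine h2 ν (mem_splitClass.2 ?_)
        rw [hkp]
        exact ⟨hν, hk⟩
    · have h := spinCoeff_eq_of_isConj lam μ (isConj_zElt_mul hs ho)
      rw [spinCoeff_zElt_mul] at h
      omega
  · rw [spinCoeff, convInd_eq_zero hs, convInd_eq_zero (by rwa [sgn_zElt_mul]), sub_zero]

/-! ### Products of permutations of maximal length -/

section Rank

variable {X : Type*} [DecidableEq X] [Fintype X]

/-- The functions that are constant on the cycles of a permutation. -/
def invariantFun (p : Perm X) : Submodule ℚ (X → ℚ) where
  carrier := {f | ∀ x, f (p x) = f x}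
  add_mem' hf hg x := by simp only [Pi.add_apply, hf x, hg x]
  zero_mem' x := rfl
  smul_mem' c f hf x := by simp only [Pi.smul_apply, hf x]

theorem apply_eq_of_sameCycle {p : Perm X} {f : X → ℚ} (hf : f ∈ invariantFun p) {x y : X}
    (h : p.SameCycle x y) : f x = f y := by
  obtain ⟨i, rfl⟩ := h.exists_nat_pow_eq
  clear h
  induction i with
  | zero => rfl
  | succ i ih => rw [ih, pow_succ', Perm.mul_apply, hf]

/-- A label of the cycle of a point. -/
def cycleLabel (p : Perm X) (x : X) : Perm X ⊕ X :=
  if p x = x then Sum.inr x else Sum.inl (p.cycleOf x)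

theorem cycleLabel_eq_iff {p : Perm X} {x y : X} :
    cycleLabel p x = cycleLabel p y ↔ p.SameCycle x y := by
  unfold cycleLabel
  constructor
  · split_ifs with h1 h2 h2
    · intro h
      rw [Sum.inr.inj h]
    · simp
    · simp
    · intro h
      rw [Sum.inl.injEq] at h
      exact (sameCycle_iff_cycleOf_eq_of_mem_support (mem_support.2 h1) (mem_support.2 h2)).2 h
  · intro h
    have := h.apply_eq_self_iff
    split_ifs with h1 h2 h2
    · rw [h.eq_of_left h1]
    · exact absurd (this.1 h1) h2
    · exact absurd (this.2 h2) h1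
    · rw [h.cycleOf_eq]

/-- The dimension is the number of cycles with fixed points included, since an invariant function is
a function of the label of the cycle. -/
theorem finrank_invariantFun (p : Perm X) :
    Module.finrank ℚ (invariantFun p) + p.support.card =
      Fintype.card X + Multiset.card p.cycleType := by
  have himg : Finset.univ.image (cycleLabel p) =
      p.cycleFactorsFinset.disjSum p.supportᶜ := by
    ext y
    rcases y with c | x
    · simp only [Finset.mem_image, Finset.mem_univ, true_and, Finset.inl_mem_disjSum, cycleLabel]
      constructor
      · rintro ⟨x, hx⟩
        split_ifs at hx with h
        · rw [← Sum.inl.inj hx]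
          exact cycleOf_mem_cycleFactorsFinset_iff.2 (mem_support.2 h)
      · intro hc
        obtain ⟨x, hx⟩ := (mem_cycleFactorsFinset_iff.1 hc).1.nonempty_support
        refine ⟨x, ?_⟩
        rw [if_neg (mem_support.1 (mem_cycleFactorsFinset_support_le hc hx)),
          cycle_is_cycleOf hx hc]
    · simp only [Finset.mem_image, Finset.mem_univ, true_and, Finset.inr_mem_disjSum, cycleLabel,
        Finset.mem_compl, notMem_support]
      constructor
      · rintro ⟨y, hy⟩
        split_ifs at hy with h
        rwa [← Sum.inr.inj hy]
      · intro hx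
        exact ⟨x, if_pos hx⟩
  set T := Finset.univ.image (cycleLabel p) with hT
  let F : X → T := fun x => ⟨cycleLabel p x, Finset.mem_image_of_mem _ (Finset.mem_univ x)⟩
  have hF : Function.Surjective F := by
    rintro ⟨y, hy⟩
    obtain ⟨x, -, rfl⟩ := Finset.mem_image.1 hy
    exact ⟨x, rfl⟩
  have hrange : LinearMap.range (LinearMap.funLeft ℚ ℚ F) = invariantFun p := by
    ext f
    constructor
    · rintro ⟨g, rfl⟩ x
      simp only [LinearMap.funLeft_apply]
      congr 1
      exact Subtype.ext (cycleLabel_eq_iff.2 (sameCycle_apply_left.2 (SameCycle.refl p x)))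
    · intro hf
      refine ⟨fun y => f (Function.surjInv hF y), ?_⟩
      ext x
      simp only [LinearMap.funLeft_apply]
      refine apply_eq_of_sameCycle hf (cycleLabel_eq_iff.1 ?_)
      exact congrArg Subtype.val (Function.surjInv_eq hF (F x))
  have hcard : Module.finrank ℚ (invariantFun p) = T.card := by
    rw [← hrange, LinearMap.finrank_range_of_inj (LinearMap.funLeft_injective_of_surjective ℚ ℚ F hF)]
    simp
  rw [hcard, himg, Finset.card_disjSum, Finset.card_compl, cycleType_def, Multiset.card_map]
  have := p.support.card_le_univ
  simp only [Finset.card_def] at *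
  omega

/-- The number of points minus the number of cycles. -/
def absLength (p : Perm X) : ℕ := (p.cycleType.map fun k => k - 1).sum

theorem absLength_add_card (p : Perm X) :
    absLength p + Multiset.card p.cycleType = p.support.card := by
  rw [absLength, ← sum_cycleType]
  have : ∀ k ∈ p.cycleType, 1 ≤ k := fun k hk => (one_lt_of_mem_cycleType hk).le
  generalize p.cycleType = t at *
  induction t using Multiset.induction_on with
  | empty => simp
  | cons a t ih =>
    have h1 := this a (by simp)
    have h2 := ih fun k hk => this k (by simp [hk])
    simp only [Multiset.map_cons, Multiset.sum_cons, Multiset.card_cons]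
    omega

theorem finrank_invariantFun_add (p : Perm X) :
    Module.finrank ℚ (invariantFun p) + absLength p = Fintype.card X := by
  have h1 := finrank_invariantFun p
  have h2 := absLength_add_card p
  omega

/-- If the lengths add up in a product `p * q`, no cycle of `p` and cycle of `q` share two
points. -/
theorem eq_of_sameCycle_of_absLength_mul {p q : Perm X}
    (h : absLength (p * q) = absLength p + absLength q) {a b : X} (hp : p.SameCycle a b)
    (hq : q.SameCycle a b) : a = b := by
  by_contra hab
  -- The codimension of the invariant functions is the length. As lengths add up, this inclusion
  -- forces the sum of the two spaces to be everything. All its members would take equal values at a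
  -- and b, which the indicator of a does not.
  have hinf : invariantFun p ⊓ invariantFun q ≤ invariantFun (p * q) := by
    rintro f ⟨hf, hg⟩ x
    rw [Perm.mul_apply, hf, hg]
  have h1 := Submodule.finrank_sup_add_finrank_inf_eq (invariantFun p) (invariantFun q)
  have h2 := Submodule.finrank_mono hinf
  have h3 := finrank_invariantFun_add p
  have h4 := finrank_invariantFun_add q
  have h5 := finrank_invariantFun_add (p * q)
  have h6 : invariantFun p ⊔ invariantFun q ≤
      LinearMap.ker (LinearMap.proj (R := ℚ) (φ := fun _ : X => ℚ) a - LinearMap.proj b) := by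
    refine sup_le ?_ ?_
    · intro f hf
      simp [apply_eq_of_sameCycle hf hp]
    · intro f hf
      simp [apply_eq_of_sameCycle hf hq]
  have h7 : invariantFun p ⊔ invariantFun q = ⊤ := by
    refine Submodule.eq_top_of_finrank_eq (le_antisymm (Submodule.finrank_le _) ?_)
    rw [Module.finrank_fintype_fun_eq_card]
    omega
  rw [h7] at h6
  have := h6 (show Pi.single a (1 : ℚ) ∈ ⊤ from trivial)
  simp [Pi.single_apply, Ne.symm hab] at this

end Rank

/-! ### Cycles cut into blocks -/

section Blocks

variable {X : Type*}

/-- The concatenation of the blocks `l ++ [c]`. -/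
def blockWord (B : List (X × List X)) : List X := B.flatMap fun b => b.2 ++ [b.1]

/-- The last letters of the blocks. -/
def blockEnds (B : List (X × List X)) : List X := B.map Prod.fst

/-- The lengths of the blocks. -/
def blockLengths (B : List (X × List X)) : List ℕ := B.map fun b => b.2.length + 1

theorem blockWord_cons (b : X × List X) (B : List (X × List X)) :
    blockWord (b :: B) = b.2 ++ b.1 :: blockWord B := by
  simp [blockWord]

theorem length_blockWord (B : List (X × List X)) :
    (blockWord B).length = (blockLengths B).sum := by
  simp [blockWord, blockLengths, List.length_flatMap]

theorem mem_blockWord {B : List (X × List X)} {x : X} :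
    x ∈ blockWord B ↔ ∃ b ∈ B, x ∈ b.1 :: b.2 := by
  simp [blockWord, or_comm]

theorem blockEnds_sublist (B : List (X × List X)) : (blockEnds B).Sublist (blockWord B) := by
  induction B with
  | nil => simp [blockEnds]
  | cons b B ih =>
    rw [blockWord_cons, blockEnds, List.map_cons]
    exact (ih.cons_cons b.1).trans (List.sublist_append_right _ _)

theorem nodup_of_mem_block {B : List (X × List X)} (h : (blockWord B).Nodup) {b : X × List X}
    (hb : b ∈ B) : (b.1 :: b.2).Nodup := by
  induction B with
  | nil => simp at hb
  | cons a B ih =>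
    rw [blockWord_cons] at h
    rcases List.mem_cons.1 hb with rfl | hb
    · have h1 : (b.2 ++ [b.1]).Nodup :=
        h.sublist (List.Sublist.append_left ((List.nil_sublist _).cons_cons _) _)
      have e : b.2 ++ [b.1] = (b.1 :: b.2).rotate 1 := by simp
      rwa [e, List.nodup_rotate] at h1
    · exact ih (h.sublist ((List.sublist_cons_self _ _).trans (List.sublist_append_right _ _))) hb

theorem blockWord_injective {B B' : List (X × List X)} (h : blockWord B = blockWord B')
    (hl : blockLengths B = blockLengths B') : B = B' := by
  induction B generalizing B' with
  | nil =>
    cases B' with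
    | nil => rfl
    | cons b B' => simp [blockLengths] at hl
  | cons b B ih =>
    cases B' with
    | nil => simp [blockLengths] at hl
    | cons b' B' =>
      simp only [blockLengths, List.map_cons, List.cons.injEq] at hl
      rw [blockWord_cons, blockWord_cons] at h
      obtain ⟨h1, h2⟩ := List.append_inj h (by omega)
      rw [List.cons.injEq] at h2
      rw [ih h2.2 hl.2, Prod.ext h2.1 h1]

theorem exists_blocks (q : List ℕ) (R : List X) (hq : ∀ k ∈ q, 1 ≤ k) (h : R.length = q.sum) :
    ∃ B : List (X × List X), blockWord B = R ∧ blockLengths B = q := by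
  induction q generalizing R with
  | nil =>
    have : R = [] := List.length_eq_zero_iff.1 (by simpa using h)
    exact ⟨[], by simp [blockWord, this], rfl⟩
  | cons k q ih =>
    have hk := hq k (by simp)
    rw [List.sum_cons] at h
    obtain ⟨B, h1, h2⟩ := ih (R.drop k) (fun j hj => hq j (by simp [hj])) (by simp; omega)
    have hne : R.take k ≠ [] := by
      intro h0
      have := congrArg List.length h0
      rw [List.length_take, List.length_nil] at this
      omega
    refine ⟨((R.take k).getLast hne, (R.take k).dropLast) :: B, ?_, ?_⟩
    · rw [blockWord_cons, h1, ← List.singleton_append, ← List.append_assoc,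
        List.dropLast_append_getLast, List.take_append_drop]
    · simp only [blockLengths, List.map_cons] at h2 ⊢
      rw [h2]
      congr 1
      simp
      omega

variable [DecidableEq X]

/-- The product of the cycles of the blocks. -/
def blockPerm (B : List (X × List X)) : Perm X := (B.map fun b => (b.1 :: b.2).formPerm).prod

theorem blockPerm_cons (b : X × List X) (B : List (X × List X)) :
    blockPerm (b :: B) = (b.1 :: b.2).formPerm * blockPerm B := by
  simp [blockPerm]

/-- Multiplying by the cycle of a block inserts the remaining letters of the block in front of its
end letter. The prefix P carries the end letters of the blocks still to be filled. -/
theorem blockPerm_mul_formPerm_append (P : List X) {B : List (X × List X)}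
    (h : (P ++ blockWord B).Nodup) :
    blockPerm B * (P ++ blockEnds B).formPerm = (P ++ blockWord B).formPerm := by
  induction B generalizing P with
  | nil => simp [blockPerm, blockEnds, blockWord]
  | cons b B ih =>
    rw [blockWord_cons] at h ⊢
    have e : P ++ blockEnds (b :: B) = (P ++ [b.1]) ++ blockEnds B := by simp [blockEnds]
    have hs : ((P ++ [b.1]) ++ blockWord B).Nodup := by
      refine h.sublist ?_
      rw [List.append_assoc]
      exact List.Sublist.append_left (List.sublist_append_right _ _) _
    rw [blockPerm_cons, mul_assoc, e, ih _ hs, List.append_assoc, List.singleton_append,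
      ← List.append_assoc]
    refine formPerm_mul_formPerm_insert ?_
    rwa [List.append_assoc]

theorem blockPerm_mul_formPerm {B : List (X × List X)} (h : (blockWord B).Nodup) :
    blockPerm B * (blockEnds B).formPerm = (blockWord B).formPerm :=
  blockPerm_mul_formPerm_append [] h

theorem blockPerm_apply_of_notMem {B : List (X × List X)} {x : X} (h : x ∉ blockWord B) :
    blockPerm B x = x := by
  induction B with
  | nil => simp [blockPerm]
  | cons b B ih =>
    rw [blockWord_cons] at h
    simp only [List.mem_append, List.mem_cons, not_or] at h
    rw [blockPerm_cons, Perm.mul_apply, ih h.2.2, List.formPerm_apply_of_notMem]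
    simp [h.1, h.2.1]

theorem blockPerm_apply_of_mem {B : List (X × List X)} (h : (blockWord B).Nodup) {b : X × List X}
    (hb : b ∈ B) {x : X} (hx : x ∈ b.1 :: b.2) : blockPerm B x = (b.1 :: b.2).formPerm x := by
  induction B with
  | nil => simp at hb
  | cons a B ih =>
    rw [blockWord_cons] at h
    rw [blockPerm_cons, Perm.mul_apply]
    have hd : ∀ y ∈ a.1 :: a.2, y ∉ blockWord B := by
      rw [List.nodup_append, List.nodup_cons] at h
      intro y hy
      rcases List.mem_cons.1 hy with rfl | hy
      · exact h.2.1.1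
      · exact fun hy' => h.2.2 y hy y (by simp [hy']) rfl
    have hs : (blockWord B).Nodup :=
      h.sublist ((List.sublist_cons_self _ _).trans (List.sublist_append_right _ _))
    rcases List.mem_cons.1 hb with rfl | hb
    · rw [blockPerm_apply_of_notMem (hd x hx)]
    · rw [ih hs hb, List.formPerm_apply_of_notMem]
      intro hy
      exact hd _ hy (mem_blockWord.2 ⟨b, hb, List.formPerm_apply_mem_of_mem hx⟩)

theorem disjoint_formPerm_blockPerm {b : X × List X} {B : List (X × List X)}
    (h : (blockWord (b :: B)).Nodup) : Disjoint (b.1 :: b.2).formPerm (blockPerm B) := by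
  rw [blockWord_cons, List.nodup_append, List.nodup_cons] at h
  intro x
  by_cases hx : x ∈ b.1 :: b.2
  · refine Or.inr (blockPerm_apply_of_notMem ?_)
    rcases List.mem_cons.1 hx with rfl | hx
    · exact h.2.1.1
    · exact fun hx' => h.2.2 x hx x (by simp [hx']) rfl
  · exact Or.inl (List.formPerm_apply_of_notMem hx)

theorem nodup_blockWord_of_cons {b : X × List X} {B : List (X × List X)}
    (h : (blockWord (b :: B)).Nodup) : (blockWord B).Nodup := by
  rw [blockWord_cons] at h
  exact h.sublist ((List.sublist_cons_self _ _).trans (List.sublist_append_right _ _))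

theorem cycleType_blockPerm [Fintype X] {B : List (X × List X)} (h : (blockWord B).Nodup) :
    (blockPerm B).cycleType = ((blockLengths B : Multiset ℕ).filter (2 ≤ ·)) := by
  induction B with
  | nil => simp [blockPerm, blockLengths]
  | cons b B ih =>
    rw [blockPerm_cons, (disjoint_formPerm_blockPerm h).cycleType_mul,
      ih (nodup_blockWord_of_cons h)]
    have hb := nodup_of_mem_block h (b := b) (by simp)
    simp only [blockLengths, List.map_cons, ← Multiset.cons_coe]
    by_cases hl : 2 ≤ b.2.length + 1
    · rw [cycleType_formPerm hb (by simpa using hl), Multiset.filter_cons_of_pos _ hl,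
        List.length_cons, Multiset.singleton_add]
    · rw [(List.formPerm_eq_one_iff _ hb).2 (by rw [List.length_cons]; omega), cycleType_one,
        Multiset.filter_cons_of_neg _ hl, zero_add]

/-! ### Cycles of a permutation as lists -/

/-- `R` lists the points of a cycle of `w`. -/
def IsCycleList (w : Perm X) (R : List X) : Prop := R.Nodup ∧ R ≠ [] ∧ R.map w = R.rotate 1

theorem IsCycleList.formPerm_apply {w : Perm X} {R : List X} (h : IsCycleList w R) {x : X}
    (hx : x ∈ R) : R.formPerm x = w x := by
  have := (map_formPerm_self h.1).trans h.2.2.symm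
  exact List.map_inj_left.1 this x hx

theorem isCycleList_of_apply {w : Perm X} {R : List X} (h : R.Nodup) (h0 : R ≠ [])
    (hw : ∀ x ∈ R, w x = R.formPerm x) : IsCycleList w R :=
  ⟨h, h0, by rw [← map_formPerm_self h]; exact List.map_congr_left hw⟩

theorem IsCycleList.getElem {w : Perm X} {c : X} {l : List X} (h : IsCycleList w (c :: l)) (i : ℕ)
    (hi : i < (c :: l).length) : (c :: l)[i] = (w ^ i) c := by
  induction i with
  | zero => rfl
  | succ i ih =>
    rw [pow_succ', Perm.mul_apply, ← ih (by omega), ← h.formPerm_apply (List.getElem_mem _),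
      List.formPerm_apply_lt_getElem _ h.1]

theorem IsCycleList.eq {w : Perm X} {c : X} {l l' : List X} (h : IsCycleList w (c :: l))
    (h' : IsCycleList w (c :: l')) : l = l' := by
  have key : ∀ l l' : List X, IsCycleList w (c :: l) → IsCycleList w (c :: l') →
      ¬ l.length < l'.length := by
    intro l l' h h' hlt
    -- The shorter list closes up after l.length + 1 steps, which would repeat c inside the longer
    -- list.
    have h1 : (w ^ (l.length + 1)) c = c := by
      have := h.formPerm_apply (List.getElem_mem (l := c :: l) (n := l.length) (by simp))
      rw [List.formPerm_apply_getElem _ h.1, h.getElem l.length, ← Perm.mul_apply, ← pow_succ'] at this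
      rw [← this]
      simp
    have h2 := h'.getElem (l.length + 1) (by simp; omega)
    rw [h1] at h2
    have h3 := (List.Nodup.getElem_inj_iff h'.1 (i := l.length + 1) (j := 0) (hi := by simp; omega)
      (hj := by simp)).1 h2
    omega
  have hlen : l.length = l'.length :=
    le_antisymm (not_lt.1 (key _ _ h' h)) (not_lt.1 (key _ _ h h'))
  have : c :: l = c :: l' := by
    refine List.ext_getElem (by simp [hlen]) fun i h1 h2 => ?_
    rw [h.getElem, h'.getElem]
  exact (List.cons.inj this).2

variable [Fintype X]

/-- The points of the cycle of `w` that starts at `x`. -/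
def cycleList (w : Perm X) (x : X) : List X := if w x = x then [x] else w.toList x

theorem isCycleList_cycleList (w : Perm X) (x : X) : IsCycleList w (cycleList w x) := by
  unfold cycleList
  split_ifs with h
  · exact isCycleList_of_apply (by simp) (by simp) (by simp [h])
  · refine isCycleList_of_apply (nodup_toList w x) ?_ fun y hy => ?_
    · rw [Ne, toList_eq_nil_iff, not_not, mem_support]
      exact h
    · rw [formPerm_toList, (mem_toList_iff.1 hy).1.cycleOf_apply]

theorem cycleList_eq_cons (w : Perm X) (x : X) : ∃ l, cycleList w x = x :: l := by
  unfold cycleList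
  split_ifs with h
  · exact ⟨[], rfl⟩
  · have hx : x ∈ w.support := mem_support.2 h
    have h2 := toList_getElem_zero w x hx
    have h3 := length_toList_pos_of_mem_support w x hx
    match hl : w.toList x, h3 with
    | a :: l, _ =>
      simp only [hl, List.getElem_cons_zero] at h2
      exact ⟨l, by rw [h2]⟩

theorem IsCycleList.eq_cycleList {w : Perm X} {x : X} {l : List X} (h : IsCycleList w (x :: l)) :
    cycleList w x = x :: l := by
  obtain ⟨l', hl'⟩ := cycleList_eq_cons w x
  rw [hl', (hl' ▸ isCycleList_cycleList w x : IsCycleList w (x :: l')).eq h]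

theorem mem_cycleList {w : Perm X} {x y : X} : y ∈ cycleList w x ↔ w.SameCycle x y := by
  unfold cycleList
  split_ifs with h
  · rw [List.mem_singleton]
    refine ⟨fun e => e ▸ SameCycle.refl _ _, fun hc => (hc.eq_of_left h).symm⟩
  · rw [mem_toList_iff, mem_support, and_iff_left h]

theorem length_cycleList {w : Perm X} {x : X} (h : w x ≠ x) :
    (cycleList w x).length = (w.cycleOf x).support.card := by
  rw [cycleList, if_neg h, length_toList]

/-- The part of a permutation off a cycle. -/
theorem IsCycleList.exists_eq_mul {w : Perm X} {R : List X} (h : IsCycleList w R) :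
    ∃ τ : Perm X, (∀ x ∈ R, τ x = x) ∧ w = τ * R.formPerm := by
  refine ⟨w * R.formPerm⁻¹, fun x hx => ?_, by group⟩
  have hx' : R.formPerm⁻¹ x ∈ R := by
    rw [← List.formPerm_mem_iff_mem]
    simpa using hx
  rw [Perm.mul_apply, ← h.formPerm_apply hx']
  simp

theorem exists_eq_mul_blockPerm {p : Perm X} {B : List (X × List X)} (hB : (blockWord B).Nodup)
    (h : ∀ b ∈ B, IsCycleList p (b.1 :: b.2)) :
    ∃ τ : Perm X, (∀ x ∈ blockWord B, τ x = x) ∧ p = τ * blockPerm B := by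
  refine ⟨p * (blockPerm B)⁻¹, fun x hx => ?_, by group⟩
  set y := (blockPerm B)⁻¹ x with hy
  have hxy : blockPerm B y = x := by simp [hy]
  have hy' : y ∈ blockWord B := by
    by_contra hn
    rw [blockPerm_apply_of_notMem hn] at hxy
    exact hn (hxy ▸ hx)
  obtain ⟨b, hb, hyb⟩ := mem_blockWord.1 hy'
  rw [Perm.mul_apply, ← hy, ← (h b hb).formPerm_apply hyb, ← blockPerm_apply_of_mem hB hb hyb, hxy]

end Blocks

/-! ### Counting factorizations -/

section Count

variable {X : Type*} [DecidableEq X] [Fintype X]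

/-- The cut cycles of `w` that describe the factorizations of `w` as a product of a permutation of
cycle type `L` and a cycle of length `S`. -/
def IsGoodBlocks (w : Perm X) (S : ℕ) (L : Multiset ℕ) (B : List (X × List X)) : Prop :=
  IsCycleList w (blockWord B) ∧ B.length = S ∧
    w.cycleType + (blockLengths B : Multiset ℕ).filter (2 ≤ ·) = L + {(blockWord B).length}

theorem length_blockEnds (B : List (X × List X)) : (blockEnds B).length = B.length := by
  simp [blockEnds]

theorem length_le_length_blockWord (B : List (X × List X)) : B.length ≤ (blockWord B).length := by
  rw [← length_blockEnds]
  exact (blockEnds_sublist B).length_le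

theorem disjoint_of_forall_apply_eq {τ p : Perm X} {R : List X} (h : ∀ x ∈ R, τ x = x)
    (hp : ∀ x, x ∉ R → p x = x) : Disjoint τ p := fun x =>
  if hx : x ∈ R then Or.inl (h x hx) else Or.inr (hp x hx)

theorem IsCycleList.exists_blocks_decomposition {w : Perm X} {B : List (X × List X)}
    (h : IsCycleList w (blockWord B)) :
    ∃ τ : Perm X, (∀ x ∈ blockWord B, τ x = x) ∧ w = τ * (blockWord B).formPerm ∧
      w * (blockEnds B).formPerm⁻¹ = τ * blockPerm B := by
  obtain ⟨τ, h1, h2⟩ := h.exists_eq_mul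
  refine ⟨τ, h1, h2, ?_⟩
  conv_lhs => rw [h2, ← blockPerm_mul_formPerm h.1]
  group

theorem IsGoodBlocks.cycleType_ends {w : Perm X} {S : ℕ} {L : Multiset ℕ} {B : List (X × List X)}
    (h : IsGoodBlocks w S L B) (hS : 2 ≤ S) : (blockEnds B).formPerm.cycleType = {S} := by
  have hl : (blockEnds B).length = S := by rw [length_blockEnds, h.2.1]
  rw [cycleType_formPerm (h.1.1.sublist (blockEnds_sublist B)) (hl ▸ hS), hl]

/-- Dividing by the cycle of the end letters replaces the cut cycle of w by the cycles of its blocks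
and leaves the other cycles alone. Blocks of one letter become fixed points and do not enter the
cycle type. -/
theorem IsGoodBlocks.cycleType_mul_inv {w : Perm X} {S : ℕ} {L : Multiset ℕ}
    {B : List (X × List X)} (h : IsGoodBlocks w S L B) (hS : 2 ≤ S) :
    (w * (blockEnds B).formPerm⁻¹).cycleType = L := by
  obtain ⟨τ, h1, h2, h3⟩ := h.1.exists_blocks_decomposition
  have hN : 2 ≤ (blockWord B).length := by
    have := length_le_length_blockWord B
    have := h.2.1
    omega
  have hd1 : Disjoint τ (blockWord B).formPerm :=
    disjoint_of_forall_apply_eq h1 fun x => List.formPerm_apply_of_notMem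
  have hd2 : Disjoint τ (blockPerm B) :=
    disjoint_of_forall_apply_eq h1 fun x => blockPerm_apply_of_notMem
  have h4 := h.2.2
  have hw : w.cycleType = τ.cycleType + {(blockWord B).length} := by
    conv_lhs => rw [h2]
    rw [hd1.cycleType_mul, cycleType_formPerm h.1.1 hN]
  rw [hw, add_right_comm] at h4
  rw [h3, hd2.cycleType_mul, cycleType_blockPerm h.1.1]
  exact add_right_cancel h4

/-- The block ending in c is the cycle through c of the quotient permutation, so the end letters
alone determine the cut. -/
theorem IsCycleList.eq_map_blockEnds {w : Perm X} {B : List (X × List X)}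
    (h : IsCycleList w (blockWord B)) :
    B = (blockEnds B).map fun c => (c, (cycleList (w * (blockEnds B).formPerm⁻¹) c).tail) := by
  obtain ⟨τ, h1, h2, h3⟩ := h.exists_blocks_decomposition
  rw [h3]
  conv_lhs => rw [← List.map_id B]
  rw [blockEnds, List.map_map]
  refine List.map_congr_left fun b hb => ?_
  have hc : IsCycleList (τ * blockPerm B) (b.1 :: b.2) := by
    refine isCycleList_of_apply (nodup_of_mem_block h.1 hb) (by simp) fun x hx => ?_
    rw [Perm.mul_apply, blockPerm_apply_of_mem h.1 hb hx]
    exact h1 _ (mem_blockWord.2 ⟨b, hb, List.formPerm_apply_mem_of_mem hx⟩)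
  simp [hc.eq_cycleList]

theorem IsGoodBlocks.eq_of_blockEnds_eq {w : Perm X} {S : ℕ} {L : Multiset ℕ}
    {B B' : List (X × List X)} (h : IsGoodBlocks w S L B) (h' : IsGoodBlocks w S L B')
    (he : blockEnds B = blockEnds B') : B = B' := by
  rw [h.1.eq_map_blockEnds, h'.1.eq_map_blockEnds, he]

theorem nodup_blockWord_map {p : Perm X} {l : List X} (hl : l.Nodup)
    (h : ∀ a ∈ l, ∀ b ∈ l, p.SameCycle a b → a = b) :
    (blockWord (l.map fun c => (c, (cycleList p c).tail))).Nodup := by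
  have hc : ∀ c, c :: (cycleList p c).tail = cycleList p c := by
    intro c
    obtain ⟨m, hm⟩ := cycleList_eq_cons p c
    rw [hm, List.tail_cons]
  induction l with
  | nil => simp [blockWord]
  | cons a l ih =>
    rw [List.map_cons, blockWord_cons]
    have ih' := ih hl.of_cons fun b hb c hc => h b (by simp [hb]) c (by simp [hc])
    have hnd : (a :: (cycleList p a).tail).Nodup := by
      rw [hc]; exact (isCycleList_cycleList p a).1
    have hd : ∀ x ∈ a :: (cycleList p a).tail,
        x ∉ blockWord (l.map fun c => (c, (cycleList p c).tail)) := by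
      intro x hx hx'
      rw [hc, mem_cycleList] at hx
      obtain ⟨b, hb, hxb⟩ := mem_blockWord.1 hx'
      obtain ⟨c, hcl, rfl⟩ := List.mem_map.1 hb
      simp only [hc, mem_cycleList] at hxb
      have := h a (by simp) c (by simp [hcl]) (hx.trans hxb.symm)
      subst this
      exact (List.nodup_cons.1 hl).1 hcl
    rw [List.nodup_append, List.nodup_cons]
    refine ⟨hnd.of_cons, ⟨hd a (by simp), ih'⟩, ?_⟩
    rintro x hx y hy rfl
    rcases List.mem_cons.1 hy with rfl | hy
    · exact (List.nodup_cons.1 hnd).1 hx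
    · exact hd x (by simp [hx]) hy

/-- Attach to each point of q, read cyclically from x, the cycle of p through it. The additivity of
lengths makes these cycles distinct, and joining them along q gives a single cycle of pq = w. -/
theorem exists_isGoodBlocks {w q : Perm X} {S : ℕ} (hS : 2 ≤ S) {L : Multiset ℕ}
    (hL : (L.map fun k => k - 1).sum + (S - 1) = absLength w) (hq : q.cycleType = {S})
    (hp : (w * q⁻¹).cycleType = L) {x : X} (hx : x ∈ q.support) :
    ∃ B, IsGoodBlocks w S L B ∧ blockEnds B = q.toList x := by
  have hcyc : q.IsCycle := card_cycleType_eq_one.1 (by rw [hq]; simp)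
  have hqs : q.support.card = S := by rw [← sum_cycleType, hq, Multiset.sum_singleton]
  have hform : (q.toList x).formPerm = q := by
    rw [formPerm_toList, hcyc.cycleOf_eq (mem_support.1 hx)]
  have hlen : (q.toList x).length = S := by
    rw [length_toList, hcyc.cycleOf_eq (mem_support.1 hx), hqs]
  set p := w * q⁻¹ with hpw
  have hwpq : p * q = w := by rw [hpw]; group
  have habs : absLength (p * q) = absLength p + absLength q := by
    rw [hwpq, ← hL, absLength, absLength, hp, hq]
    simp
  set B := (q.toList x).map fun c => (c, (cycleList p c).tail) with hB
  have hends : blockEnds B = q.toList x := by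
    simp [hB, blockEnds, Function.comp_def]
  have hnd : (blockWord B).Nodup := by
    refine nodup_blockWord_map (nodup_toList q x) fun a ha b hb hab => ?_
    refine eq_of_sameCycle_of_absLength_mul habs hab ?_
    exact (mem_toList_iff.1 ha).1.symm.trans (mem_toList_iff.1 hb).1
  obtain ⟨τ, h1, h2⟩ := exists_eq_mul_blockPerm (p := p) hnd (by
    intro b hb
    obtain ⟨c, -, rfl⟩ := List.mem_map.1 hb
    obtain ⟨m, hm⟩ := cycleList_eq_cons p c
    simp only [hm, List.tail_cons]
    rw [← hm]
    exact isCycleList_cycleList p c)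
  have hw : w = τ * (blockWord B).formPerm := by
    rw [← blockPerm_mul_formPerm hnd, hends, hform, ← mul_assoc, ← h2, hwpq]
  have hBl : B.length = S := by rw [← length_blockEnds, hends, hlen]
  have hN : 2 ≤ (blockWord B).length := by
    have := length_le_length_blockWord B
    omega
  refine ⟨B, ⟨isCycleList_of_apply hnd ?_ ?_, hBl, ?_⟩, hends⟩
  · intro h0
    simp [h0] at hN
  · intro y hy
    rw [hw, Perm.mul_apply]
    exact h1 _ (List.formPerm_apply_mem_of_mem hy)
  · have hd1 : Disjoint τ (blockWord B).formPerm :=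
      disjoint_of_forall_apply_eq h1 fun x => List.formPerm_apply_of_notMem
    have hd2 : Disjoint τ (blockPerm B) :=
      disjoint_of_forall_apply_eq h1 fun x => blockPerm_apply_of_notMem
    have e1 : w.cycleType = τ.cycleType + {(blockWord B).length} := by
      conv_lhs => rw [hw]
      rw [hd1.cycleType_mul, cycleType_formPerm hnd hN]
    have e2 : L = τ.cycleType + (blockLengths B : Multiset ℕ).filter (2 ≤ ·) := by
      rw [← hp, h2, hd2.cycleType_mul, cycleType_blockPerm hnd]
    rw [e1, e2, add_right_comm]

/-- A cut amounts to a factorization together with a point of the S-cycle q at which the list of end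
letters starts; hence the factor S. -/
theorem card_isGoodBlocks_eq {w : Perm X} {S : ℕ} (hS : 2 ≤ S) {L : Multiset ℕ}
    (hL : (L.map fun k => k - 1).sum + (S - 1) = absLength w) :
    Nat.card {B // IsGoodBlocks w S L B} =
      S * (Finset.univ.filter fun q : Perm X => q.cycleType = {S} ∧ (w * q⁻¹).cycleType = L).card := by
  let T := {q : Perm X // q.cycleType = {S} ∧ (w * q⁻¹).cycleType = L}
  choose f hf1 hf2 using fun t : Σ q : T, {x // x ∈ q.1.support} =>
    exists_isGoodBlocks hS hL t.1.2.1 t.1.2.2 t.2.2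
  have hform : ∀ t : Σ q : T, {x // x ∈ q.1.support}, (t.1.1.toList t.2.1).formPerm = t.1.1 := by
    intro t
    have hcyc : t.1.1.IsCycle := card_cycleType_eq_one.1 (by rw [t.1.2.1]; simp)
    rw [formPerm_toList, hcyc.cycleOf_eq (mem_support.1 t.2.2)]
  have hbij : Function.Bijective (fun t => (⟨f t, hf1 t⟩ : {B // IsGoodBlocks w S L B})) := by
    constructor
    · intro t t' h
      have h := congrArg (fun B => blockEnds B.1) h
      simp only [hf2] at h
      have h1 : t.1 = t'.1 := by
        apply Subtype.ext
        rw [← hform t, ← hform t', h]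
      obtain ⟨q, x, hx⟩ := t
      obtain ⟨q', x', hx'⟩ := t'
      obtain rfl : q = q' := h1
      simp only at h
      have e : x = x' := by
        have h2 := toList_getElem_zero q.1 x hx
        have h3 := toList_getElem_zero q.1 x' hx'
        rw [← h2, ← h3]
        simp only [h]
      subst e
      rfl
    · rintro ⟨B, hB⟩
      have hl : 2 ≤ (blockEnds B).length := by rw [length_blockEnds, hB.2.1]; exact hS
      have hnd := hB.1.1.sublist (blockEnds_sublist B)
      let x := (blockEnds B)[0]
      have hx : x ∈ (blockEnds B).formPerm.support := by
        rw [support_formPerm hnd hl, List.mem_toFinset]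
        exact List.getElem_mem _
      refine ⟨⟨⟨_, hB.cycleType_ends hS, hB.cycleType_mul_inv hS⟩, x, hx⟩, Subtype.ext ?_⟩
      refine (hf1 _).eq_of_blockEnds_eq hB ?_
      rw [hf2]
      exact toList_formPerm_nontrivial _ hl hnd
  rw [← Nat.card_congr (Equiv.ofBijective _ hbij), Nat.card_sigma]
  have hc : ∀ q : T, Nat.card {x // x ∈ q.1.support} = S := by
    intro q
    rw [Nat.card_eq_fintype_card, Fintype.card_coe, ← sum_cycleType, q.2.1, Multiset.sum_singleton]
  simp only [hc, Finset.sum_const, smul_eq_mul, Finset.card_univ]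
  rw [mul_comm, Fintype.card_subtype]

/-- The lists of block lengths on a cycle of length `N`. -/
def IsGoodLengths (w : Perm X) (S : ℕ) (L : Multiset ℕ) (N : ℕ) (q : List ℕ) : Prop :=
  (∀ k ∈ q, 1 ≤ k) ∧ q.length = S ∧ q.sum = N ∧
    w.cycleType + (q : Multiset ℕ).filter (2 ≤ ·) = L + {N}

theorem finite_isGoodLengths (w : Perm X) (S : ℕ) (L : Multiset ℕ) (N : ℕ) :
    Finite {q // IsGoodLengths w S L N q} := by
  refine Set.Finite.to_subtype (s := {q | IsGoodLengths w S L N q}) ?_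
  refine (List.finite_length_eq (Fin (N + 1)) S |>.image (List.map Fin.val)).subset ?_
  rintro q ⟨-, h2, h3, -⟩
  have hle : ∀ k ∈ q, k < N + 1 := fun k hk => by
    have := List.single_le_sum (fun _ _ => Nat.zero_le _) k hk
    omega
  refine ⟨q.pmap Fin.mk hle, ?_, ?_⟩
  · simp [h2]
  · simp [List.map_pmap]

/-- The word of a cut is a cycle of w read from its first letter x, so the cut is determined by x
and the block lengths. -/
theorem card_isGoodBlocks_eq_sum (w : Perm X) (S : ℕ) (L : Multiset ℕ) :
    Nat.card {B // IsGoodBlocks w S L B} =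
      ∑ x, Nat.card {q // IsGoodLengths w S L (cycleList w x).length q} := by
  have hex : ∀ t : Σ x, {q // IsGoodLengths w S L (cycleList w x).length q},
      ∃ B, IsGoodBlocks w S L B ∧ blockWord B = cycleList w t.1 ∧ blockLengths B = t.2.1 := by
    rintro ⟨x, q, h1, h2, h3, h4⟩
    obtain ⟨B, hB, hl⟩ := exists_blocks q (cycleList w x) h1 h3.symm
    refine ⟨B, ⟨hB ▸ isCycleList_cycleList w x, ?_, by rw [hB, hl, h4]⟩, hB, hl⟩
    have := congrArg List.length hl
    rw [← h2, ← this]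
    simp [blockLengths]
  choose f hf1 hf2 hf3 using hex
  have hbij : Function.Bijective (fun t => (⟨f t, hf1 t⟩ : {B // IsGoodBlocks w S L B})) := by
    constructor
    · intro t t' h
      have e2 := congrArg (fun B => blockWord B.1) h
      have e3 := congrArg (fun B => blockLengths B.1) h
      simp only [hf2, hf3] at e2 e3
      obtain ⟨x, q, hq⟩ := t
      obtain ⟨x', q', hq'⟩ := t'
      obtain ⟨l, hl⟩ := cycleList_eq_cons w x
      obtain ⟨l', hl'⟩ := cycleList_eq_cons w x'
      simp only at e2 e3
      rw [hl, hl'] at e2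
      obtain rfl := (List.cons.inj e2).1
      subst e3
      rfl
    · rintro ⟨B, hB⟩
      obtain ⟨x, l, hxl⟩ := List.exists_cons_of_ne_nil hB.1.2.1
      have hw : cycleList w x = blockWord B := by
        rw [hxl]
        exact (hxl ▸ hB.1 : IsCycleList w (x :: l)).eq_cycleList
      refine ⟨⟨x, blockLengths B, ?_, ?_, ?_, ?_⟩, Subtype.ext (blockWord_injective ?_ ?_)⟩
      · intro k hk
        obtain ⟨b, -, rfl⟩ := List.mem_map.1 hk
        omega
      · rw [← hB.2.1]
        simp [blockLengths]
      · rw [hw, length_blockWord]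
      · rw [hw]
        exact hB.2.2
      · rw [hf2, hw]
      · rw [hf3]
  have := finite_isGoodLengths w S L
  rw [← Nat.card_congr (Equiv.ofBijective _ hbij), Nat.card_sigma]

/-- A cycle of length k has k starting points. The condition F 1 = 0 is needed because the cycle
type omits fixed points. -/
theorem sum_length_cycleList (w : Perm X) (F : ℕ → ℕ) (h1 : F 1 = 0) :
    ∑ x, F (cycleList w x).length = (w.cycleType.map fun k => k * F k).sum := by
  have h : ∑ x, F (cycleList w x).length = ∑ x ∈ w.support, F (cycleList w x).length := by
    refine (Finset.sum_subset (Finset.subset_univ _) fun x _ hx => ?_).symm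
    rw [notMem_support] at hx
    simp [cycleList, hx, h1]
  have hs : w.support = w.cycleFactorsFinset.biUnion support := by
    ext x
    rw [mem_support_iff_mem_support_of_mem_cycleFactorsFinset, Finset.mem_biUnion]
  rw [h, hs, Finset.sum_biUnion, cycleType_def, Multiset.map_map]
  · refine Finset.sum_congr rfl fun c hc => ?_
    rw [Finset.sum_congr rfl (g := fun _ => F c.support.card), Finset.sum_const, smul_eq_mul]
    · rfl
    · intro x hx
      rw [length_cycleList (mem_support.1 (mem_cycleFactorsFinset_support_le hc hx)),
        ← cycle_is_cycleOf hx hc]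
  · intro c hc d hd hcd
    exact (disjoint_iff_disjoint_support.1 (cycleFactorsFinset_pairwise_disjoint w hc hd hcd))

/-- The number of factorizations of `w` with lengths that add up. -/
theorem mul_card_factorizations {w : Perm X} {S : ℕ} (hS : 2 ≤ S) {L : Multiset ℕ}
    (hL : (L.map fun k => k - 1).sum + (S - 1) = absLength w) :
    S * (Finset.univ.filter fun q : Perm X => q.cycleType = {S} ∧ (w * q⁻¹).cycleType = L).card =
      (w.cycleType.map fun k => k * Nat.card {q // IsGoodLengths w S L k q}).sum := by
  rw [← card_isGoodBlocks_eq hS hL, card_isGoodBlocks_eq_sum,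
    sum_length_cycleList w fun k => Nat.card {q // IsGoodLengths w S L k q}]
  -- At least two positive lengths cannot sum to 1.
  have : IsEmpty {q // IsGoodLengths w S L 1 q} := by
    refine ⟨fun ⟨q, h1, h2, h3, _⟩ => ?_⟩
    have := List.length_le_sum_of_one_le q h1
    omega
  exact Nat.card_of_isEmpty

end Count

/-! ### The sign of a factorization -/

theorem oddPerm_mul_iff {n : ℕ} {p q : Perm (Fin n)} (h : Disjoint p q) :
    OddPerm (p * q) ↔ OddPerm p ∧ OddPerm q := by
  simp only [OddPerm, h.cycleType_mul, Multiset.mem_add]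
  exact ⟨fun H => ⟨fun k hk => H k (Or.inl hk), fun k hk => H k (Or.inr hk)⟩,
    fun H k hk => hk.elim (H.1 k) (H.2 k)⟩

theorem oddPerm_blockPerm {n : ℕ} {B : List (Fin n × List (Fin n))} (h : (blockWord B).Nodup)
    (ho : ∀ k ∈ blockLengths B, Odd k) : OddPerm (blockPerm B) := by
  intro k hk
  rw [cycleType_blockPerm h, Multiset.mem_filter] at hk
  exact ho k hk.1

theorem zElt_pow_comm {n : ℕ} (k : ℕ) (g : Cover n) : zElt n ^ k * g = g * zElt n ^ k :=
  ((show Commute (zElt n) g from zElt_comm g).pow_left k).eq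

/-- The lifted form of `blockPerm_mul_formPerm_append`. Each insertion costs one z, but for a block
of one letter this z cancels against the cycle element [c] = z, so only blocks with at least two
letters count. The parity condition keeps all intermediate words odd, hence invariant under
rotation. -/
theorem oddLift_blockPerm_mul_cyc {n : ℕ} (P : List (Fin n)) {B : List (Fin n × List (Fin n))}
    (h : (P ++ blockWord B).Nodup) (ho : ∀ k ∈ blockLengths B, Odd k)
    (hP : Odd (P.length + B.length)) :
    oddLift n (blockPerm B) * cyc n (P ++ blockEnds B) =
      zElt (n + 1) ^ ((blockLengths B).filter (2 ≤ ·)).length * cyc n (P ++ blockWord B) := by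
  induction B generalizing P with
  | nil => simp [blockPerm, blockEnds, blockWord, blockLengths, oddLift_one]
  | cons b B ih =>
    have hb : Odd (b.1 :: b.2).length := ho _ (by simp [blockLengths])
    have ho' : ∀ k ∈ blockLengths B, Odd k := fun k hk => ho k (by
      simp only [blockLengths, List.map_cons, List.mem_cons] at hk ⊢
      exact Or.inr hk)
    have hw : (blockWord (b :: B)).Nodup := h.of_append_right
    have hnd := nodup_of_mem_block hw (b := b) (by simp)
    rw [blockWord_cons] at h ⊢
    have e : P ++ blockEnds (b :: B) = (P ++ [b.1]) ++ blockEnds B := by simp [blockEnds]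
    have hs : ((P ++ [b.1]) ++ blockWord B).Nodup := by
      refine h.sublist ?_
      rw [List.append_assoc]
      exact List.Sublist.append_left (List.sublist_append_right _ _) _
    have hlen : Odd ((P ++ [b.1]).length + B.length) := by
      simp only [List.length_append, List.length_cons, List.length_nil] at hP ⊢
      convert hP using 1
      omega
    have hword : ∀ C : List (Fin n × List (Fin n)), (∀ k ∈ blockLengths C, Odd k) →
        ((blockWord C).length) % 2 = C.length % 2 := by
      intro C hC
      induction C with
      | nil => simp [blockWord]
      | cons c C ih =>
        have h1 := hC (c.2.length + 1) (by simp [blockLengths])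
        have h2 := ih fun k hk => hC k (by
          simp only [blockLengths, List.map_cons, List.mem_cons] at hk ⊢
          exact Or.inr hk)
        rw [blockWord_cons]
        simp only [List.length_append, List.length_cons]
        rw [Nat.odd_iff] at h1
        omega
    have hPQ : Odd (P ++ b.1 :: blockWord B).length := by
      have := hword B ho'
      simp only [List.length_append, List.length_cons] at hP ⊢
      rw [Nat.odd_iff] at hP ⊢
      omega
    have hins := cyc_mul_cyc_insert (P := P) (l := b.2) (c := b.1) (Q := blockWord B) hb
      (by rwa [List.append_assoc]) hPQ
    rw [List.append_assoc] at hins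
    have hz : oddLift n (b.1 :: b.2).formPerm =
        (if (b.1 :: b.2).length = 1 then zElt (n + 1) else 1) * cyc n (b.1 :: b.2) := by
      rw [oddLift_formPerm hnd hb]
      split_ifs
      · rw [← mul_assoc, zElt_mul_self, one_mul]
      · simp
    rw [blockPerm_cons, oddLift_mul (oddPerm_formPerm hnd hb)
      (oddPerm_blockPerm (nodup_blockWord_of_cons hw) ho') (disjoint_formPerm_blockPerm hw),
      mul_assoc, e, ih _ hs ho' hlen, List.append_assoc, List.singleton_append, ← mul_assoc,
      ← zElt_pow_comm, mul_assoc, hz, mul_assoc _ (cyc _ _), hins]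
    simp only [blockLengths, List.map_cons, List.filter_cons, List.length_cons]
    by_cases h1 : b.2.length + 1 = 1
    · have h2 : ¬ (decide (2 ≤ b.2.length + 1) = true) := by
        rw [decide_eq_true_eq]
        omega
      rw [if_pos h1, if_neg h2, ← mul_assoc (zElt (n + 1)) (zElt (n + 1)), zElt_mul_self,
        one_mul]
    · have h2 : decide (2 ≤ b.2.length + 1) = true := by
        rw [decide_eq_true_eq]
        omega
      rw [if_neg h1, if_pos h2, List.length_cons, pow_succ, one_mul, mul_assoc]

/-- K is the number of blocks with at least two letters. Comparing numbers of cycles fixes it in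
terms of w and L alone, so the sign is common to all factorizations. -/
theorem oddLift_mul_oddLift {n : ℕ} {w : Perm (Fin n)} {S : ℕ} {L : Multiset ℕ}
    {B : List (Fin n × List (Fin n))} (h : IsGoodBlocks w S L B) (hS : 3 ≤ S) (hSo : Odd S)
    (hw : OddPerm w) (hL : ∀ k ∈ L, Odd k) :
    ∃ K, K + Multiset.card w.cycleType = Multiset.card L + 1 ∧
      oddLift n (w * (blockEnds B).formPerm⁻¹) * oddLift n (blockEnds B).formPerm =
        zElt (n + 1) ^ K * oddLift n w := by
  obtain ⟨τ, h1, h2, h3⟩ := h.1.exists_blocks_decomposition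
  have hBl := h.2.1
  have hN : 3 ≤ (blockWord B).length := hS.trans (hBl ▸ length_le_length_blockWord B)
  have hd1 : Disjoint τ (blockWord B).formPerm :=
    disjoint_of_forall_apply_eq h1 fun x => List.formPerm_apply_of_notMem
  have hd2 : Disjoint τ (blockPerm B) :=
    disjoint_of_forall_apply_eq h1 fun x => blockPerm_apply_of_notMem
  have hw' := hw
  rw [h2, oddPerm_mul_iff hd1] at hw'
  have hWo : Odd (blockWord B).length := by
    refine hw'.2 _ ?_
    rw [cycleType_formPerm h.1.1 (by omega)]
    simp
  -- A block with at least two letters is a cycle of w q⁻¹, whose cycle lengths are those in L.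
  have hlen : ∀ k ∈ blockLengths B, Odd k := by
    intro k hk
    have hk1 : 1 ≤ k := by
      obtain ⟨b, -, rfl⟩ := List.mem_map.1 hk
      omega
    rcases hk1.eq_or_lt with rfl | hk2
    · exact odd_one
    · refine hL k ?_
      rw [← h.cycleType_mul_inv (by omega), h3, hd2.cycleType_mul, cycleType_blockPerm h.1.1]
      exact Multiset.mem_add.2 (Or.inr (Multiset.mem_filter.2 ⟨hk, hk2⟩))
  refine ⟨((blockLengths B).filter (2 ≤ ·)).length, ?_, ?_⟩
  · have h4 := congrArg Multiset.card h.2.2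
    rw [Multiset.card_add, Multiset.card_add, Multiset.card_singleton, Multiset.filter_coe,
      Multiset.coe_card] at h4
    omega
  · have hendl : (blockEnds B).length = S := by rw [length_blockEnds, hBl]
    have hends := oddLift_formPerm (h.1.1.sublist (blockEnds_sublist B)) (hendl ▸ hSo)
    rw [if_neg (by omega), one_mul] at hends
    have hword := oddLift_formPerm h.1.1 hWo
    rw [if_neg (by omega), one_mul] at hword
    have key := oddLift_blockPerm_mul_cyc [] (B := B) h.1.1 hlen (by simpa [hBl] using hSo)
    rw [List.nil_append, List.nil_append, hends, hword] at key
    rw [h3, oddLift_mul hw'.1 (oddPerm_blockPerm h.1.1 hlen) hd2, mul_assoc, key, ← mul_assoc,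
      ← zElt_pow_comm, mul_assoc]
    conv_rhs => rw [h2]
    rw [oddLift_mul hw'.1 hw'.2 hd1]

theorem absLength_of_cycleType {n : ℕ} {p : Perm (Fin n)} {ν : EvenPartition}
    (h : p.cycleType = cycleLengths ν) : absLength p = size ν := by
  simp [absLength, h, cycleLengths, size]

-- An element of a split class is determined by its permutation, so the convolution counts
-- factorizations in the symmetric group whose canonical lifts multiply to u.
open Classical in
theorem convInd_eq_card (n : ℕ) (lam : EvenPartition) (s : EvenPart) (u : Cover n) :
    convInd n lam {s} u = ((Finset.univ.filter fun q : Perm (Fin n) =>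
      (q.cycleType = {s.1 + 1} ∧ (perm n u * q⁻¹).cycleType = cycleLengths lam) ∧
        oddLift n (perm n u * q⁻¹) * oddLift n q = embed n u).card : ℤ) := by
  classical
  have hs : cycleLengths {s} = {s.1 + 1} := by simp [cycleLengths]
  have e : convInd n lam {s} u = ((Finset.univ.filter fun h : Cover n =>
      u * h⁻¹ ∈ splitClass n lam ∧ h ∈ splitClass n {s}).card : ℤ) := by
    rw [convInd, Finset.card_filter, Nat.cast_sum]
    refine Finset.sum_congr rfl fun h _ => ?_
    by_cases h1 : u * h⁻¹ ∈ splitClass n lam <;> by_cases h2 : h ∈ splitClass n {s} <;>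
      simp [classInd, h1, h2]
  rw [e, Nat.cast_inj]
  refine Finset.card_bij (fun h _ => perm n h) ?_ ?_ ?_
  · intro h hh
    simp only [Finset.mem_filter, Finset.mem_univ, true_and, mem_splitClass] at hh ⊢
    obtain ⟨⟨h1, h2⟩, h3, h4⟩ := hh
    rw [map_mul, map_inv] at h1 h2
    refine ⟨⟨h3.trans hs, h1⟩, ?_⟩
    rw [map_mul, map_inv] at h2
    rw [← h2, ← h4, inv_mul_cancel_right]
  · intro h hh h' hh' heq
    simp only [Finset.mem_filter, Finset.mem_univ, true_and, mem_splitClass] at hh hh'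
    refine embed_injective n ?_
    rw [hh.2.2, hh'.2.2, heq]
  · intro q hq
    simp only [Finset.mem_filter, Finset.mem_univ, true_and] at hq
    obtain ⟨⟨h1, h2⟩, h3⟩ := hq
    obtain ⟨h, hh, rfl⟩ := exists_embed_eq_oddLift (oddPerm_of_cycleType (h1.trans hs.symm))
    refine ⟨h, ?_, rfl⟩
    simp only [Finset.mem_filter, Finset.mem_univ, true_and, mem_splitClass, map_mul, map_inv]
    refine ⟨⟨h2, ?_⟩, h1.trans hs.symm, hh⟩
    rw [← h3, hh, mul_inv_cancel_right]

-- By the constancy of the sign, all factorizations are counted either at g or at zg, according to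
-- the parity of ℓ(λ) + 1 + ℓ(ν).
open Classical in
theorem spinCoeff_eq {n : ℕ} {lam ν : EvenPartition} {s : EvenPart} (hν : size ν = size lam + s.1)
    {g : Cover n} (hg : g ∈ splitClass n ν) :
    spinCoeff n lam {s} g = (-1) ^ (Multiset.card lam + 1 + Multiset.card ν) *
      ((Finset.univ.filter fun q : Perm (Fin n) =>
        q.cycleType = {s.1 + 1} ∧ (perm n g * q⁻¹).cycleType = cycleLengths lam).card : ℤ) := by
  obtain ⟨hw, he⟩ := mem_splitClass.1 hg
  have hwo := oddPerm_of_cycleType hw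
  have hs1 := s.2.1
  have hs3 : 3 ≤ s.1 + 1 := by
    obtain ⟨k, hk⟩ := s.2.2
    omega
  have hL : ((cycleLengths lam).map fun k => k - 1).sum + (s.1 + 1 - 1) =
      absLength (perm n g) := by
    rw [absLength_of_cycleType hw, hν]
    simp [cycleLengths, size]
  have key : ∀ q : Perm (Fin n), q.cycleType = {s.1 + 1} →
      (perm n g * q⁻¹).cycleType = cycleLengths lam →
      ∃ K, K + Multiset.card ν = Multiset.card lam + 1 ∧
        oddLift n (perm n g * q⁻¹) * oddLift n q = zElt (n + 1) ^ K * embed n g := by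
    intro q hq hp
    have hcyc : q.IsCycle := card_cycleType_eq_one.1 (by rw [hq]; simp)
    obtain ⟨x, hx⟩ := hcyc.nonempty_support
    obtain ⟨B, hB, hBe⟩ := exists_isGoodBlocks (by omega) hL hq hp hx
    obtain ⟨K, hK, h⟩ := oddLift_mul_oddLift hB hs3 s.2.2.add_one hwo (by
      rw [← hp]
      exact oddPerm_of_cycleType hp)
    rw [hBe, formPerm_toList, hcyc.cycleOf_eq (mem_support.1 hx), ← he] at h
    refine ⟨K, ?_, h⟩
    rw [hw] at hK
    simpa [cycleLengths] using hK
  rw [spinCoeff, convInd_eq_card, convInd_eq_card, map_mul (perm n), perm_zElt, one_mul,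
    map_mul (embed n), embed_zElt]
  have hne : zElt (n + 1) * embed n g ≠ embed n g := fun h =>
    zElt_ne_one _ (mul_eq_right.1 h)
  have hzp : ∀ K, zElt (n + 1) ^ K = if Even K then 1 else zElt (n + 1) := by
    intro K
    split_ifs with hK
    · obtain ⟨m, rfl⟩ := hK
      rw [← two_mul, pow_mul, sq, zElt_mul_self, one_pow]
    · obtain ⟨m, rfl⟩ := Nat.not_even_iff_odd.1 hK
      rw [pow_succ, pow_mul, sq, zElt_mul_self, one_pow, one_mul]
  by_cases hpar : Even (Multiset.card lam + 1 + Multiset.card ν)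
  · rw [hpar.neg_one_pow, one_mul]
    have e1 : (Finset.univ.filter fun q : Perm (Fin n) =>
        (q.cycleType = {s.1 + 1} ∧ (perm n g * q⁻¹).cycleType = cycleLengths lam) ∧
        oddLift n (perm n g * q⁻¹) * oddLift n q = embed n g) = Finset.univ.filter fun q =>
        q.cycleType = {s.1 + 1} ∧ (perm n g * q⁻¹).cycleType = cycleLengths lam := by
      refine Finset.filter_congr fun q _ => and_iff_left_of_imp fun ⟨h1, h2⟩ => ?_
      obtain ⟨K, hK, h⟩ := key q h1 h2
      rw [h, hzp, if_pos (by grind), one_mul]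
    have e2 : (Finset.univ.filter fun q : Perm (Fin n) =>
        (q.cycleType = {s.1 + 1} ∧ (perm n g * q⁻¹).cycleType = cycleLengths lam) ∧
        oddLift n (perm n g * q⁻¹) * oddLift n q = zElt (n + 1) * embed n g) = ∅ := by
      refine Finset.filter_eq_empty_iff.2 fun q _ => ?_
      rintro ⟨⟨h1, h2⟩, h3⟩
      obtain ⟨K, hK, h⟩ := key q h1 h2
      rw [h, hzp, if_pos (by grind), one_mul] at h3
      exact hne h3.symm
    rw [e1, e2]
    simp
  · rw [(Nat.not_even_iff_odd.1 hpar).neg_one_pow, neg_one_mul]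
    have e1 : (Finset.univ.filter fun q : Perm (Fin n) =>
        (q.cycleType = {s.1 + 1} ∧ (perm n g * q⁻¹).cycleType = cycleLengths lam) ∧
        oddLift n (perm n g * q⁻¹) * oddLift n q = zElt (n + 1) * embed n g) =
        Finset.univ.filter fun q =>
        q.cycleType = {s.1 + 1} ∧ (perm n g * q⁻¹).cycleType = cycleLengths lam := by
      refine Finset.filter_congr fun q _ => and_iff_left_of_imp fun ⟨h1, h2⟩ => ?_
      obtain ⟨K, hK, h⟩ := key q h1 h2
      rw [h, hzp, if_neg (by grind)]
    have e2 : (Finset.univ.filter fun q : Perm (Fin n) =>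
        (q.cycleType = {s.1 + 1} ∧ (perm n g * q⁻¹).cycleType = cycleLengths lam) ∧
        oddLift n (perm n g * q⁻¹) * oddLift n q = embed n g) = ∅ := by
      refine Finset.filter_eq_empty_iff.2 fun q _ => ?_
      rintro ⟨⟨h1, h2⟩, h3⟩
      obtain ⟨K, hK, h⟩ := key q h1 h2
      rw [h, hzp, if_neg (by grind)] at h3
      exact hne h3
    rw [e1, e2]
    simp

/-! ### Lists with a given multiset of entries -/

theorem finite_lists {α : Type*} (m : Multiset α) : Finite {l : List α // (l : Multiset α) = m} := by
  classical
  refine Set.Finite.to_subtype ((Multiset.lists m).finite_toSet.subset fun l hl => ?_)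
  rw [Set.mem_ofPred_eq, Multiset.mem_lists_iff]
  exact hl.symm

/-- A nonempty list with multiset of entries `m` is the same as its head and its tail. -/
def listsEquivSigma {α : Type*} [DecidableEq α] (m : Multiset α) (hm : m ≠ 0) :
    {l : List α // (l : Multiset α) = m} ≃
      (a : m.toFinset) × {l : List α // (l : Multiset α) = m.erase a.1} where
  toFun
    | ⟨[], h⟩ => (hm h.symm).elim
    | ⟨a :: l, h⟩ => ⟨⟨a, by simp [← h]⟩, l, by simp [← h]⟩
  invFun x := ⟨x.1.1 :: x.2.1, by
    rw [← Multiset.cons_coe, x.2.2, Multiset.cons_erase (Multiset.mem_toFinset.1 x.1.2)]⟩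
  left_inv
    | ⟨[], h⟩ => (hm h.symm).elim
    | ⟨a :: l, h⟩ => rfl
  right_inv _ := rfl

theorem prod_factorial_count_erase {α : Type*} [DecidableEq α] {m : Multiset α} {a : α}
    (ha : a ∈ m) : ∏ i ∈ m.toFinset, (m.count i).factorial =
      m.count a * ∏ i ∈ (m.erase a).toFinset, ((m.erase a).count i).factorial := by
  have h1 : ∏ i ∈ (m.erase a).toFinset, ((m.erase a).count i).factorial =
      ∏ i ∈ m.toFinset, ((m.erase a).count i).factorial := by
    refine Finset.prod_subset (Multiset.toFinset_subset.2
      (Multiset.subset_of_le (Multiset.erase_le _ _))) fun i _ hi => ?_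
    rw [Multiset.mem_toFinset] at hi
    rw [Multiset.count_eq_zero_of_notMem hi, Nat.factorial_zero]
  have ham := Multiset.mem_toFinset.2 ha
  rw [h1, ← Finset.mul_prod_erase _ _ ham, ← Finset.mul_prod_erase _ _ ham, ← mul_assoc,
    Multiset.count_erase_self, Nat.mul_factorial_pred (Multiset.count_ne_zero.2 ha)]
  congr 1
  refine Finset.prod_congr rfl fun i hi => ?_
  rw [Multiset.count_erase_of_ne (Finset.ne_of_mem_erase hi)]

/-- The multinomial formula, by induction on the first entry a: it contributes count a · N!, and the
multiplicities add up to N + 1. -/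
theorem prod_factorial_count_mul_card_lists {α : Type*} [DecidableEq α] (m : Multiset α) :
    (∏ i ∈ m.toFinset, (m.count i).factorial) * Nat.card {l : List α // (l : Multiset α) = m} =
      (Multiset.card m).factorial := by
  induction hN : Multiset.card m generalizing m with
  | zero =>
    rw [Multiset.card_eq_zero] at hN
    subst hN
    simp
  | succ N ih =>
    have hm : m ≠ 0 := by
      rintro rfl
      simp at hN
    have := fun a => finite_lists (m.erase a)
    have key : ∀ a : m.toFinset, (∏ i ∈ m.toFinset, (m.count i).factorial) *
        Nat.card {l : List α // (l : Multiset α) = m.erase a.1} = m.count a.1 * N.factorial := by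
      intro a
      have ha := Multiset.mem_toFinset.1 a.2
      rw [prod_factorial_count_erase ha, mul_assoc, ih]
      rw [Multiset.card_erase_of_mem ha, hN, Nat.pred_succ]
    rw [Nat.card_congr (listsEquivSigma m hm), Nat.card_sigma, Finset.mul_sum,
      Finset.sum_congr rfl fun a _ => key a, ← Finset.sum_mul, Nat.factorial_succ, ← hN,
      ← Multiset.toFinset_sum_count_eq, ← Finset.sum_coe_sort m.toFinset fun a => m.count a]

/-! ### The coefficients of top degree -/

/-- The coefficient of `d_{(s + |μ|)}` in `d_μ d_s`. -/
def topCoeff (s : EvenPart) (μ : EvenPartition) : ℚ :=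
  if Multiset.card μ ≤ s.1 + 1 then
    (-1) ^ Multiset.card μ * ((size μ : ℚ) + s.1 + 1) * s.1.factorial /
      ((s.1 + 1 - Multiset.card μ).factorial * ∏ i ∈ μ.toFinset, ((μ.count i).factorial : ℚ))
  else 0

/-- The coefficient of `d_ν` in `d_lam d_s`, for `|ν| = |lam| + s`. -/
def topValue (lam : EvenPartition) (s : EvenPart) (ν : EvenPartition) : ℚ :=
  (ν.map fun k => if ν ≤ lam + {k} then topCoeff s (lam + {k} - ν) else 0).sum

theorem size_add (μ ν : EvenPartition) : size (μ + ν) = size μ + size ν := by simp [size]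

theorem size_singleton (k : EvenPart) : size {k} = k.1 := by simp [size]

theorem cycleLengths_add (μ ν : EvenPartition) :
    cycleLengths (μ + ν) = cycleLengths μ + cycleLengths ν := by simp [cycleLengths]

theorem cycleLengths_singleton (k : EvenPart) : cycleLengths {k} = {k.1 + 1} := by
  simp [cycleLengths]

theorem two_le_of_mem_cycleLengths {ν : EvenPartition} {k : ℕ} (h : k ∈ cycleLengths ν) :
    2 ≤ k := by
  obtain ⟨p, -, rfl⟩ := Multiset.mem_map.1 h
  have := p.2.1
  omega

theorem filter_cycleLengths (ν : EvenPartition) :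
    (cycleLengths ν).filter (2 ≤ ·) = cycleLengths ν :=
  Multiset.filter_eq_self.2 fun _ => two_le_of_mem_cycleLengths

/-- The entries exceeding 1 are forced to be the cycle lengths of μ and the others are ones. The sum
is then automatic from the sizes. -/
theorem isGoodLengths_iff {n : ℕ} {w : Perm (Fin n)} {lam μ ν : EvenPartition} {s k : EvenPart}
    (hw : w.cycleType = cycleLengths ν) (hν : size ν = size lam + s.1) (hμ : μ + ν = lam + {k})
    (q : List ℕ) :
    IsGoodLengths w (s.1 + 1) (cycleLengths lam) (k.1 + 1) q ↔
      Multiset.card μ ≤ s.1 + 1 ∧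
        (q : Multiset ℕ) = cycleLengths μ + Multiset.replicate (s.1 + 1 - Multiset.card μ) 1 := by
  have hc : cycleLengths lam + {k.1 + 1} = cycleLengths ν + cycleLengths μ := by
    rw [← cycleLengths_singleton, ← cycleLengths_add, ← hμ, cycleLengths_add, add_comm]
  have hcard : Multiset.card (cycleLengths μ) = Multiset.card μ := by simp [cycleLengths]
  rw [IsGoodLengths, hw, hc, add_right_inj]
  constructor
  · rintro ⟨h1, h2, h3, h4⟩
    have h5 : (q : Multiset ℕ).filter (fun k => ¬ 2 ≤ k) =
        Multiset.replicate (Multiset.card ((q : Multiset ℕ).filter fun k => ¬ 2 ≤ k)) 1 := by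
      refine Multiset.eq_replicate_card.2 fun b hb => ?_
      obtain ⟨hb1, hb2⟩ := Multiset.mem_filter.1 hb
      have := h1 b hb1
      omega
    have h6 := Multiset.filter_add_not (fun k => 2 ≤ k) (q : Multiset ℕ)
    have h7 := congrArg Multiset.card h6
    rw [Multiset.card_add, h4, hcard, Multiset.coe_card, h2] at h7
    refine ⟨by omega, ?_⟩
    rw [← h6, h4, h5]
    congr 2
    omega
  · rintro ⟨h1, h2⟩
    refine ⟨fun k hk => ?_, ?_, ?_, ?_⟩
    · rw [← Multiset.mem_coe, h2, Multiset.mem_add] at hk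
      rcases hk with hk | hk
      · exact one_le_two.trans (two_le_of_mem_cycleLengths hk)
      · rw [Multiset.eq_of_mem_replicate hk]
    · rw [← Multiset.coe_card, h2, Multiset.card_add, Multiset.card_replicate, hcard]
      omega
    · rw [← Multiset.sum_coe, h2, Multiset.sum_add, sum_cycleLengths, Multiset.sum_replicate,
        smul_eq_mul, mul_one]
      have := congrArg size hμ
      rw [size_add, size_add, size_singleton] at this
      omega
    · rw [h2, Multiset.filter_add, filter_cycleLengths, add_eq_left, Multiset.filter_eq_nil]
      intro a ha
      rw [Multiset.eq_of_mem_replicate ha]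
      omega

theorem not_isGoodLengths {n : ℕ} {w : Perm (Fin n)} {lam ν : EvenPartition} {S : ℕ} {k : EvenPart}
    (hw : w.cycleType = cycleLengths ν) (hν : ¬ ν ≤ lam + {k}) (q : List ℕ) :
    ¬ IsGoodLengths w S (cycleLengths lam) (k.1 + 1) q := by
  rintro ⟨-, -, -, h⟩
  rw [hw, ← cycleLengths_singleton, ← cycleLengths_add] at h
  have hle : cycleLengths ν ≤ cycleLengths (lam + {k}) := by
    rw [← h]
    exact Multiset.le_add_right _ _
  exact hν ((Multiset.map_le_map_iff fun a b hab => Subtype.ext (Nat.succ_injective hab)).1 hle)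

/-- The cycle lengths of μ are at least 2, so the added ones contribute a separate factor r!. -/
theorem prod_factorial_count_cycleLengths (μ : EvenPartition) (r : ℕ) :
    ∏ i ∈ (cycleLengths μ + Multiset.replicate r 1).toFinset,
      ((cycleLengths μ + Multiset.replicate r 1).count i).factorial =
      r.factorial * ∏ i ∈ μ.toFinset, (μ.count i).factorial := by
  have hinj : Function.Injective fun p : EvenPart => p.1 + 1 := fun a b hab =>
    Subtype.ext (Nat.succ_injective hab)
  have h1 : ∀ i ∈ insert 1 (μ.toFinset.image fun p : EvenPart => p.1 + 1),
      i ∉ (cycleLengths μ + Multiset.replicate r 1).toFinset →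
      ((cycleLengths μ + Multiset.replicate r 1).count i).factorial = 1 := by
    intro i _ hi
    rw [Multiset.mem_toFinset] at hi
    rw [Multiset.count_eq_zero_of_notMem hi, Nat.factorial_zero]
  have hnot : 1 ∉ cycleLengths μ := fun h => by
    have := two_le_of_mem_cycleLengths h
    omega
  rw [Finset.prod_subset (fun i hi => ?_) h1, Finset.prod_insert, Finset.prod_image hinj.injOn]
  · congr 1
    · rw [Multiset.count_add, Multiset.count_eq_zero_of_notMem hnot, zero_add,
        Multiset.count_replicate_self]
    · refine Finset.prod_congr rfl fun p _ => ?_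
      have hp := p.2.1
      have h : p.1 + 1 ∉ Multiset.replicate r 1 := fun h => by
        have := Multiset.eq_of_mem_replicate h
        omega
      rw [Multiset.count_add, Multiset.count_eq_zero_of_notMem h, add_zero, cycleLengths,
        Multiset.count_map_eq_count' (fun p : EvenPart => p.1 + 1) _ hinj]
  · intro h
    obtain ⟨p, -, hp⟩ := Finset.mem_image.1 h
    have := p.2.1
    omega
  · rw [Multiset.mem_toFinset, Multiset.mem_add] at hi
    rcases hi with hi | hi
    · obtain ⟨p, hp, rfl⟩ := Multiset.mem_map.1 hi
      exact Finset.mem_insert_of_mem (Finset.mem_image_of_mem _ (Multiset.mem_toFinset.2 hp))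
    · rw [Multiset.eq_of_mem_replicate hi]
      exact Finset.mem_insert_self _ _

/-- There are (s+1)! / ((s+1-ℓ(μ))! ∏ m_i(μ)!) arrangements. The factor s + 1 taken out of (s+1)!
cancels later against the choice of a starting point on q. -/
theorem card_isGoodLengths {n : ℕ} {w : Perm (Fin n)} {lam ν : EvenPartition} {s k : EvenPart}
    (hw : w.cycleType = cycleLengths ν) (hν : size ν = size lam + s.1) :
    (-1) ^ (Multiset.card lam + 1 + Multiset.card ν) * (((k.1 + 1) *
      Nat.card {q // IsGoodLengths w (s.1 + 1) (cycleLengths lam) (k.1 + 1) q} : ℕ) : ℚ) =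
      (s.1 + 1) * if ν ≤ lam + {k} then topCoeff s (lam + {k} - ν) else 0 := by
  by_cases h : ν ≤ lam + {k}
  · rw [if_pos h]
    set μ := lam + {k} - ν with hμ
    have hμν : μ + ν = lam + {k} := Multiset.sub_add_cancel h
    -- ℓ(λ) + 1 = ℓ(μ) + ℓ(ν), so the exponents differ by the even number 2ℓ(ν).
    have hsign : (-1 : ℚ) ^ (Multiset.card lam + 1 + Multiset.card ν) =
        (-1) ^ Multiset.card μ := by
      have := congrArg Multiset.card hμν
      rw [Multiset.card_add, Multiset.card_add, Multiset.card_singleton] at this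
      rw [← this, pow_add, pow_add, mul_assoc, ← mul_pow]
      simp
    have hk : k.1 = size μ + s.1 := by
      have := congrArg size hμν
      rw [size_add, size_add, size_singleton] at this
      omega
    rw [hsign, topCoeff]
    split_ifs with hc
    · have e : Nat.card {q // IsGoodLengths w (s.1 + 1) (cycleLengths lam) (k.1 + 1) q} =
          Nat.card {q : List ℕ // (q : Multiset ℕ) =
            cycleLengths μ + Multiset.replicate (s.1 + 1 - Multiset.card μ) 1} :=
        Nat.card_congr (Equiv.subtypeEquivRight fun q => by
          rw [isGoodLengths_iff hw hν hμν, and_iff_right hc])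
      have h2 := prod_factorial_count_mul_card_lists
        (cycleLengths μ + Multiset.replicate (s.1 + 1 - Multiset.card μ) 1)
      have hcard : Multiset.card (cycleLengths μ +
          Multiset.replicate (s.1 + 1 - Multiset.card μ) 1) = s.1 + 1 := by
        simp only [cycleLengths, Multiset.card_add, Multiset.card_map, Multiset.card_replicate]
        omega
      rw [prod_factorial_count_cycleLengths, hcard, ← e, Nat.factorial_succ] at h2
      have h3 := congrArg (Nat.cast (R := ℚ)) h2
      push_cast at h3 ⊢
      have h4 : ((s.1 + 1 - Multiset.card μ).factorial : ℚ) *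
          ∏ i ∈ μ.toFinset, ((μ.count i).factorial : ℚ) ≠ 0 :=
        mul_ne_zero (by positivity) (Finset.prod_ne_zero_iff.2 fun i _ => by positivity)
      generalize (Nat.card _ : ℚ) = c at h3 ⊢
      rw [mul_div_assoc', eq_div_iff h4, hk]
      push_cast
      linear_combination (-1) ^ Multiset.card μ * ((size μ : ℚ) + s.1 + 1) * h3
    · rw [mul_zero, Nat.card_eq_zero.2 (Or.inl ⟨fun q =>
        hc ((isGoodLengths_iff hw hν hμν q.1).1 q.2).1⟩)]
      simp
  · rw [if_neg h, mul_zero, Nat.card_eq_zero.2 (Or.inl ⟨fun q => not_isGoodLengths hw h q.1 q.2⟩)]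
    simp

/-- The signed number of factorizations, summed over the cycle of w that is cut. Nothing on the
right depends on n, which is why the structure polynomials of top degree are constants. -/
theorem spinCoeff_eq_topValue {n : ℕ} {lam ν : EvenPartition} {s : EvenPart}
    (hν : size ν = size lam + s.1) {g : Cover n} (hg : g ∈ splitClass n ν) :
    (spinCoeff n lam {s} g : ℚ) = topValue lam s ν := by
  obtain ⟨hw, -⟩ := mem_splitClass.1 hg
  have hs1 := s.2.1
  have hL : ((cycleLengths lam).map fun k => k - 1).sum + (s.1 + 1 - 1) =
      absLength (perm n g) := by
    rw [absLength_of_cycleType hw, hν]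
    simp [cycleLengths, size]
  have h1 := mul_card_factorizations (by omega) hL
  rw [hw, show cycleLengths ν = ν.map fun p => p.1 + 1 from rfl, Multiset.map_map] at h1
  have h2 := congrArg (Nat.cast (R := ℚ)) h1
  rw [Nat.cast_mul, Nat.cast_multiset_sum, Multiset.map_map] at h2
  have h3 : ((s.1 : ℚ) + 1) ≠ 0 := by positivity
  rw [spinCoeff_eq hν hg]
  refine mul_left_cancel₀ h3 ?_
  rw [topValue, ← Multiset.sum_map_mul_left, ← Multiset.map_congr rfl fun k _ =>
    card_isGoodLengths hw hν, Multiset.sum_map_mul_left]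
  push_cast at h2 ⊢
  rw [mul_left_comm, h2]
  simp only [Function.comp_def, Nat.cast_mul, Nat.cast_add, Nat.cast_one]

end SpinFH

namespace SpinFH

open Polynomial

/-! ### The structure polynomials of top degree -/

theorem splitClass_nonempty {n : ℕ} {ν : EvenPartition} (h : size ν + Multiset.card ν ≤ n) :
    (splitClass n ν).Nonempty := by
  obtain ⟨w, hw, -⟩ := exists_perm_distinguished h
  obtain ⟨g, hg, rfl⟩ := exists_embed_eq_oddLift (oddPerm_of_cycleType hw)
  exact ⟨g, mem_splitClass.2 ⟨hw, hg⟩⟩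

/-- The value is an actual structure constant for the smallest n at which the class of ν is
nonempty, hence an integer. -/
theorem exists_intCast_eq_topValue {lam ν : EvenPartition} {s : EvenPart}
    (hν : size ν = size lam + s.1) : ∃ z : ℤ, (z : ℚ) = topValue lam s ν := by
  obtain ⟨g, hg⟩ := splitClass_nonempty (le_refl (size ν + Multiset.card ν))
  exact ⟨_, spinCoeff_eq_topValue hν hg⟩

theorem coe_intCast_integerValued (z : ℤ) : ((z : integerValued) : ℚ[X]) = C (z : ℚ) := by
  simp

/-- A polynomial that takes the value z at all large natural numbers is the constant z. -/
theorem isStructurePolynomial_iff {lam ν : EvenPartition} {s : EvenPart}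
    (hν : size ν = size lam + s.1) {z : ℤ} (hz : (z : ℚ) = topValue lam s ν) (p : integerValued) :
    IsStructurePolynomial lam {s} ν p ↔ p = z := by
  have key : ∀ n, size ν + Multiset.card ν ≤ n → ∀ a, IsStructureConstants n lam {s} a →
      (a ν : ℚ) = z := by
    intro n hn a ha
    obtain ⟨g, hg⟩ := splitClass_nonempty hn
    rw [ha.apply_eq hg, spinCoeff_eq_topValue hν hg, hz]
  constructor
  · intro hp
    refine Subtype.ext ?_
    rw [coe_intCast_integerValued]
    refine Polynomial.eq_of_infinite_eval_eq _ _ (Set.infinite_of_injective_forall_mem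
      (f := fun n : ℕ => ((size ν + Multiset.card ν + n : ℕ) : ℚ)) (fun a b hab => ?_) fun n => ?_)
    · have := Nat.cast_injective hab
      omega
    · obtain ⟨⟨a, ha⟩, h⟩ := hp _ (Nat.le_add_right (size ν + Multiset.card ν) n)
      change _ = _
      rw [← h a ha, eval_C, key _ (Nat.le_add_right _ _) a ha]
  · rintro rfl n hn
    refine ⟨exists_isStructureConstants n lam {s}, fun a ha => ?_⟩
    rw [key n hn a ha, coe_intCast_integerValued, eval_C]

theorem structurePolynomial_eq {lam ν : EvenPartition} {s : EvenPart}
    (hν : size ν = size lam + s.1) {z : ℤ} (hz : (z : ℚ) = topValue lam s ν) :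
    structurePolynomial lam {s} ν = z := by
  have h : ∃ p, IsStructurePolynomial lam {s} ν p := ⟨z, (isStructurePolynomial_iff hν hz _).2 rfl⟩
  rw [structurePolynomial, dif_pos h]
  exact (isStructurePolynomial_iff hν hz _).1 h.choose_spec

theorem topValue_addSize (lam : EvenPartition) (s : EvenPart) :
    topValue lam s {addSize s lam} = topCoeff s lam := by
  rw [topValue, Multiset.map_singleton, Multiset.sum_singleton,
    if_pos (Multiset.le_add_left _ _), Multiset.add_sub_cancel_right]

theorem size_addSize (lam : EvenPartition) (s : EvenPart) :
    size {addSize s lam} = size lam + s.1 := by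
  rw [size_singleton]
  exact Nat.add_comm _ _

/-- The integer `topCoeff s μ`. -/
def topInt (s : EvenPart) (μ : EvenPartition) : ℤ := ⌊topCoeff s μ⌋

/-- `topCoeff` is the value for the one-part partition (s + |μ|), hence an integer, so the floor
loses nothing. -/
theorem cast_topInt (s : EvenPart) (μ : EvenPartition) : (topInt s μ : ℚ) = topCoeff s μ := by
  obtain ⟨z, hz⟩ := exists_intCast_eq_topValue (size_addSize μ s)
  rw [topValue_addSize] at hz
  rw [topInt, ← hz, Int.floor_intCast]

theorem structurePolynomial_eq_sum {lam ν : EvenPartition} {s : EvenPart}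
    (hν : size ν = size lam + s.1) : structurePolynomial lam {s} ν =
      ((ν.map fun k => if ν ≤ lam + {k} then topInt s (lam + {k} - ν) else 0).sum : ℤ) := by
  refine structurePolynomial_eq hν ?_
  rw [Int.cast_multiset_sum, Multiset.map_map, topValue]
  congr 1
  refine Multiset.map_congr rfl fun k _ => ?_
  rw [Function.comp_apply, ← cast_topInt]
  split_ifs <;> simp

theorem structurePolynomial_addSize (lam : EvenPartition) (s : EvenPart) :
    structurePolynomial lam {s} {addSize s lam} = (topInt s lam : ℤ) :=
  structurePolynomial_eq (size_addSize lam s) (by rw [cast_topInt, topValue_addSize])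

theorem eq_addSize {lam μ ν : EvenPartition} {s k : EvenPart} (hν : size ν = size lam + s.1)
    (h : μ + ν = lam + {k}) : k = addSize s μ := by
  refine Subtype.ext ?_
  have := congrArg size h
  rw [size_add, size_add, size_singleton] at this
  change k.1 = s.1 + size μ
  omega

/-- The sum runs over positions, so equal parts of ν contribute separately. For a given position, μ
must be λ ∪ (ν_i) - ν, which is available exactly when ν is contained in λ ∪ (ν_i). -/
theorem structurePolynomial_eq_finsum {lam ν : EvenPartition} {s : EvenPart}
    (hν : size ν = size lam + s.1) : structurePolynomial lam {s} ν =
      ∑ᶠ (x : Fin (sortedParts ν).length × EvenPartition)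
        (_ : x.2 + ν = lam + {(sortedParts ν).get x.1}),
        structurePolynomial x.2 {s} {(sortedParts ν).get x.1} := by
  classical
  rw [finsum_cond_eq_sum_of_cond_iff
    (fun x : Fin (sortedParts ν).length × EvenPartition =>
      structurePolynomial x.2 {s} {(sortedParts ν).get x.1})
    (p := fun x => x.2 + ν = lam + {(sortedParts ν).get x.1}) (t := (Finset.univ.filter fun i => ν ≤ lam + {(sortedParts ν).get i}).image
      fun i => (i, lam + {(sortedParts ν).get i} - ν)), Finset.sum_image]
  · rw [Finset.sum_filter, structurePolynomial_eq_sum hν]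
    have h : ∀ f : EvenPart → ℤ,
        (ν.map f).sum = ∑ i, f ((sortedParts ν).get i) := by
      intro f
      have h : ((sortedParts ν : Multiset EvenPart).map f).sum =
          ∑ i, f ((sortedParts ν).get i) := by
        simp [← Fin.sum_univ_fun_getElem]
      rwa [sortedParts, Multiset.sort_eq] at h
    rw [h, Int.cast_sum]
    refine Finset.sum_congr rfl fun i _ => ?_
    split_ifs with hi
    · have h2 : lam + {(sortedParts ν).get i} - ν + ν = lam + {(sortedParts ν).get i} :=
        Multiset.sub_add_cancel hi
      have h3 := structurePolynomial_addSize (lam + {(sortedParts ν).get i} - ν) s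
      rw [← eq_addSize hν h2] at h3
      exact h3.symm
    · simp
  · intro i _ j _ hij
    exact (Prod.ext_iff.1 hij).1
  · rintro ⟨i, μ⟩ -
    simp only [Finset.mem_image, Finset.mem_filter, Finset.mem_univ, true_and, Prod.mk.injEq]
    constructor
    · intro h
      refine ⟨i, ?_, rfl, ?_⟩
      · rw [← h]
        exact Multiset.le_add_left _ _
      · rw [← h, Multiset.add_sub_cancel_right]
    · rintro ⟨j, h1, rfl, rfl⟩
      exact Multiset.sub_add_cancel h1

/-! ### The top degree part of a product -/

theorem le_of_add_eq {lam μ ν : EvenPartition} {k : EvenPart} (hk : k ∈ ν)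
    (h : μ + ν = lam + {k}) : μ ≤ lam := by
  refine Multiset.le_iff_count.2 fun a => ?_
  have h1 := congrArg (Multiset.count a) h
  rw [Multiset.count_add, Multiset.count_add, Multiset.count_singleton] at h1
  split_ifs at h1 with ha
  · have := Multiset.one_le_count_iff_mem.2 (ha ▸ hk)
    omega
  · omega

theorem le_size_of_mem {μ : EvenPartition} {k : EvenPart} (h : k ∈ μ) : k.1 ≤ size μ :=
  Multiset.single_le_sum (fun _ _ => Nat.zero_le _) _ (Multiset.mem_map_of_mem _ h)

/-- The part s + |μ| is larger than every part of μ, so deleting μ leaves all its copies. This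
produces the factor m_{s+|μ|}(λ) + 1. -/
theorem count_addSize {lam μ ν : EvenPartition} {s : EvenPart} (h : μ + ν = lam + {addSize s μ}) :
    ν.count (addSize s μ) = lam.count (addSize s μ) + 1 := by
  have h1 := congrArg (Multiset.count (addSize s μ)) h
  have h2 : addSize s μ ∉ μ := fun hm => by
    have h3 := le_size_of_mem hm
    have h4 := s.2.1
    simp only [addSize] at h3
    omega
  rwa [Multiset.count_add, Multiset.count_add, Multiset.count_singleton_self,
    Multiset.count_eq_zero_of_notMem h2, zero_add] at h1

theorem topInt_eq_zero {s : EvenPart} {μ : EvenPartition} (h : ¬ Multiset.card μ ≤ s.1 + 1) :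
    topInt s μ = 0 := by
  rw [topInt, topCoeff, if_neg h, Int.floor_zero]

/-- The distinct parts k of ν that contribute correspond to the partitions μ contained in λ, by μ =
λ ∪ (k) - ν and k = s + |μ|. The multiplicity of k in ν becomes the coefficient. -/
theorem sum_topInt_eq {lam ν : EvenPartition} {s : EvenPart} (hν : size ν = size lam + s.1) :
    (ν.map fun k => if ν ≤ lam + {k} then topInt s (lam + {k} - ν) else 0).sum =
      ∑ μ ∈ (Finset.Iic lam).filter (fun μ => Multiset.card μ ≤ s.1 + 1),
        if μ + ν = lam + {addSize s μ} then
          ((lam.count (addSize s μ) : ℤ) + 1) * topInt s μ else 0 := by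
  rw [Finset.sum_filter_of_ne, Finset.sum_multiset_map_count, ← Finset.sum_filter]
  · simp only [smul_ite, smul_zero]
    rw [← Finset.sum_filter]
    refine Finset.sum_bij' (fun k _ => lam + {k} - ν) (fun μ _ => addSize s μ) ?_ ?_ ?_ ?_ ?_
    · intro k hk
      rw [Finset.mem_filter, Multiset.mem_toFinset] at hk
      have h := Multiset.sub_add_cancel hk.2
      rw [Finset.mem_filter, Finset.mem_Iic, ← eq_addSize hν h]
      exact ⟨le_of_add_eq hk.1 h, h⟩
    · intro μ hμ
      rw [Finset.mem_filter] at hμ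
      rw [Finset.mem_filter, Multiset.mem_toFinset, ← hμ.2]
      refine ⟨Multiset.one_le_count_iff_mem.1 ?_, Multiset.le_add_left _ _⟩
      rw [count_addSize hμ.2]
      omega
    · intro k hk
      rw [Finset.mem_filter] at hk
      exact (eq_addSize hν (Multiset.sub_add_cancel hk.2)).symm
    · intro μ hμ
      rw [Finset.mem_filter] at hμ
      rw [← hμ.2, Multiset.add_sub_cancel_right]
    · intro k hk
      rw [Finset.mem_filter] at hk
      have h := Multiset.sub_add_cancel hk.2
      have h1 := eq_addSize hν h
      have h2 : lam + {k} - ν + ν = lam + {addSize s (lam + {k} - ν)} := by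
        rw [← h1]
        exact h
      have h2 := count_addSize h2
      rw [← h1] at h2 ⊢
      rw [h2, nsmul_eq_mul]
      push_cast
      rfl
  · intro μ _ h
    by_contra hc
    rw [topInt_eq_zero hc] at h
    simp at h

/-! ### Coordinates and degree of products in 𝒦 -/

theorem coords_d (ν : EvenPartition) : coords (d ν) = Finsupp.single ν 1 :=
  LinearEquiv.apply_symm_apply _ _

theorem coords_d_mul_d (lam μ : EvenPartition) : coords (d lam * d μ) =
    ∑ ν ∈ partitionsUpTo (size lam + size μ), Finsupp.single ν (structurePolynomial lam μ ν) := by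
  change coords ((coords (d lam)).sum fun lam p => (coords (d μ)).sum fun μ q =>
    (p * q) • ∑ ν ∈ partitionsUpTo (size lam + size μ), structurePolynomial lam μ ν • d ν) = _
  rw [coords_d, coords_d, Finsupp.sum_single_index, Finsupp.sum_single_index, one_mul, one_smul,
    map_sum]
  · refine Finset.sum_congr rfl fun ν _ => ?_
    rw [map_smul, coords_d, Finsupp.smul_single, smul_eq_mul, mul_one]
  · rw [mul_zero, zero_smul]
  · simp

theorem coords_d_mul_d_apply (lam μ ν : EvenPartition) : coords (d lam * d μ) ν =
    if size ν ≤ size lam + size μ then structurePolynomial lam μ ν else 0 := by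
  classical
  rw [coords_d_mul_d, Finsupp.finsetSum_apply]
  simp only [Finsupp.single_apply]
  rw [Finset.sum_ite_eq']
  simp [partitionsUpTo]

theorem add_singleton_le_iff {lam : EvenPartition} {s k : EvenPart} :
    lam + {s} ≤ lam + {k} ↔ k = s := by
  rw [add_le_add_iff_left, Multiset.singleton_le, Multiset.mem_singleton, eq_comm]

theorem topInt_zero (s : EvenPart) : topInt s 0 = 1 := by
  have h : (topInt s 0 : ℚ) = 1 := by
    rw [cast_topInt, topCoeff, if_pos (by simp)]
    have : ((s.1 + 1).factorial : ℚ) ≠ 0 := by positivity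
    simp only [Multiset.card_zero, pow_zero, one_mul, tsub_zero, Multiset.toFinset_zero,
      Finset.prod_empty, mul_one]
    rw [div_eq_one_iff_eq this, Nat.factorial_succ]
    simp [size]
  exact_mod_cast h

/-- Only k = s, with μ empty and coefficient 1, contributes; it occurs m_s(λ) + 1 times in λ ∪ (s).
-/
theorem structurePolynomial_add_singleton (lam : EvenPartition) (s : EvenPart) :
    structurePolynomial lam {s} (lam + {s}) = ((lam.count s + 1 : ℤ) : integerValued) := by
  rw [structurePolynomial_eq_sum (by rw [size_add, size_singleton]), Finset.sum_multiset_map_count]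
  simp only [add_singleton_le_iff]
  congr 1
  rw [Finset.sum_eq_single s]
  · rw [if_pos rfl, tsub_self, topInt_zero, Multiset.count_add,
      Multiset.count_singleton_self, nsmul_one]
    push_cast
    rfl
  · intro k _ hk
    rw [if_neg hk, smul_zero]
  · intro h
    simp at h

theorem degree_d_mul_d (lam : EvenPartition) (s : EvenPart) :
    degree (d lam * d {s}) = size lam + s.1 := by
  refine le_antisymm (Finset.sup_le fun ν hν => ?_) ?_
  · rw [Finsupp.mem_support_iff, coords_d_mul_d_apply, size_singleton] at hν
    by_contra h
    rw [if_neg h] at hν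
    exact hν rfl
  · have h : lam + {s} ∈ (coords (d lam * d {s})).support := by
      rw [Finsupp.mem_support_iff, coords_d_mul_d_apply, if_pos (size_add _ _).le,
        structurePolynomial_add_singleton]
      intro h
      have h1 := congrArg Subtype.val h
      rw [coe_intCast_integerValued] at h1
      have h2 : ((lam.count s + 1 : ℤ) : ℚ) = 0 := C_eq_zero.1 h1
      norm_cast at h2
    rw [← size_singleton s, ← size_add]
    exact Finset.le_sup (f := size) h

theorem topPart_d_mul_d (lam : EvenPartition) (s : EvenPart) :
    topPart (d lam * d {s}) =
      ∑ μ ∈ (Finset.Iic lam).filter (fun μ => Multiset.card μ ≤ s.1 + 1),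
        (((lam.count (addSize s μ) : ℤ) + 1) * topInt s μ) • d (lam + {addSize s μ} - μ) := by
  classical
  refine coords.injective (Finsupp.ext fun ν => ?_)
  rw [topPart, LinearEquiv.apply_symm_apply, Finsupp.filter_apply, degree_d_mul_d,
    coords_d_mul_d_apply, map_sum, Finsupp.finsetSum_apply, size_singleton]
  have key : ∀ μ ∈ (Finset.Iic lam).filter (fun μ => Multiset.card μ ≤ s.1 + 1),
      coords ((((lam.count (addSize s μ) : ℤ) + 1) * topInt s μ) • d (lam + {addSize s μ} - μ)) ν =
      ((if μ + ν = lam + {addSize s μ} then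
        ((lam.count (addSize s μ) : ℤ) + 1) * topInt s μ else 0 : ℤ) : integerValued) := by
    intro μ hμ
    rw [Finset.mem_filter, Finset.mem_Iic] at hμ
    have hle : μ ≤ lam + {addSize s μ} := hμ.1.trans (Multiset.le_add_right _ _)
    have hiff : lam + {addSize s μ} - μ = ν ↔ μ + ν = lam + {addSize s μ} := by
      constructor
      · rintro rfl
        exact add_tsub_cancel_of_le hle
      · intro h
        rw [← h, add_tsub_cancel_left]
    rw [map_zsmul, coords_d, Finsupp.smul_apply, Finsupp.single_apply]
    simp only [hiff]
    split_ifs <;> simp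
  rw [Finset.sum_congr rfl key, ← Int.cast_sum]
  split_ifs with h1 h2
  · rw [structurePolynomial_eq_sum h1, sum_topInt_eq h1]
  · exact (h2 h1.le).elim
  -- In lower degree no μ satisfies μ ∪ ν = λ ∪ (s + |μ|), since this equation forces |ν| = |λ| + s.
  · rw [Finset.sum_eq_zero, Int.cast_zero]
    intro μ _
    rw [if_neg]
    intro h
    have h3 := congrArg size h
    rw [size_add, size_add, size_singleton] at h3
    simp only [addSize] at h3
    omega

/-! ### Dominance -/

/-- Among the subpartitions with at most j parts, the j largest parts have the greatest sum. By
induction, exchange some part of t for the head of the list, which is at least as large. -/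
theorem size_le_sum_take {l : List EvenPart} (hl : l.Pairwise fun a b => b ≤ a)
    {t : EvenPartition} (ht : t ≤ (l : Multiset EvenPart)) {j : ℕ} (hj : Multiset.card t ≤ j) :
    size t ≤ ((l.take j).map Subtype.val).sum := by
  induction l generalizing t j with
  | nil =>
    rw [Multiset.coe_nil, Multiset.le_zero] at ht
    subst ht
    simp [size]
  | cons a l ih =>
    rw [List.pairwise_cons] at hl
    by_cases h0 : t = 0
    · subst h0
      simp [size]
    · obtain ⟨b, hb, hba, hbl⟩ : ∃ b ∈ t, b ≤ a ∧ t.erase b ≤ (l : Multiset EvenPart) := by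
        by_cases ha : a ∈ t
        · refine ⟨a, ha, le_rfl, ?_⟩
          rw [Multiset.erase_le_iff_le_cons]
          exact ht
        · obtain ⟨b, hb⟩ := Multiset.exists_mem_of_ne_zero h0
          have h1 : t ≤ (l : Multiset EvenPart) := by
            rw [← Multiset.cons_coe, Multiset.le_cons_of_notMem ha] at ht
            exact ht
          exact ⟨b, hb, hl.1 b (Multiset.mem_of_le h1 hb), (Multiset.erase_le _ _).trans h1⟩
      have hc := Multiset.card_erase_add_one hb
      obtain ⟨j, rfl⟩ : ∃ i, j = i + 1 := ⟨j - 1, by omega⟩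
      have h1 := ih hl.2 hbl (j := j) (by omega)
      have h2 : size t = b.1 + size (t.erase b) := by
        conv_lhs => rw [← Multiset.cons_erase hb, ← Multiset.singleton_add, size_add,
          size_singleton]
      rw [List.take_succ_cons, List.map_cons, List.sum_cons, h2]
      exact add_le_add hba h1

/-- Writing λ = μ ∪ ρ gives ν = ρ ∪ (k) with k = |μ| + s, so ν arises from λ ∪ (s) by merging the
parts of μ ∪ (s) into one. -/
theorem dominates_of_add_eq {lam μ ν : EvenPartition} {s k : EvenPart}
    (hν : size ν = size lam + s.1) (hk : k ∈ ν) (h : μ + ν = lam + {k}) :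
    Dominates ν (lam + {s}) := by
  refine ⟨by rw [hν, size_add, size_singleton], fun j => ?_⟩
  have hks : k.1 = size (μ + {s}) := by
    rw [eq_addSize hν h, size_add, size_singleton]
    exact Nat.add_comm _ _
  obtain ⟨ρ, rfl⟩ := Multiset.le_iff_exists_add.1 (le_of_add_eq hk h)
  have hρ : ν = ρ + {k} := by
    rw [add_assoc] at h
    exact add_left_cancel h
  have hsort : ∀ σ : EvenPartition, (sortedParts σ : Multiset EvenPart) = σ := fun σ =>
    Multiset.sort_eq _ _
  set t : EvenPartition := Multiset.ofList ((sortedParts (μ + ρ + {s})).take j) with ht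
  have ht1 : t ≤ μ + ρ + {s} := by
    rw [← hsort (μ + ρ + {s})]
    exact Multiset.coe_le.2 (List.take_sublist _ _).subperm
  have ht2 : Multiset.card t ≤ j := by
    rw [ht, Multiset.coe_card]
    exact List.length_take_le _ _
  have ht3 : (((sortedParts (μ + ρ + {s})).take j).map Subtype.val).sum = size t := by
    rw [ht, size, Multiset.map_coe, Multiset.sum_coe]
  have ht4 : t - ρ ≤ μ + {s} := by
    rw [tsub_le_iff_right]
    exact ht1.trans (by rw [add_right_comm])
  have ht5 : t = t ∩ ρ + (t - ρ) := by
    rw [add_comm, Multiset.sub_add_inter]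
  have hsorted : (sortedParts ν).Pairwise fun a b => b ≤ a := Multiset.pairwise_sort _ _
  rw [ht3]
  by_cases h0 : t - ρ = 0
  · refine size_le_sum_take hsorted ?_ ht2
    rw [hsort, hρ]
    exact (tsub_eq_zero_iff_le.1 h0).trans (Multiset.le_add_right _ _)
  -- Of the j largest parts of λ ∪ (s), those outside ρ are replaced by the single part k. The sum
  -- does not decrease, as k is the size of μ ∪ (s), and the number of parts does not grow, as at
  -- least one is removed.
  · have h1 : size t ≤ size (t ∩ ρ + {k}) := by
      conv_lhs => rw [ht5]
      rw [size_add, size_add, size_singleton, hks]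
      obtain ⟨r, hr⟩ := Multiset.le_iff_exists_add.1 ht4
      rw [hr, size_add]
      omega
    refine h1.trans (size_le_sum_take hsorted ?_ (le_trans ?_ ht2))
    · rw [hsort, hρ, add_le_add_iff_right]
      exact Multiset.inter_le_right
    · have h2 := congrArg Multiset.card ht5
      have h3 := Multiset.card_pos.2 h0
      rw [Multiset.card_add] at h2 ⊢
      rw [Multiset.card_singleton]
      omega

theorem dominates_of_structurePolynomial_ne_zero {lam ν : EvenPartition} {s : EvenPart}
    (hν : size ν = size lam + s.1) (h : structurePolynomial lam {s} ν ≠ 0) :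
    Dominates ν (lam + {s}) := by
  by_contra hd
  refine h ?_
  rw [structurePolynomial_eq_sum hν, Multiset.sum_eq_zero, Int.cast_zero]
  intro z hz
  obtain ⟨k, hk, rfl⟩ := Multiset.mem_map.1 hz
  rw [if_neg]
  exact fun hle => hd (dominates_of_add_eq hν hk (Multiset.sub_add_cancel hle))

end SpinFH

open SpinFH

theorem mainTheorem10 (lam : EvenPartition) (s : EvenPart) :
    -- the structure constants of top degree are well defined
    (∀ ν : EvenPartition, size ν = size lam + s.1 →
      IsStructurePolynomial lam {s} ν (structurePolynomial lam {s} ν) ∧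
      ∀ p, IsStructurePolynomial lam {s} ν p → p = structurePolynomial lam {s} ν) ∧
    -- the formula for the top degree part of the product of `d_lam` and `d_s`
    (∃ c : EvenPartition → ℤ,
      (∀ μ : EvenPartition, μ ≤ lam → Multiset.card μ ≤ s.1 + 1 →
        (c μ : ℚ) = (-1) ^ Multiset.card μ *
          (((lam.count (addSize s μ) : ℚ) + 1) * ((s.1 : ℚ) + size μ + 1) * s.1.factorial /
            ((s.1 + 1 - Multiset.card μ).factorial *
              ∏ i ∈ μ.toFinset, ((μ.count i).factorial : ℚ)))) ∧
      topPart (d lam * d {s}) =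
        ∑ μ ∈ (Finset.Iic lam).filter (fun μ => Multiset.card μ ≤ s.1 + 1),
          c μ • d (lam + {addSize s μ} - μ)) ∧
    -- the coefficient of a one-part partition
    ((structurePolynomial lam {s} {addSize s lam} : Polynomial ℚ) =
      if Multiset.card lam ≤ s.1 + 1 then
        Polynomial.C ((-1) ^ Multiset.card lam * ((size lam : ℚ) + s.1 + 1) * s.1.factorial /
          ((s.1 + 1 - Multiset.card lam).factorial *
            ∏ i ∈ lam.toFinset, ((lam.count i).factorial : ℚ)))
      else 0) ∧
    -- reduction to one-part partitions
    (∀ ν : EvenPartition, size ν = size lam + s.1 →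
      structurePolynomial lam {s} ν =
        ∑ᶠ (x : Fin (sortedParts ν).length × EvenPartition)
          (_ : x.2 + ν = lam + {(sortedParts ν).get x.1}),
          structurePolynomial x.2 {s} {(sortedParts ν).get x.1}) ∧
    -- triangularity for the dominance order, with positive leading coefficient
    (∀ ν : EvenPartition, size ν = size lam + s.1 →
      structurePolynomial lam {s} ν ≠ 0 → Dominates ν (lam + {s})) ∧
    (∃ c : ℤ, 0 < c ∧
      (structurePolynomial lam {s} (lam + {s}) : Polynomial ℚ) = Polynomial.C (c : ℚ)) := by
  refine ⟨fun ν hν => ?_, ⟨fun μ => ((lam.count (addSize s μ) : ℤ) + 1) * topInt s μ, ?_,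
    topPart_d_mul_d lam s⟩, ?_, fun ν => structurePolynomial_eq_finsum,
    fun ν => dominates_of_structurePolynomial_ne_zero, (lam.count s : ℤ) + 1, by positivity, ?_⟩
  · obtain ⟨z, hz⟩ := exists_intCast_eq_topValue hν
    rw [structurePolynomial_eq hν hz]
    exact ⟨(isStructurePolynomial_iff hν hz _).2 rfl, fun p =>
      (isStructurePolynomial_iff hν hz p).1⟩
  · intro μ _ hμ
    rw [Int.cast_mul, cast_topInt, topCoeff, if_pos hμ]
    push_cast
    ring
  · rw [structurePolynomial_addSize, coe_intCast_integerValued, cast_topInt, topCoeff]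
    split_ifs
    · rfl
    · exact Polynomial.C_0
  · rw [structurePolynomial_add_singleton, coe_intCast_integerValued]
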